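/- **Problem.** An instance for $m$ identical parallel machines consists of $n$ jobs with positive rational processing times $p_1,\dots,p_n$ and a rational setup time $s\ge 0$. A job may be split into finitely many parts, and parts of one job may be processed simultaneously on different machines. A part of length $x>0$ occupies its machine during a time slot of length $s+x$ (first a setup of length $s$, then $x$ units of processing). In a feasible schedule no slot starts before time $0$, slots on the same machine do not overlap, and the lengths of the parts of job $j$ add up to $p_j$. The completion time $C_j$ of job $j$ is the latest finishing time of one of its parts, and $\mathrm{OPT}$ is the minimum (infimum) of $\sum_j C_j$ over all feasible schedules, with real starting times and lengths. **Theorem.** For every fixed number $m\ge 1$ of machines and every fixed real $\varepsilon>0$ there is an algorithm that, given any instance, computes a feasible schedule with $\sum_j C_j\le(1+5\varepsilon)\,\mathrm{OPT}$, in time bounded by a polynomial in the binary encoding length of the instance (on a random access machine with rational arithmetic, under the logarithmic cost criterion). The polynomial may depend on $m$ and $\varepsilon$. More precisely, the computed schedule is the one produced by the following scheme. Number the jobs in SPT order, $p_1\le\dots\le p_n$. Let $K=\max\{0,\,n-\lceil m/\varepsilon\rceil\}$ and $\delta=s+p_K$ ($\delta=0$ if $K=0$). A *round* is determined by guessed loads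 $t_1,\dots,t_m\in\{0,\delta,2\delta,\dots,K\delta\}$ and guessed machine sets $M_j\subseteq\{1,\dots,m\}$ for $j>K$: 1. Jobs $1,\dots,K$ are list scheduled unsplit in SPT order: each job goes to an open machine of least load (of several, the one with the smallest index), where machine $i$ is closed once its load, setups included, is $t_i$ or more. The round is discarded if all machines are closed before job $K$ is assigned. Let $T_i$ be the resulting load of machine $i$ and $\tilde C_1,\dots,\tilde C_K$ the resulting completion times. 2. The schedule is completed by an optimal solution of the linear program, with at most $(m+1)\lceil m/\varepsilon\rceil$ variables $x_{ij}$ ($j>K$, $i\in M_j$) and $C_j$ ($j>K$), $$\min\sum_{j>K}C_j\quad\text{s.t.}\quad \sum_{i\in M_j}x_{ij}=p_j,\qquad T_i+\sum_{K<k\le j,\ i\in M_k}(s+x_{ik})\le C_j\ \ (i\in M_j),\qquad x_{ij},\,C_j\ge0 .$$ The round is discarded if the linear program is infeasible. The scheme takes a round of least value $\sum_{h\le K}\tilde C_h+\sum_{j>K}C_j$ among all rounds that are not discarded, and returns the schedule in which each machine processes its nonempty job parts in SPT order, each with its setup, without idle time. -/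

import Mathlib

open scoped BigOperators

namespace SplitSched

/-! ### The scheduling problem -/

/-- An instance: `n` jobs with positive rational processing times `p j` and a uniform setup
time `s ≥ 0`. The number of machines is a separate parameter, since it is fixed. -/
structure Instance where
  n : ℕ
  p : Fin n → ℚ
  s : ℚ
  p_pos : ∀ j, 0 < p j
  s_nonneg : 0 ≤ s

/-- A job part. It occupies `machine` during `[start, start + s + len]`: a setup of length `s`,
immediately followed by `len` units of processing of `job`. -/
structure Part (m n : ℕ) where
  machine : Fin m
  job : Fin n
  start : ℝ
  len : ℝ

/-- A schedule is a finite collection of job parts; a job may have any number of parts, which may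
be processed simultaneously on different machines. -/
abbrev Schedule (m n : ℕ) := List (Part m n)

/-- The time at which a part is completed, for setup time `s`. -/
def Part.finish {m n : ℕ} (s : ℝ) (a : Part m n) : ℝ := a.start + s + a.len

/-- Feasibility: no part starts before time `0`, parts are nonempty, the time slots (setup and
processing) of two parts on one machine do not overlap, every job is processed completely. -/
structure IsFeasible {m : ℕ} (I : Instance) (σ : Schedule m I.n) : Prop where
  start_nonneg : ∀ a ∈ σ, 0 ≤ a.start
  len_pos : ∀ a ∈ σ, 0 < a.len
  disjoint : σ.Pairwise fun a b => a.machine = b.machine →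
    a.finish I.s ≤ b.start ∨ b.finish I.s ≤ a.start
  total : ∀ j, ((σ.filter fun a => a.job = j).map Part.len).sum = (I.p j : ℝ)

/-- The completion time of job `j`: the latest finishing time of one of its parts. -/
noncomputable def completionTime {m : ℕ} (I : Instance) (σ : Schedule m I.n) (j : Fin I.n) : ℝ :=
  ((σ.filter fun a => a.job = j).map (Part.finish (I.s : ℝ))).foldr max 0

/-- The objective value: the total completion time. -/
noncomputable def totalCompletionTime {m : ℕ} (I : Instance) (σ : Schedule m I.n) : ℝ :=
  ∑ j, completionTime I σ j

/-- The optimal value on `m` machines, over all feasible schedules. -/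
noncomputable def OPT (m : ℕ) (I : Instance) : ℝ :=
  sInf {c | ∃ σ : Schedule m I.n, IsFeasible I σ ∧ totalCompletionTime I σ = c}

/-- The schedule with a part of length `len j i`, starting at `start j i`, of job `j` on machine
`i`, for all `j` and `i` with `len j i > 0`, and no other parts. -/
noncomputable def scheduleOf {m n : ℕ} (len start : Fin n → Fin m → ℝ) : Schedule m n :=
  (List.finRange n).flatMap fun j =>
    ((List.finRange m).filter fun i => 0 < len j i).map fun i => ⟨i, j, start j i, len j i⟩

/-! ### The approximation scheme

In this part `q h` is the processing time of the job in position `h` of the SPT order, where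
positions are counted from `0`. The first `K` positions are `0, …, K - 1`. -/

/-- The number `K = n - m/ε` of jobs that are list scheduled (`m/ε` is rounded up, and `K = 0` if
`n ≤ m/ε`). -/
noncomputable def numFirst (m : ℕ) (ε : ℝ) (n : ℕ) : ℕ := n - ⌈(m : ℝ) / ε⌉₊

/-- `s` plus the processing time of the last one of the first `K` jobs: the step of the grid from
which the machine loads are guessed. -/
noncomputable def gridStep {n : ℕ} (s : ℝ) (q : Fin n → ℝ) (K : ℕ) : ℝ :=
  if h : 0 < K ∧ K ≤ n then s + q ⟨K - 1, by omega⟩ else 0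

/-- The load of machine `i` after the first `h` jobs, if the job in position `k` is processed
unsplit on machine `f k`. -/
noncomputable def listLoad {m n : ℕ} (s : ℝ) (q : Fin n → ℝ) (f : Fin n → Fin m) (h : ℕ)
    (i : Fin m) : ℝ :=
  ∑ k with k.val < h ∧ f k = i, (s + q k)

/-- `f` is the result, on the first `K` jobs, of list scheduling in SPT order with guessed loads
`t`: machine `i` is closed once its load is `t i` or more, and each job is assigned unsplit to an
open machine with the least load (of several such machines, to the first one). There is no such
`f` if all machines get closed too early. -/
def IsListSchedule {m n : ℕ} (s : ℝ) (q : Fin n → ℝ) (K : ℕ) (t : Fin m → ℝ)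
    (f : Fin n → Fin m) : Prop :=
  ∀ h : Fin n, h.val < K →
    listLoad s q f h (f h) < t (f h) ∧
    ∀ i, listLoad s q f h i < t i →
      listLoad s q f h (f h) < listLoad s q f h i ∨
      (listLoad s q f h (f h) = listLoad s q f h i ∧ f h ≤ i)

/-- Feasibility for the linear program that completes the schedule, in the variables `C h` and
`x h i` for `K ≤ h` and `i ∈ M h`. Here machine `i` is available from time `T i` on, and the job in
position `h` may only use the machines in `M h` and is set up on each of them. -/
structure LPFeasible {m n : ℕ} (s : ℝ) (q : Fin n → ℝ) (K : ℕ) (T : Fin m → ℝ)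
    (M : Fin n → Finset (Fin m)) (x : Fin n → Fin m → ℝ) (C : Fin n → ℝ) : Prop where
  total : ∀ h, K ≤ h.val → ∑ i ∈ M h, x h i = q h
  finish : ∀ h, K ≤ h.val → ∀ i ∈ M h,
    T i + ∑ k with K ≤ k.val ∧ k ≤ h ∧ i ∈ M k, (s + x k i) ≤ C h
  x_nonneg : ∀ h, K ≤ h.val → ∀ i ∈ M h, 0 ≤ x h i
  C_nonneg : ∀ h, K ≤ h.val → 0 ≤ C h

/-- The objective of the linear program. -/
noncomputable def lpValue {n : ℕ} (K : ℕ) (C : Fin n → ℝ) : ℝ := ∑ h with K ≤ h.val, C h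

/-- `(x, C)` is an optimal solution of the linear program. -/
def LPOptimal {m n : ℕ} (s : ℝ) (q : Fin n → ℝ) (K : ℕ) (T : Fin m → ℝ)
    (M : Fin n → Finset (Fin m)) (x : Fin n → Fin m → ℝ) (C : Fin n → ℝ) : Prop :=
  LPFeasible s q K T M x C ∧
    ∀ x' C', LPFeasible s q K T M x' C' → lpValue K C ≤ lpValue K C'

/-- The data of one round of the scheme: the guessed loads (as multiples `a i` of the grid step),
the list schedule `f` of the first `K` jobs, the guessed machine sets `M` of the remaining jobs and
a solution `(x, C)` of the linear program. Only `f h` with `h < K`, and only `M h`, `x h i`, `C h`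
with `K ≤ h` and `i ∈ M h` are used. -/
structure Round (m n : ℕ) where
  a : Fin m → ℕ
  f : Fin n → Fin m
  M : Fin n → Finset (Fin m)
  x : Fin n → Fin m → ℝ
  C : Fin n → ℝ

namespace Round

variable {m n : ℕ}

/-- The round is carried out correctly: the first `K` jobs are list scheduled within the guessed
loads, each of which is one of the `K + 1` numbers `0, δ, 2δ, …, Kδ` with `δ` the grid step, and
the schedule is completed by an optimal solution of the linear program for the guessed sets. -/
structure Valid (s : ℝ) (q : Fin n → ℝ) (K : ℕ) (r : Round m n) : Prop where
  guess_le : ∀ i, r.a i ≤ K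
  list : IsListSchedule s q K (fun i => r.a i * gridStep s q K) r.f
  lp : LPOptimal s q K (listLoad s q r.f K) r.M r.x r.C

/-- The value of the round: the total completion time of the list schedule of the first `K` jobs
plus the optimal value of the linear program. -/
noncomputable def value (s : ℝ) (q : Fin n → ℝ) (K : ℕ) (r : Round m n) : ℝ :=
  ∑ h with h.val < K, listLoad s q r.f (h.val + 1) (r.f h) + lpValue K r.C

/-- A valid round of least value among all valid rounds. -/
def IsBest (s : ℝ) (q : Fin n → ℝ) (K : ℕ) (r : Round m n) : Prop :=
  r.Valid s q K ∧ ∀ r' : Round m n, r'.Valid s q K → r.value s q K ≤ r'.value s q K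

/-- The time for which machine `i` processes the job in position `h`. -/
noncomputable def amount (q : Fin n → ℝ) (K : ℕ) (r : Round m n) (h : Fin n) (i : Fin m) : ℝ :=
  if h.val < K then (if r.f h = i then q h else 0) else (if i ∈ r.M h then r.x h i else 0)

/-- The time at which machine `i` starts the setup for the job in position `h`: each machine
processes its nonempty job parts in SPT order without idle time. -/
noncomputable def startTime (s : ℝ) (q : Fin n → ℝ) (K : ℕ) (r : Round m n) (h : Fin n)
    (i : Fin m) : ℝ :=
  ∑ k with k < h ∧ 0 < r.amount q K k i, (s + r.amount q K k i)

end Round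

/-- `σ` is the schedule that the approximation scheme produces for the parameter `ε`: for some
numbering `π` of the jobs in SPT order, it is the schedule of a best round. -/
def IsSchemeOutput {m : ℕ} (ε : ℝ) (I : Instance) (σ : Schedule m I.n) : Prop :=
  ∃ (π : Equiv.Perm (Fin I.n)) (q : Fin I.n → ℝ) (K : ℕ) (r : Round m I.n),
    (q = fun h => (I.p (π h) : ℝ)) ∧ Monotone q ∧ K = numFirst m ε I.n ∧ r.IsBest I.s q K ∧
    σ = scheduleOf (fun j i => r.amount q K (π.symm j) i)
      (fun j i => r.startTime I.s q K (π.symm j) i)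

/-! ### The machine model

A random access machine over the rational numbers with the logarithmic cost criterion, programmed
by structured programs: every instruction costs one plus the bit lengths of the numbers (values and
addresses) that it handles. -/

/-- The bit length of a rational number: sign, numerator and denominator in binary. -/
def bitLength (x : ℚ) : ℕ := 1 + Nat.size x.num.natAbs + Nat.size x.den

/-- The memory: registers `reg a` and arrays `arr b` with cells `arr b 0, arr b 1, …`. A program
names finitely many registers and arrays; array cells are addressed by the contents of registers. -/
structure State where
  reg : ℕ → ℚ
  arr : ℕ → ℕ → ℚ

def State.setReg (S : State) (d : ℕ) (x : ℚ) : State :=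
  { S with reg := Function.update S.reg d x }

def State.setArr (S : State) (b k : ℕ) (x : ℚ) : State :=
  { S with arr := Function.update S.arr b (Function.update (S.arr b) k x) }

/-- The arithmetic operations; a division by zero yields zero. -/
inductive Op
  | add | sub | mul | div

def Op.eval : Op → ℚ → ℚ → ℚ
  | .add, x, y => x + y
  | .sub, x, y => x - y
  | .mul, x, y => x * y
  | .div, x, y => x / y

/-- Programs. -/
inductive Prog
  /-- do nothing -/
  | skip
  /-- `reg d := c` -/
  | const (d : ℕ) (c : ℚ)
  /-- `reg d := reg a ∘ reg b` -/
  | arith (o : Op) (d a b : ℕ)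
  /-- `reg d := arr b [reg a]` -/
  | read (d b a : ℕ)
  /-- `arr b [reg a] := reg d` -/
  | write (b a d : ℕ)
  /-- first `c`, then `c'` -/
  | seq (c c' : Prog)
  /-- if `reg a < reg b` then `c` else `c'` -/
  | ite (a b : ℕ) (c c' : Prog)
  /-- while `reg a < reg b` do `c` -/
  | loop (a b : ℕ) (c : Prog)

/-- `Exec c S S' t`: started in state `S`, the program `c` halts in state `S'`, and the execution
has cost `t`. An access to an array at an address that is not a natural number does not halt. -/
inductive Exec : Prog → State → State → ℕ → Prop
  | skip (S : State) : Exec .skip S S 1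
  | const (S : State) (d : ℕ) (c : ℚ) :
      Exec (.const d c) S (S.setReg d c) (1 + bitLength c)
  | arith (S : State) (o : Op) (d a b : ℕ) :
      Exec (.arith o d a b) S (S.setReg d (o.eval (S.reg a) (S.reg b)))
        (1 + bitLength (S.reg a) + bitLength (S.reg b))
  | read (S : State) (d b a k : ℕ) (hk : S.reg a = (k : ℚ)) :
      Exec (.read d b a) S (S.setReg d (S.arr b k))
        (1 + bitLength (S.reg a) + bitLength (S.arr b k))
  | write (S : State) (b a d k : ℕ) (hk : S.reg a = (k : ℚ)) :
      Exec (.write b a d) S (S.setArr b k (S.reg d))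
        (1 + bitLength (S.reg a) + bitLength (S.reg d))
  | seq {c c' : Prog} {S S' S'' : State} {t t' : ℕ} (h : Exec c S S' t) (h' : Exec c' S' S'' t') :
      Exec (.seq c c') S S'' (t + t')
  | ite_true {a b : ℕ} {c c' : Prog} {S S' : State} {t : ℕ} (hab : S.reg a < S.reg b)
      (h : Exec c S S' t) :
      Exec (.ite a b c c') S S' (1 + bitLength (S.reg a) + bitLength (S.reg b) + t)
  | ite_false {a b : ℕ} {c c' : Prog} {S S' : State} {t : ℕ} (hab : ¬ S.reg a < S.reg b)
      (h : Exec c' S S' t) :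
      Exec (.ite a b c c') S S' (1 + bitLength (S.reg a) + bitLength (S.reg b) + t)
  | loop_true {a b : ℕ} {c : Prog} {S S' S'' : State} {t t' : ℕ} (hab : S.reg a < S.reg b)
      (h : Exec c S S' t) (h' : Exec (.loop a b c) S' S'' t') :
      Exec (.loop a b c) S S'' (1 + bitLength (S.reg a) + bitLength (S.reg b) + t + t')
  | loop_false {a b : ℕ} {c : Prog} {S : State} (hab : ¬ S.reg a < S.reg b) :
      Exec (.loop a b c) S S (1 + bitLength (S.reg a) + bitLength (S.reg b))

/-- The length of the binary encoding of an instance. -/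
def Instance.size (I : Instance) : ℕ :=
  bitLength I.n + bitLength I.s + ∑ j, bitLength (I.p j)

/-- The initial state: `n` in register `0`, `s` in register `1`, the processing times (in the order
in which the instance lists them, which need not be sorted) in array `0`, and zeros elsewhere. -/
def Instance.input (I : Instance) : State where
  reg a := if a = 0 then I.n else if a = 1 then I.s else 0
  arr b k := if h : b = 0 ∧ k < I.n then I.p ⟨k, h.2⟩ else 0

/-- The schedule described by a final state: cell `j * m + i` of array `1` holds the length of the
part of job `j` on machine `i` (no part, if it is not positive), and the same cell of array `2`
holds its starting time. -/
noncomputable def outputSchedule (m n : ℕ) (S : State) : Schedule m n :=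
  scheduleOf (fun j i => (S.arr 1 (j.val * m + i.val) : ℝ))
    (fun j i => (S.arr 2 (j.val * m + i.val) : ℝ))

end SplitSched

/-! The guarantee compares the best round with an arbitrary feasible schedule.

Normal form. Of a schedule only the order of completion and the amount of each job on each machine
matter: sorted by completion time, these data form a feasible point of the linear program with `K =
0` and the same objective (`IsFeasible.exists_sequence`). An exchange argument brings the jobs into
SPT order at no cost (`exists_redistribution`, `LPFeasible.swap`, `LPFeasible.exists_spt`). If a
longer job precedes a shorter one and they share a machine, the shorter one takes over early work of
the longer one; if this cuts a part in two, the setup saved on the shared machine pays for the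
additional one.

Upper bound. Round the time that each machine spends on the first K jobs up to the grid and take
this as the guess. List scheduling then starts the job in position h no later than the corresponding
smallest completion time among the first K jobs (`LPFeasible.sum_listLoad_le`), so these jobs lose
in total at most W, the sum of `s + p_k` over them. Rounding and the last job on a machine increase
its load by at most `2δ`, so the remaining r = n - K jobs can keep their amounts and finish at most
`2δ` later.

Lower bound. The jobs completed by time c need at most m·c machine time, so m times the optimum is
at least the sum of the work of all initial segments (`LPFeasible.sum_prefix_le`). The last r
segments contribute at least r·W, and also at least `δ·r(r+1)/2` (`le_sum_prefix`). If `K > 0` then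
r ≥ m/ε, so W is at most ε times and 2rδ at most 4ε times the cost of the schedule, which gives 1 +
5ε (`LPFeasible.exists_round`). If `K = 0`, nothing is lost.

Running time. For fixed m and ε the linear programs have bounded size and fixed coefficients; only
the right-hand sides depend on the instance. Fourier–Motzkin elimination with the right-hand sides
as parameters yields finitely many rational linear maps, one of which gives an optimal solution
whenever there is a feasible one (`exists_param_optimal`, `Candidate.exists_list`). The program
contains this list. In each of the `(K+1)^m` guesses of the loads it evaluates all candidates and
keeps the cheapest feasible one; optimality for its linear program is then automatic
(`BestState.exists_isBest`). All numbers have a common denominator and polynomially bounded weight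
(`Adm.bitLength_le`). The program is verified in a small loop language by weakest preconditions and
compiled to the machine (`Cmd.exec_compile`). -/

namespace SplitSched

/-! ### Bit lengths -/

theorem one_le_bitLength (x : ℚ) : 1 ≤ bitLength x := by
  unfold bitLength; omega

theorem natSize_mul_le (a b : ℕ) : Nat.size (a * b) ≤ Nat.size a + Nat.size b := by
  rw [Nat.size_le, pow_add]
  exact Nat.mul_lt_mul'' (Nat.lt_size_self a) (Nat.lt_size_self b)

theorem natSize_add_le (a b : ℕ) : Nat.size (a + b) ≤ 1 + Nat.size a + Nat.size b := by
  rw [Nat.size_le]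
  have ha := Nat.lt_size_self a
  have hb := Nat.lt_size_self b
  have h1 : 2 ^ Nat.size a ≤ 2 ^ (Nat.size a + Nat.size b) :=
    Nat.pow_le_pow_right (by norm_num) (by omega)
  have h2 : 2 ^ Nat.size b ≤ 2 ^ (Nat.size a + Nat.size b) :=
    Nat.pow_le_pow_right (by norm_num) (by omega)
  have h3 : 2 ^ (1 + Nat.size a + Nat.size b) = 2 * 2 ^ (Nat.size a + Nat.size b) := by
    rw [add_assoc, pow_add]; norm_num
  omega

/-- The bit length of a fraction is at most the one of any representation of it. -/
theorem bitLength_le_of_mul_eq {x : ℚ} {e : ℕ} {z : ℤ} (he : 0 < e) (h : x * e = z) :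
    bitLength x ≤ 1 + Nat.size z.natAbs + Nat.size e := by
  have he' : (e : ℚ) ≠ 0 := by positivity
  have hx : x = Rat.divInt z e := by
    rw [Rat.divInt_eq_div, eq_div_iff (by exact_mod_cast he'), ← h]; norm_cast
  have h1 : x.den ≤ e := by
    have := Rat.den_dvd z e
    rw [← hx] at this
    exact Nat.le_of_dvd he (by exact_mod_cast this)
  have h2 : x.num.natAbs ≤ z.natAbs := by
    rcases eq_or_ne z 0 with rfl | hz
    · have : x = 0 := by rw [hx]; simp
      simp [this]
    · have := Rat.num_dvd z (b := e) (by exact_mod_cast he.ne')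
      rw [← hx] at this
      exact Nat.le_of_dvd (Int.natAbs_pos.mpr hz) (Int.natAbs_dvd_natAbs.mpr this)
  have h3 := Nat.size_le_size h1
  have h4 := Nat.size_le_size h2
  unfold bitLength
  omega

theorem bitLength_mul_le (x y : ℚ) : bitLength (x * y) ≤ 2 * (bitLength x + bitLength y) := by
  have h : (x * y) * ((x.den * y.den : ℕ) : ℚ) = ((x.num * y.num : ℤ) : ℚ) := by
    push_cast
    nth_rewrite 1 [← Rat.num_div_den x, ← Rat.num_div_den y]
    field_simp
  have h1 := bitLength_le_of_mul_eq (Nat.mul_pos x.den_pos y.den_pos) h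
  have h2 := natSize_mul_le x.den y.den
  have h3 := natSize_mul_le x.num.natAbs y.num.natAbs
  rw [Int.natAbs_mul] at h1
  unfold bitLength at *
  omega

theorem bitLength_add_le (x y : ℚ) : bitLength (x + y) ≤ 2 * (bitLength x + bitLength y) := by
  have h : (x + y) * ((x.den * y.den : ℕ) : ℚ) = ((x.num * y.den + y.num * x.den : ℤ) : ℚ) := by
    push_cast
    nth_rewrite 1 [← Rat.num_div_den x, ← Rat.num_div_den y]
    field_simp
  have h1 := bitLength_le_of_mul_eq (Nat.mul_pos x.den_pos y.den_pos) h
  have h2 := natSize_mul_le x.den y.den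
  have h3 := natSize_mul_le x.num.natAbs y.den
  have h4 := natSize_mul_le y.num.natAbs x.den
  have h5 := natSize_add_le (x.num.natAbs * y.den) (y.num.natAbs * x.den)
  have h6 : (x.num * y.den + y.num * x.den).natAbs ≤
      x.num.natAbs * y.den + y.num.natAbs * x.den := by
    refine (Int.natAbs_add_le _ _).trans ?_
    simp [Int.natAbs_mul]
  have h7 := Nat.size_le_size h6
  unfold bitLength at *
  omega

/-! ### A language with expressions and counting loops -/

/-- Expressions: variables, constants, sums, products, array cells. -/
inductive Exp
  | var (v : ℕ)
  | lit (c : ℚ)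
  | add (e e' : Exp)
  | mul (e e' : Exp)
  | get (b : ℕ) (e : Exp)

namespace Exp

/-- The floor only makes the address total. Under `ok` the address is a natural number and the floor
does nothing. -/
def eval (σ : State) : Exp → ℚ
  | var v => σ.reg v
  | lit c => c
  | add e e' => e.eval σ + e'.eval σ
  | mul e e' => e.eval σ * e'.eval σ
  | get b e => σ.arr b ⌊e.eval σ⌋₊

/-- All addresses in the expression are natural numbers. -/
def ok (σ : State) : Exp → Prop
  | var _ => True
  | lit _ => True
  | add e e' => e.ok σ ∧ e'.ok σ
  | mul e e' => e.ok σ ∧ e'.ok σ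
  | get _ e => e.ok σ ∧ ∃ k : ℕ, e.eval σ = k

/-- Evaluation into the register `2 * d + 1`; variable `v` is kept in register `2 * v`. -/
def comp : Exp → ℕ → Prog
  | var v, d => .seq (.const (2 * d + 1) 0) (.arith .add (2 * d + 1) (2 * d + 1) (2 * v))
  | lit c, d => .const (2 * d + 1) c
  | add e e', d => .seq (e.comp d) (.seq (e'.comp (d + 1))
      (.arith .add (2 * d + 1) (2 * d + 1) (2 * (d + 1) + 1)))
  | mul e e', d => .seq (e.comp d) (.seq (e'.comp (d + 1))
      (.arith .mul (2 * d + 1) (2 * d + 1) (2 * (d + 1) + 1)))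
  | get b e, d => .seq (e.comp d) (.read (2 * d + 1) b (2 * d + 1))

/-- The factor by which the value may be longer than the contents of the memory. -/
def growth : Exp → ℕ
  | var _ => 1
  | lit c => bitLength c
  | add e e' => 2 * (e.growth + e'.growth)
  | mul e e' => 2 * (e.growth + e'.growth)
  | get _ _ => 1

/-- The evaluation time in units of the bit length of the contents of the memory. -/
def time : Exp → ℕ
  | var _ => 7
  | lit c => 1 + bitLength c
  | add e e' => e.time + e'.time + (1 + e.growth + e'.growth)
  | mul e e' => e.time + e'.time + (1 + e.growth + e'.growth)
  | get _ e => e.time + (2 + e.growth)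

end Exp

/-- All numbers in the memory have bit length at most `B`. -/
def State.Bdd (B : ℕ) (σ : State) : Prop :=
  (∀ v, bitLength (σ.reg v) ≤ B) ∧ ∀ b k, bitLength (σ.arr b k) ≤ B

/-- The state `S` of the machine represents the state `σ` of the language. -/
def State.Rel (σ S : State) : Prop := (∀ v, S.reg (2 * v) = σ.reg v) ∧ S.arr = σ.arr

theorem State.Rel.setTemp {σ S : State} (h : σ.Rel S) (d : ℕ) (x : ℚ) :
    σ.Rel (S.setReg (2 * d + 1) x) := by
  refine ⟨fun v => ?_, h.2⟩
  have : 2 * v ≠ 2 * d + 1 := by omega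
  simp [State.setReg, this, h.1]

theorem State.Rel.setVar {σ S : State} (h : σ.Rel S) (v : ℕ) (x : ℚ) :
    (σ.setReg v x).Rel (S.setReg (2 * v) x) := by
  refine ⟨fun w => ?_, h.2⟩
  simp [State.setReg, Function.update_apply, h.1]

theorem State.Rel.setArr {σ S : State} (h : σ.Rel S) (b k : ℕ) (x : ℚ) :
    (σ.setArr b k x).Rel (S.setArr b k x) := by
  refine ⟨h.1, ?_⟩
  simp [State.setArr, h.2]

theorem bitLength_zero : bitLength 0 = 2 := by simp [bitLength, Nat.size_one]

theorem bitLength_one : bitLength 1 = 3 := by simp [bitLength, Nat.size_one]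

namespace Exp

theorem bitLength_eval_le {B : ℕ} (hB : 1 ≤ B) {σ : State} (hσ : σ.Bdd B) (e : Exp) :
    bitLength (e.eval σ) ≤ e.growth * B := by
  induction e with
  | var v => simpa [eval, growth] using hσ.1 v
  | lit c => simpa [eval, growth] using Nat.le_mul_of_pos_right _ hB
  | add e e' h h' =>
    refine (bitLength_add_le _ _).trans ?_
    simp only [growth]; nlinarith
  | mul e e' h h' =>
    refine (bitLength_mul_le _ _).trans ?_
    simp only [growth]; nlinarith
  | get b e _ => simpa [eval, growth] using hσ.2 b _

/-- Variables live in even registers, intermediate results in odd ones. Evaluation at depth `d`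
preserves the odd registers of smaller depth, so the first operand survives the evaluation of the
second one at depth `d + 1`. -/
theorem exec_comp {B : ℕ} (hB : 1 ≤ B) {σ : State} (hσ : σ.Bdd B) (e : Exp) (he : e.ok σ) :
    ∀ (d : ℕ) (S : State), σ.Rel S → ∃ S' t, Exec (e.comp d) S S' t ∧ t ≤ e.time * B ∧
      σ.Rel S' ∧ S'.reg (2 * d + 1) = e.eval σ ∧
      ∀ d' < d, S'.reg (2 * d' + 1) = S.reg (2 * d' + 1) := by
  induction e with
  | var v =>
    intro d S hS
    refine ⟨_, _, .seq (.const _ _ _) (.arith _ _ _ _ _), ?_, (hS.setTemp _ _).setTemp _ _, ?_, ?_⟩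
    · have h1 : (S.setReg (2 * d + 1) 0).reg (2 * v) = σ.reg v := (hS.setTemp d 0).1 v
      have h2 : (S.setReg (2 * d + 1) 0).reg (2 * d + 1) = 0 := by simp [State.setReg]
      rw [h1, h2, bitLength_zero]
      have := hσ.1 v
      simp only [time]
      omega
    · have : 2 * v ≠ 2 * d + 1 := by omega
      simp [State.setReg, Op.eval, this, hS.1, eval]
    · intro d' hd'
      have : d' ≠ d := by omega
      simp [State.setReg, this]
  | lit c =>
    intro d S hS
    refine ⟨_, _, .const _ _ _, ?_, hS.setTemp _ _, ?_, ?_⟩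
    · exact Nat.le_mul_of_pos_right _ hB
    · simp [State.setReg, eval]
    · intro d' hd'
      have : d' ≠ d := by omega
      simp [State.setReg, this]
  | add e e' ih ih' =>
    intro d S hS
    obtain ⟨S1, t1, h1, ht1, hr1, hv1, hf1⟩ := ih he.1 d S hS
    obtain ⟨S2, t2, h2, ht2, hr2, hv2, hf2⟩ := ih' he.2 (d + 1) S1 hr1
    have hv : S2.reg (2 * d + 1) = e.eval σ := by rw [hf2 d (by omega), hv1]
    refine ⟨_, _, .seq h1 (.seq h2 (.arith _ _ _ _ _)), ?_, hr2.setTemp _ _, ?_, ?_⟩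
    · have g1 := bitLength_eval_le hB hσ e
      have g2 := bitLength_eval_le hB hσ e'
      rw [hv, hv2]
      simp only [time]
      nlinarith
    · simp [State.setReg, Op.eval, hv, hv2, eval]
    · intro d' hd'
      have : d' ≠ d := by omega
      simp [State.setReg, this, hf2 d' (by omega), hf1 d' hd']
  | mul e e' ih ih' =>
    intro d S hS
    obtain ⟨S1, t1, h1, ht1, hr1, hv1, hf1⟩ := ih he.1 d S hS
    obtain ⟨S2, t2, h2, ht2, hr2, hv2, hf2⟩ := ih' he.2 (d + 1) S1 hr1
    have hv : S2.reg (2 * d + 1) = e.eval σ := by rw [hf2 d (by omega), hv1]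
    refine ⟨_, _, .seq h1 (.seq h2 (.arith _ _ _ _ _)), ?_, hr2.setTemp _ _, ?_, ?_⟩
    · have g1 := bitLength_eval_le hB hσ e
      have g2 := bitLength_eval_le hB hσ e'
      rw [hv, hv2]
      simp only [time]
      nlinarith
    · simp [State.setReg, Op.eval, hv, hv2, eval]
    · intro d' hd'
      have : d' ≠ d := by omega
      simp [State.setReg, this, hf2 d' (by omega), hf1 d' hd']
  | get b e ih =>
    intro d S hS
    obtain ⟨S1, t1, h1, ht1, hr1, hv1, hf1⟩ := ih he.1 d S hS
    obtain ⟨k, hk⟩ := he.2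
    refine ⟨_, _, .seq h1 (.read _ _ _ _ k (hv1.trans hk)), ?_, hr1.setTemp _ _, ?_, ?_⟩
    · have g1 := bitLength_eval_le hB hσ e
      have g2 := hσ.2 b k
      rw [hv1, hr1.2]
      simp only [time]
      nlinarith
    · simp [State.setReg, eval, hk, hr1.2]
    · intro d' hd'
      have : d' ≠ d := by omega
      simp [State.setReg, this, hf1 d' hd']

end Exp

/-- Commands. In `cfor v w c`, variable `v` counts from `0` to the value of variable `w`. -/
inductive Cmd
  | skip
  | set (v : ℕ) (e : Exp)
  | put (b : ℕ) (e e' : Exp)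
  | seq (c c' : Cmd)
  | ite (e e' : Exp) (c c' : Cmd)
  | cfor (v w : ℕ) (c : Cmd)

namespace Cmd

/-- The variables that a command may change. -/
def wreg : Cmd → ℕ → Prop
  | skip, _ => False
  | set v _, u => u = v
  | put _ _ _, _ => False
  | seq c c', u => c.wreg u ∨ c'.wreg u
  | ite _ _ c c', u => c.wreg u ∨ c'.wreg u
  | cfor v _ c, u => u = v ∨ c.wreg u

/-- The arrays that a command may change. -/
def warr : Cmd → ℕ → Prop
  | skip, _ => False
  | set _ _, _ => False
  | put b _ _, u => u = b
  | seq c c', u => c.warr u ∨ c'.warr u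
  | ite _ _ c c', u => c.warr u ∨ c'.warr u
  | cfor _ _ c, u => c.warr u

/-- The states agree on everything that the command does not change. -/
def Agree (c : Cmd) (σ τ : State) : Prop :=
  (∀ v, ¬ c.wreg v → τ.reg v = σ.reg v) ∧ ∀ b, ¬ c.warr b → τ.arr b = σ.arr b

/-- Weakest precondition: from `σ`, the command `c` leads to a state in `Q`, where loops are
executed at most `N` times and all assigned numbers have bit length at most `B`. -/
def wp (B N : ℕ) : Cmd → (State → Prop) → State → Prop
  | skip, Q, σ => Q σ
  | set v e, Q, σ => e.ok σ ∧ bitLength (e.eval σ) ≤ B ∧ Q (σ.setReg v (e.eval σ))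
  | put b e e', Q, σ => e.ok σ ∧ e'.ok σ ∧ ∃ k : ℕ, e.eval σ = k ∧ bitLength (e'.eval σ) ≤ B ∧
      Q (σ.setArr b k (e'.eval σ))
  | seq c c', Q, σ => wp B N c (wp B N c' Q) σ
  | ite e e' c c', Q, σ => e.ok σ ∧ e'.ok σ ∧ (e.eval σ < e'.eval σ → wp B N c Q σ) ∧
      (¬ e.eval σ < e'.eval σ → wp B N c' Q σ)
  | cfor v w c, Q, σ => v ≠ w ∧ ¬ c.wreg v ∧ ¬ c.wreg w ∧ ∃ k : ℕ, σ.reg w = k ∧ k ≤ N ∧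
      ∃ Inv : ℕ → State → Prop, Inv 0 σ ∧
        (∀ i < k, ∀ τ, Inv i τ → wp B N c (Inv (i + 1)) (τ.setReg v i)) ∧
        ∀ τ, Inv k τ → Q (τ.setReg v k)

/-- No intermediate result is needed beyond the command that computes it, so every command starts
again at depth 0, and the loop uses the same register for its increment. -/
def compile : Cmd → Prog
  | skip => .skip
  | set v e => .seq (e.comp 0) (.seq (.const (2 * v) 0) (.arith .add (2 * v) (2 * v) (2 * 0 + 1)))
  | put b e e' => .seq (e.comp 0) (.seq (e'.comp 1) (.write b (2 * 0 + 1) (2 * 1 + 1)))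
  | seq c c' => .seq c.compile c'.compile
  | ite e e' c c' => .seq (e.comp 0) (.seq (e'.comp 1)
      (.ite (2 * 0 + 1) (2 * 1 + 1) c.compile c'.compile))
  | cfor v w c => .seq (.const (2 * v) 0) (.loop (2 * v) (2 * w)
      (.seq c.compile (.seq (.const (2 * 0 + 1) 1) (.arith .add (2 * v) (2 * v) (2 * 0 + 1)))))

/-- A time bound in units of the bit length of the contents of the memory, if all loops are
executed at most `N` times. -/
def time (N : ℕ) : Cmd → ℕ
  | skip => 1
  | set _ e => e.time + (6 + e.growth)
  | put _ e e' => e.time + e'.time + (1 + e.growth + e'.growth)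
  | seq c c' => c.time N + c'.time N
  | ite e e' c c' => e.time + e'.time + (1 + e.growth + e'.growth) + (c.time N + c'.time N)
  -- With bit lengths at most `B`, the test, the constant and the increment of one iteration cost at
  -- most `9 + 3 * B ≤ 12 * B`. The initialization and the last test cost at most `3 * B` each.
  | cfor _ _ c => 6 + N * (c.time N + 12)

theorem wp_mono {B N : ℕ} {c : Cmd} {Q Q' : State → Prop} {σ : State} (h : wp B N c Q σ)
    (hQ : ∀ τ, Q τ → Q' τ) : wp B N c Q' σ := by
  induction c generalizing Q Q' σ with
  | skip => exact hQ _ h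
  | set v e => exact ⟨h.1, h.2.1, hQ _ h.2.2⟩
  | put b e e' =>
    obtain ⟨h1, h2, k, h3, h4, h5⟩ := h
    exact ⟨h1, h2, k, h3, h4, hQ _ h5⟩
  | seq c c' ih ih' => exact ih h fun τ hτ => ih' hτ hQ
  | ite e e' c c' ih ih' => exact ⟨h.1, h.2.1, fun hl => ih (h.2.2.1 hl) hQ,
      fun hl => ih' (h.2.2.2 hl) hQ⟩
  | cfor v w c ih =>
    obtain ⟨h1, h2, h3, k, h4, h5, Inv, h6, h7, h8⟩ := h
    exact ⟨h1, h2, h3, k, h4, h5, Inv, h6, h7, fun τ hτ => hQ _ (h8 τ hτ)⟩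

theorem Agree.refl (c : Cmd) (σ : State) : c.Agree σ σ := ⟨fun _ _ => rfl, fun _ _ => rfl⟩

/-- What a command leaves unchanged is visible from its syntax, so `Agree` can be added to every
postcondition. Loop invariants then only have to mention what the loop changes. -/
theorem wp_frame {B N : ℕ} {c : Cmd} {Q : State → Prop} {σ : State} (h : wp B N c Q σ) :
    wp B N c (fun τ => Q τ ∧ c.Agree σ τ) σ := by
  induction c generalizing Q σ with
  | skip => exact ⟨h, Agree.refl _ _⟩
  | set v e =>
    refine ⟨h.1, h.2.1, h.2.2, fun u hu => ?_, fun _ _ => rfl⟩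
    have : u ≠ v := hu
    simp [State.setReg, this]
  | put b e e' =>
    obtain ⟨h1, h2, k, h3, h4, h5⟩ := h
    refine ⟨h1, h2, k, h3, h4, h5, fun _ _ => rfl, fun u hu => ?_⟩
    have : u ≠ b := hu
    simp [State.setArr, this]
  | seq c c' ih ih' =>
    change wp B N c (wp B N c' _) σ
    refine wp_mono (c := c) (ih h) fun τ hτ => wp_mono (c := c') (ih' hτ.1) fun ρ hρ =>
      ⟨hρ.1, fun v hv => ?_, fun b hb => ?_⟩
    · simp only [wreg, not_or] at hv
      rw [hρ.2.1 v hv.2, hτ.2.1 v hv.1]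
    · simp only [warr, not_or] at hb
      rw [hρ.2.2 b hb.2, hτ.2.2 b hb.1]
  | ite e e' c c' ih ih' =>
    refine ⟨h.1, h.2.1, fun hl => wp_mono (ih (h.2.2.1 hl)) ?_,
      fun hl => wp_mono (ih' (h.2.2.2 hl)) ?_⟩
    · exact fun τ hτ => ⟨hτ.1, fun v hv => hτ.2.1 v fun h => hv (.inl h),
        fun b hb => hτ.2.2 b fun h => hb (.inl h)⟩
    · exact fun τ hτ => ⟨hτ.1, fun v hv => hτ.2.1 v fun h => hv (.inr h),
        fun b hb => hτ.2.2 b fun h => hb (.inr h)⟩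
  | cfor v w c ih =>
    obtain ⟨h1, h2, h3, k, h4, h5, Inv, h6, h7, h8⟩ := h
    have hset : ∀ (τ : State) (x : ℚ), (cfor v w c).Agree σ τ →
        (cfor v w c).Agree σ (τ.setReg v x) := by
      intro τ x hτ
      refine ⟨fun u hu => ?_, hτ.2⟩
      have huv : u ≠ v := fun h => hu (.inl h)
      simp [State.setReg, huv, hτ.1 u hu]
    refine ⟨h1, h2, h3, k, h4, h5, fun i τ => Inv i τ ∧ (cfor v w c).Agree σ τ,
      ⟨h6, Agree.refl _ _⟩, fun i hi τ hτ => ?_, fun τ hτ => ⟨h8 τ hτ.1, hset _ _ hτ.2⟩⟩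
    refine wp_mono (ih (h7 i hi τ hτ.1)) fun ρ hρ => ⟨hρ.1, ?_⟩
    have := hset τ i hτ.2
    exact ⟨fun u hu => by rw [hρ.2.1 u fun h => hu (.inr h), this.1 u hu],
      fun b hb => by rw [hρ.2.2 b hb, this.2 b hb]⟩

/-- The rule for sequences, with the unchanged part of the state made available. -/
theorem wp_seq {B N : ℕ} {c c' : Cmd} {R Q : State → Prop} {σ : State} (h : wp B N c R σ)
    (h' : ∀ τ, R τ → c.Agree σ τ → wp B N c' Q τ) : wp B N (seq c c') Q σ :=
  wp_mono (c := c) (wp_frame h) fun τ hτ => h' τ hτ.1 hτ.2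

/-- The rule for loops, with the unchanged part of the state made available. -/
theorem wp_cfor {B N : ℕ} {v w : ℕ} {c : Cmd} {Q : State → Prop} {σ : State} (hvw : v ≠ w)
    (hv : ¬ c.wreg v) (hw : ¬ c.wreg w) (k : ℕ) (hk : σ.reg w = k) (hkN : k ≤ N)
    (Inv : ℕ → State → Prop) (h0 : Inv 0 σ)
    (hstep : ∀ i < k, ∀ τ, Inv i τ → (cfor v w c).Agree σ τ → wp B N c (Inv (i + 1)) (τ.setReg v i))
    (hend : ∀ τ, Inv k τ → (cfor v w c).Agree σ τ → Q (τ.setReg v k)) :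
    wp B N (cfor v w c) Q σ := by
  refine ⟨hvw, hv, hw, k, hk, hkN, fun i τ => Inv i τ ∧ (cfor v w c).Agree σ τ,
    ⟨h0, Agree.refl _ _⟩, fun i hi τ hτ => ?_, fun τ hτ => hend τ hτ.1 hτ.2⟩
  refine wp_mono (wp_frame (hstep i hi τ hτ.1 hτ.2)) fun ρ hρ => ⟨hρ.1, ?_⟩
  refine ⟨fun u hu => ?_, fun b hb => by rw [hρ.2.2 b hb, ← hτ.2.2 b hb]; rfl⟩
  have huv : u ≠ v := fun h => hu (.inl h)
  rw [hρ.2.1 u fun h => hu (.inr h), ← hτ.2.1 u hu]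
  simp [State.setReg, huv]

theorem _root_.SplitSched.State.Bdd.setReg {B : ℕ} {σ : State} (h : σ.Bdd B) (v : ℕ) {x : ℚ}
    (hx : bitLength x ≤ B) : (σ.setReg v x).Bdd B := by
  refine ⟨fun u => ?_, h.2⟩
  by_cases huv : u = v
  · subst huv; simpa [State.setReg] using hx
  · simpa [State.setReg, huv] using h.1 u

theorem _root_.SplitSched.State.Bdd.setArr {B : ℕ} {σ : State} (h : σ.Bdd B) (b k : ℕ) {x : ℚ}
    (hx : bitLength x ≤ B) : (σ.setArr b k x).Bdd B := by
  refine ⟨h.1, fun b' k' => ?_⟩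
  by_cases hb : b' = b
  · subst hb
    by_cases hk : k' = k
    · subst hk; simpa [State.setArr] using hx
    · simpa [State.setArr, hk] using h.2 b' k'
  · simpa [State.setArr, hb] using h.2 b' k'

/-- `wp` bounds every assigned number by `B`, and `hN` bounds the loop counters. So `Bdd` persists,
every value handled has length at most a constant times `B`, and the cost is a number of such units.
-/
theorem exec_compile {B N : ℕ} (hN : ∀ i ≤ N, bitLength (i : ℚ) ≤ B) {c : Cmd}
    {Q : State → Prop} {σ S : State} (h : wp B N c Q σ) (hσ : σ.Bdd B) (hS : σ.Rel S) :
    ∃ τ S' t, Exec c.compile S S' t ∧ t ≤ c.time N * B ∧ State.Rel τ S' ∧ State.Bdd B τ ∧ Q τ := by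
  have hB : 1 ≤ B := (one_le_bitLength _).trans (hN 0 (Nat.zero_le _))
  induction c generalizing Q σ S with
  | skip => exact ⟨σ, S, _, .skip _, by simpa [time] using hB, hS, hσ, h⟩
  | set v e =>
    obtain ⟨S1, t1, h1, ht1, hr1, hv1, -⟩ := e.exec_comp hB hσ h.1 0 S hS
    have hr2 := hr1.setVar v 0
    have e1 : (S1.setReg (2 * v) 0).reg (2 * v) = 0 := by simp [State.setReg]
    have e2 : (S1.setReg (2 * v) 0).reg (2 * 0 + 1) = e.eval σ := by
      rw [← hv1]
      have : 2 * 0 + 1 ≠ 2 * v := by omega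
      simp only [State.setReg, Function.update_apply, if_neg this]
    refine ⟨σ.setReg v (e.eval σ), _, _, .seq h1 (.seq (.const _ _ _) (.arith _ _ _ _ _)), ?_, ?_,
      hσ.setReg v h.2.1, h.2.2⟩
    · rw [e1, e2, bitLength_zero]
      have := e.bitLength_eval_le hB hσ
      simp only [time]
      nlinarith
    · rw [e1, e2]
      simpa [Op.eval, State.setReg] using hr1.setVar v (e.eval σ)
  | put b e e' =>
    obtain ⟨ho, ho', k, hk, hb, hQ⟩ := h
    obtain ⟨S1, t1, h1, ht1, hr1, hv1, -⟩ := e.exec_comp hB hσ ho 0 S hS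
    obtain ⟨S2, t2, h2, ht2, hr2, hv2, hf2⟩ := e'.exec_comp hB hσ ho' 1 S1 hr1
    have hv : S2.reg (2 * 0 + 1) = e.eval σ := by rw [hf2 0 (by omega), hv1]
    refine ⟨σ.setArr b k (e'.eval σ), _, _, .seq h1 (.seq h2 (.write _ _ _ _ k (hv.trans hk))), ?_,
      ?_, hσ.setArr b k hb, hQ⟩
    · rw [hv, hv2]
      have g1 := e.bitLength_eval_le hB hσ
      have g2 := e'.bitLength_eval_le hB hσ
      simp only [time]
      nlinarith
    · rw [hv2]
      exact hr2.setArr b k _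
  | seq c c' ih ih' =>
    obtain ⟨τ, S1, t1, h1, ht1, hr1, hb1, hQ1⟩ := ih h hσ hS
    obtain ⟨ρ, S2, t2, h2, ht2, hr2, hb2, hQ2⟩ := ih' hQ1 hb1 hr1
    refine ⟨ρ, S2, _, .seq h1 h2, ?_, hr2, hb2, hQ2⟩
    simp only [time]
    nlinarith
  | ite e e' c c' ih ih' =>
    obtain ⟨ho, ho', hc, hc'⟩ := h
    obtain ⟨S1, t1, h1, ht1, hr1, hv1, -⟩ := e.exec_comp hB hσ ho 0 S hS
    obtain ⟨S2, t2, h2, ht2, hr2, hv2, hf2⟩ := e'.exec_comp hB hσ ho' 1 S1 hr1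
    have hv : S2.reg (2 * 0 + 1) = e.eval σ := by rw [hf2 0 (by omega), hv1]
    have g1 := e.bitLength_eval_le hB hσ
    have g2 := e'.bitLength_eval_le hB hσ
    by_cases hl : e.eval σ < e'.eval σ
    · obtain ⟨τ, S3, t3, h3, ht3, hr3, hb3, hQ3⟩ := ih (hc hl) hσ hr2
      refine ⟨τ, S3, _, .seq h1 (.seq h2 (.ite_true (by rwa [hv, hv2]) h3)), ?_, hr3, hb3, hQ3⟩
      rw [hv, hv2]
      simp only [time]
      nlinarith
    · obtain ⟨τ, S3, t3, h3, ht3, hr3, hb3, hQ3⟩ := ih' (hc' hl) hσ hr2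
      refine ⟨τ, S3, _, .seq h1 (.seq h2 (.ite_false (by rwa [hv, hv2]) h3)), ?_, hr3, hb3, hQ3⟩
      rw [hv, hv2]
      simp only [time]
      nlinarith
  | cfor v w c ih =>
    obtain ⟨hvw, hv, hw, k, hk, hkN, Inv, h0, hstep, hend⟩ := h
    -- Induction on the number `d` of remaining iterations. The body changes neither counter nor
    -- limit, so the number of iterations is fixed on entry.
    have key : ∀ d i, i + d = k → ∀ τ S, Inv i τ → τ.reg w = k → τ.Bdd B →
        State.Rel (τ.setReg v i) S → ∃ τ' S' t,
        Exec (.loop (2 * v) (2 * w) (.seq c.compile (.seq (.const (2 * 0 + 1) 1)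
          (.arith .add (2 * v) (2 * v) (2 * 0 + 1))))) S S' t ∧
        t ≤ (3 + d * (c.time N + 12)) * B ∧ State.Rel τ' S' ∧ State.Bdd B τ' ∧ Q τ' := by
      intro d
      induction d with
      | zero =>
        intro i hi τ S hI hw' hb hr
        obtain rfl : i = k := by omega
        have e1 : S.reg (2 * v) = i := by rw [hr.1]; simp [State.setReg]
        have e2 : S.reg (2 * w) = i := by rw [hr.1]; simp [State.setReg, hvw.symm, hw']
        refine ⟨_, S, _, .loop_false (by rw [e1, e2]; exact lt_irrefl _), ?_, hr,
          hb.setReg v (hN i hkN), hend τ hI⟩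
        rw [e1, e2]
        have := hN i hkN
        omega
      | succ d ihd =>
        intro i hi τ S hI hw' hb hr
        have e1 : S.reg (2 * v) = i := by rw [hr.1]; simp [State.setReg]
        have e2 : S.reg (2 * w) = k := by rw [hr.1]; simp [State.setReg, hvw.symm, hw']
        obtain ⟨ρ, S1, t1, h1, ht1, hr1, hb1, hI1, hA⟩ :=
          ih (wp_frame (hstep i (by omega) τ hI)) (hb.setReg v (hN i (by omega))) hr
        have hv1 : ρ.reg v = i := by rw [hA.1 v hv]; simp [State.setReg]
        have hw1 : ρ.reg w = k := by rw [hA.1 w hw]; simp [State.setReg, hvw.symm, hw']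
        have hr2 := (hr1.setTemp 0 1).setVar v ((i : ℚ) + 1)
        have e3 : (S1.setReg (2 * 0 + 1) 1).reg (2 * v) = i := by
          rw [(hr1.setTemp 0 1).1, hv1]
        have e4 : (S1.setReg (2 * 0 + 1) 1).reg (2 * 0 + 1) = 1 := by simp [State.setReg]
        obtain ⟨τ', S', t', h', ht', hr', hb', hQ'⟩ := ihd (i + 1) (by omega) ρ _ hI1 hw1 hb1
          (by push_cast; exact hr2)
        have hlt : S.reg (2 * v) < S.reg (2 * w) := by
          rw [e1, e2]; exact_mod_cast (by omega : i < k)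
        have hinc := Exec.arith (S1.setReg (2 * 0 + 1) 1) .add (2 * v) (2 * v) (2 * 0 + 1)
        rw [e3, e4] at hinc
        refine ⟨τ', S', _, .loop_true hlt (.seq h1 (.seq (.const _ _ _) hinc)) h', ?_, hr', hb',
          hQ'⟩
        rw [e1, e2, bitLength_one]
        have a1 := hN i (by omega)
        have a2 := hN k hkN
        nlinarith
    have hr0 := hS.setVar v 0
    obtain ⟨τ', S', t, h1, ht, hr, hb, hQ⟩ := key k 0 (by omega) σ _ h0 hk hσ
      (by simpa using hr0)
    refine ⟨τ', S', _, .seq (.const _ _ _) h1, ?_, hr, hb, hQ⟩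
    rw [bitLength_zero]
    simp only [time]
    have : k * (c.time N + 12) ≤ N * (c.time N + 12) := Nat.mul_le_mul_right _ hkN
    nlinarith

/-- The time bound is polynomial in the bound on the lengths of the loops. -/
theorem exists_polynomial_time (c : Cmd) : ∃ P : Polynomial ℕ, ∀ N, c.time N = P.eval N := by
  induction c with
  | skip => exact ⟨1, fun N => by simp [time]⟩
  | set v e => exact ⟨Polynomial.C (e.time + (6 + e.growth)), fun N => by
      rw [Polynomial.eval_C]; rfl⟩
  | put b e e' => exact ⟨Polynomial.C (e.time + e'.time + (1 + e.growth + e'.growth)), fun N => by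
      rw [Polynomial.eval_C]; rfl⟩
  | seq c c' ih ih' =>
    obtain ⟨P, hP⟩ := ih
    obtain ⟨P', hP'⟩ := ih'
    exact ⟨P + P', fun N => by simp [time, hP, hP']⟩
  | ite e e' c c' ih ih' =>
    obtain ⟨P, hP⟩ := ih
    obtain ⟨P', hP'⟩ := ih'
    exact ⟨Polynomial.C (e.time + e'.time + (1 + e.growth + e'.growth)) + (P + P'), fun N => by
      rw [Polynomial.eval_add, Polynomial.eval_add, Polynomial.eval_C, time, hP, hP']⟩
  | cfor v w c ih =>
    obtain ⟨P, hP⟩ := ih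
    exact ⟨Polynomial.C 6 + Polynomial.X * (P + Polynomial.C 12), fun N => by
      rw [Polynomial.eval_add, Polynomial.eval_mul, Polynomial.eval_add, Polynomial.eval_C,
        Polynomial.eval_X, Polynomial.eval_C, time, hP]⟩

end Cmd

end SplitSched

namespace SplitSched

/-! ### Parametric linear programs -/

/-- The rational linear form with coefficients `b`. -/
noncomputable def lin {P : Type*} [Fintype P] (b : P → ℚ) (y : P → ℝ) : ℝ := ∑ l, (b l : ℝ) * y l

section Elimination

variable {P ι : Type} [Fintype P] [Fintype ι]

theorem lin_add (b b' : P → ℚ) (y : P → ℝ) : lin (b + b') y = lin b y + lin b' y := by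
  simp [lin, add_mul, Finset.sum_add_distrib]

theorem lin_smul (c : ℚ) (b : P → ℚ) (y : P → ℝ) : lin (c • b) y = c * lin b y := by
  simp [lin, mul_assoc, Finset.mul_sum]

theorem lin_zero (y : P → ℝ) : lin 0 y = 0 := by simp [lin]

theorem lin_option (b : Option P → ℚ) (z : ℝ) (y : P → ℝ) :
    lin b (fun o => o.elim z y) = b none * z + lin (fun l => b (some l)) y := by
  simp [lin, Fintype.sum_option]

theorem lin_sum {κ : Type*} (t : Finset κ) (b : κ → P → ℚ) (y : P → ℝ) :
    lin (∑ k ∈ t, b k) y = ∑ k ∈ t, lin (b k) y := by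
  simp only [lin, Finset.sum_apply, Rat.cast_sum, Finset.sum_mul]
  exact Finset.sum_comm

/-- Elimination of one variable from a system of linear inequalities with parameters. If the system
bounds the variable from below, the minimum is attained at one of finitely many forms. -/
theorem exists_elim_one (S : List (ℚ × (P → ℚ))) : ∃ S' Z : List (P → ℚ), ∀ y : P → ℝ,
    ((∃ z : ℝ, ∀ f ∈ S, 0 ≤ f.1 * z + lin f.2 y) → ∀ g ∈ S', 0 ≤ lin g y) ∧
    ((∀ g ∈ S', 0 ≤ lin g y) → ∃ ζ ∈ Z, (∀ f ∈ S, 0 ≤ f.1 * lin ζ y + lin f.2 y) ∧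
      ((∃ f ∈ S, 0 < f.1) → ∀ z : ℝ, (∀ f ∈ S, 0 ≤ f.1 * z + lin f.2 y) → lin ζ y ≤ z)) := by
  classical
  -- Rows without the variable are kept, and each lower bound is combined with each upper bound. The
  -- candidate solutions are the bounds `-f.2 / f.1` themselves, and 0 for the case that there are
  -- none.
  refine ⟨(S.filter fun f => f.1 = 0).map Prod.snd ++
    (S.filter fun f => 0 < f.1).flatMap fun f => (S.filter fun g => g.1 < 0).map fun g =>
      f.1 • g.2 + (-g.1) • f.2, 0 :: S.map fun f => (-f.1⁻¹) • f.2, fun y => ⟨?_, ?_⟩⟩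
  · rintro ⟨z, hz⟩ g hg
    simp only [List.mem_append, List.mem_map, List.mem_filter, List.mem_flatMap,
      decide_eq_true_eq] at hg
    rcases hg with ⟨f, ⟨hf, hf0⟩, rfl⟩ | ⟨f, ⟨hf, hf0⟩, g, ⟨hg, hg0⟩, rfl⟩
    · simpa [hf0] using hz f hf
    · rw [lin_add, lin_smul, lin_smul]
      have h1 := hz f hf
      have h2 := hz g hg
      have hf0' : (0 : ℝ) < f.1 := by exact_mod_cast hf0
      have hg0' : (g.1 : ℝ) < 0 := by exact_mod_cast hg0
      push_cast
      nlinarith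
  · intro h
    simp only [List.mem_append, List.mem_map, List.mem_filter, List.mem_flatMap,
      decide_eq_true_eq] at h
    have h0 : ∀ f ∈ S, f.1 = 0 → 0 ≤ lin f.2 y := fun f hf hf0 => h _ (.inl ⟨f, ⟨hf, hf0⟩, rfl⟩)
    have hpn : ∀ f ∈ S, 0 < f.1 → ∀ g ∈ S, g.1 < 0 →
        0 ≤ (f.1 : ℝ) * lin g.2 y - g.1 * lin f.2 y := by
      intro f hf hf0 g hg hg0
      have := h _ (.inr ⟨f, ⟨hf, hf0⟩, g, ⟨hg, hg0⟩, rfl⟩)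
      rw [lin_add, lin_smul, lin_smul] at this
      push_cast at this
      linarith
    have hval : ∀ f : ℚ × (P → ℚ), lin ((-f.1⁻¹) • f.2) y = -lin f.2 y / f.1 := by
      intro f; rw [lin_smul]; push_cast; field_simp
    have hfin : ∀ p : ℚ × (P → ℚ) → Prop, {f | f ∈ S ∧ p f}.Finite := fun p =>
      S.finite_toSet.subset fun f hf => hf.1
    by_cases hpos : ∃ f ∈ S, 0 < f.1
    -- The largest lower bound respects all upper bounds, by the combined rows, and is the least
    -- solution.
    · obtain ⟨f, ⟨hf, hf0⟩, hmax⟩ := Set.exists_max_image {f | f ∈ S ∧ 0 < f.1}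
        (fun f => -lin f.2 y / f.1) (hfin _) (by obtain ⟨f, h⟩ := hpos; exact ⟨f, h⟩)
      have hf0' : (0 : ℝ) < f.1 := by exact_mod_cast hf0
      refine ⟨_, List.mem_cons_of_mem _ (List.mem_map_of_mem hf), ?_, ?_⟩
      · intro g hg
        rw [hval]
        rcases lt_trichotomy g.1 0 with hg0 | hg0 | hg0
        · have := hpn f hf hf0 g hg hg0
          have e : (g.1 : ℝ) * (-lin f.2 y / f.1) + lin g.2 y =
              ((f.1 : ℝ) * lin g.2 y - g.1 * lin f.2 y) / f.1 := by field_simp; ring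
          rw [e]
          positivity
        · simpa [hg0] using h0 g hg hg0
        · have := hmax g ⟨hg, hg0⟩
          have hg0' : (0 : ℝ) < g.1 := by exact_mod_cast hg0
          have h2 := mul_le_mul_of_nonneg_left this hg0'.le
          rw [mul_div_cancel₀ _ hg0'.ne'] at h2
          linarith
      · intro _ z hz
        rw [hval, div_le_iff₀ hf0']
        linarith [hz f hf]
    by_cases hneg : ∃ f ∈ S, f.1 < 0
    -- Without lower bounds, the smallest upper bound is a solution.
    · obtain ⟨f, ⟨hf, hf0⟩, hmin⟩ := Set.exists_min_image {f | f ∈ S ∧ f.1 < 0}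
        (fun f => -lin f.2 y / f.1) (hfin _) (by obtain ⟨f, h⟩ := hneg; exact ⟨f, h⟩)
      refine ⟨_, List.mem_cons_of_mem _ (List.mem_map_of_mem hf), ?_, fun h => absurd h hpos⟩
      intro g hg
      rw [hval]
      rcases lt_trichotomy g.1 0 with hg0 | hg0 | hg0
      · have := hmin g ⟨hg, hg0⟩
        have hg0' : (g.1 : ℝ) < 0 := by exact_mod_cast hg0
        have h2 := mul_le_mul_of_nonpos_left this hg0'.le
        rw [mul_div_cancel₀ _ hg0'.ne] at h2
        linarith
      · simpa [hg0] using h0 g hg hg0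
      · exact absurd ⟨g, hg, hg0⟩ hpos
    · refine ⟨0, List.mem_cons_self, ?_, fun h => absurd h hpos⟩
      intro g hg
      have hg0 : g.1 = 0 := by
        rcases lt_trichotomy g.1 0 with h | h | h
        · exact absurd ⟨g, hg, h⟩ hneg
        · exact h
        · exact absurd ⟨g, hg, h⟩ hpos
      simpa [hg0] using h0 g hg hg0

/-- Fourier–Motzkin elimination: a system of linear inequalities with parameters is solvable if and
only if the parameters satisfy certain linear inequalities, and then one of finitely many linear
functions of the parameters is a solution. -/
theorem exists_elim (v : ℕ) : ∀ {P : Type} [Fintype P] (S : List ((Fin v → ℚ) × (P → ℚ))),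
    ∃ (S' : List (P → ℚ)) (Z : List (Fin v → P → ℚ)), ∀ y : P → ℝ,
    ((∃ x : Fin v → ℝ, ∀ f ∈ S, 0 ≤ lin f.1 x + lin f.2 y) → ∀ g ∈ S', 0 ≤ lin g y) ∧
    ((∀ g ∈ S', 0 ≤ lin g y) → ∃ ζ ∈ Z, ∀ f ∈ S,
      0 ≤ lin f.1 (fun i => lin (ζ i) y) + lin f.2 y) := by
  induction v with
  | zero =>
    intro P _ S
    refine ⟨S.map Prod.snd, [fun _ => 0], fun y => ⟨?_, ?_⟩⟩
    · rintro ⟨x, hx⟩ g hg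
      obtain ⟨f, hf, rfl⟩ := List.mem_map.mp hg
      simpa [lin] using hx f hf
    · intro h
      refine ⟨_, List.mem_singleton_self _, fun f hf => ?_⟩
      simpa [lin] using h f.2 (List.mem_map_of_mem hf)
  | succ v ih =>
    intro P _ S
    -- The variable `x 0` becomes the additional parameter `none` while the others are eliminated.
    -- It is eliminated last, and its solution `ζ0` is substituted into the others.
    obtain ⟨S1, Z1, h1⟩ := ih (P := Option P)
      (S.map fun f => (Fin.tail f.1, fun o => o.elim (f.1 0) f.2))
    obtain ⟨S', Z0, h0⟩ := exists_elim_one (S1.map fun g => (g none, fun l => g (some l)))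
    have key : ∀ (x : Fin v → ℝ) (z : ℝ) (y : P → ℝ) (f : (Fin (v + 1) → ℚ) × (P → ℚ)),
        lin (Fin.tail f.1) x + lin (fun o : Option P => o.elim (f.1 0) f.2) (fun o => o.elim z y) =
        lin f.1 (Fin.cons z x : Fin (v + 1) → ℝ) + lin f.2 y := by
      intro x z y f
      rw [lin_option]
      simp only [lin, Fin.sum_univ_succ, Fin.cons_zero, Fin.cons_succ, Option.elim, Fin.tail]
      ring
    refine ⟨S', Z0.flatMap fun ζ0 => Z1.map fun ζ =>
      Fin.cons ζ0 fun i => (ζ i none) • ζ0 + fun l => ζ i (some l), fun y => ⟨?_, ?_⟩⟩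
    · rintro ⟨x, hx⟩
      refine (h0 y).1 ⟨x 0, fun f hf => ?_⟩
      obtain ⟨g, hg, rfl⟩ := List.mem_map.mp hf
      rw [← lin_option]
      refine (h1 _).1 ⟨Fin.tail x, fun f hf => ?_⟩ g hg
      obtain ⟨f', hf', rfl⟩ := List.mem_map.mp hf
      rw [key, Fin.cons_self_tail]
      exact hx f' hf'
    · intro h
      obtain ⟨ζ0, hζ0, hs, -⟩ := (h0 y).2 h
      obtain ⟨ζ, hζ, hs'⟩ := (h1 fun o => o.elim (lin ζ0 y) y).2 fun g hg => by
        rw [lin_option]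
        exact hs _ (List.mem_map_of_mem (f := fun g => (g none, fun l => g (some l))) hg)
      refine ⟨_, List.mem_flatMap.mpr ⟨ζ0, hζ0, List.mem_map_of_mem hζ⟩, fun f hf => ?_⟩
      have := hs' _ (List.mem_map_of_mem hf)
      rw [key] at this
      convert this using 3
      ext i
      refine Fin.cases ?_ (fun i => ?_) i
      · simp
      · simp only [Fin.cons_succ]
        rw [lin_add, lin_smul, lin_option]

/-- A parametric linear program whose objective is bounded from below is, whenever it is feasible,
solved by one of finitely many linear functions of the parameters. -/
theorem exists_param_optimal (S : List ((ι → ℚ) × (P → ℚ))) (c : ι → ℚ) :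
    ∃ Z : List (ι → P → ℚ), ∀ y : P → ℝ,
    (∃ x : ι → ℝ, ∀ f ∈ S, 0 ≤ lin f.1 x + lin f.2 y) →
    (∃ L, ∀ x : ι → ℝ, (∀ f ∈ S, 0 ≤ lin f.1 x + lin f.2 y) → L ≤ lin c x) →
    ∃ ζ ∈ Z, (∀ f ∈ S, 0 ≤ lin f.1 (fun i => lin (ζ i) y) + lin f.2 y) ∧
      ∀ x : ι → ℝ, (∀ f ∈ S, 0 ≤ lin f.1 x + lin f.2 y) →
        lin c (fun i => lin (ζ i) y) ≤ lin c x := by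
  obtain ⟨e⟩ : Nonempty (Fin (Fintype.card ι) ≃ ι) := ⟨(Fintype.equivFin ι).symm⟩
  have hlin : ∀ (b : ι → ℚ) (x : Fin (Fintype.card ι) → ℝ),
      lin (fun i => b (e i)) x = lin b (fun i => x (e.symm i)) := by
    intro b x
    simp only [lin]
    rw [← e.sum_comp]
    simp
  -- A new parameter `z` with the constraint `c · x ≤ z` represents the objective. Eliminating `x`
  -- leaves conditions on `z` and `y`, and the least such `z` is the optimal value.
  obtain ⟨S2, Z2, h2⟩ := exists_elim (Fintype.card ι) (P := Option P)
    ((fun i => -c (e i), fun o => o.elim 1 fun _ => 0) ::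
      S.map fun f => (fun i => f.1 (e i), fun o => o.elim 0 f.2))
  let F : (Option P → ℚ) → ℚ × (P → ℚ) := fun g => (g none, fun l => g (some l))
  obtain ⟨S', Z0, h0⟩ := exists_elim_one (S2.map F)
  have key : ∀ (y : P → ℝ) (z : ℝ) (x : Fin (Fintype.card ι) → ℝ),
      (∀ f ∈ ((fun i => -c (e i), fun o => o.elim 1 fun _ => 0) ::
        S.map fun f => (fun i => f.1 (e i), fun o => o.elim 0 f.2) :
          List ((Fin (Fintype.card ι) → ℚ) × (Option P → ℚ))),
        0 ≤ lin f.1 x + lin f.2 (fun o => o.elim z y)) ↔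
      lin c (fun i => x (e.symm i)) ≤ z ∧
        ∀ f ∈ S, 0 ≤ lin f.1 (fun i => x (e.symm i)) + lin f.2 y := by
    intro y z x
    simp only [List.forall_mem_cons, List.forall_mem_map]
    refine and_congr ?_ (forall₂_congr fun f hf => ?_)
    · rw [hlin (fun i => -c i), lin_option]
      simp [lin]
    · rw [hlin, lin_option]
      simp
  refine ⟨Z0.flatMap fun ζ0 => Z2.map fun ζ => fun i =>
      (ζ (e.symm i) none) • ζ0 + fun l => ζ (e.symm i) (some l), ?_⟩
  rintro y ⟨x0, hx0⟩ ⟨L, hL⟩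
  have hsol : ∀ x : ι → ℝ, (∀ f ∈ S, 0 ≤ lin f.1 x + lin f.2 y) → ∀ z, lin c x ≤ z →
      ∀ f ∈ S2.map F, 0 ≤ f.1 * z + lin f.2 y := by
    intro x hx z hz f hf
    obtain ⟨g, hg, rfl⟩ := List.mem_map.mp hf
    rw [← lin_option]
    refine (h2 _).1 ⟨fun i => x (e i), (key _ _ _).mpr ?_⟩ g hg
    simp only [Equiv.apply_symm_apply]
    exact ⟨hz, hx⟩
  have hsol' : ∀ z : ℝ, (∀ f ∈ S2.map F, 0 ≤ f.1 * z + lin f.2 y) → ∃ ζ ∈ Z2,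
      lin c (fun i => lin (ζ (e.symm i)) fun o => o.elim z y) ≤ z ∧
        ∀ f ∈ S, 0 ≤ lin f.1 (fun i => lin (ζ (e.symm i)) fun o => o.elim z y) + lin f.2 y := by
    intro z hz
    obtain ⟨ζ, hζ, hs⟩ := (h2 fun o => o.elim z y).2 fun g hg => by
      rw [lin_option]
      exact hz _ (List.mem_map_of_mem (f := F) hg)
    exact ⟨ζ, hζ, (key _ _ _).mp hs⟩
  obtain ⟨ζ0, hζ0, hs, hmin⟩ := (h0 y).2 ((h0 y).1 ⟨_, hsol x0 hx0 _ le_rfl⟩)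
  -- If no condition bounded `z` from below, a value of at most `L - 1` would be attainable,
  -- contrary to the lower bound `L` on the objective.
  have hpos : ∃ f ∈ S2.map F, 0 < f.1 := by
    by_contra hcon
    push Not at hcon
    have h1 : ∀ f ∈ S2.map F,
        0 ≤ f.1 * min (lin c x0) (L - 1) + lin f.2 y := by
      intro f hf
      have a := hsol x0 hx0 _ le_rfl f hf
      have b : (f.1 : ℝ) ≤ 0 := by exact_mod_cast hcon f hf
      have := mul_le_mul_of_nonpos_left (min_le_left (lin c x0) (L - 1)) b
      linarith
    obtain ⟨ζ, -, hc, hf⟩ := hsol' _ h1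
    have := hL _ hf
    have := min_le_right (lin c x0) (L - 1)
    linarith
  obtain ⟨ζ, hζ, hc, hf⟩ := hsol' _ hs
  have e1 : ∀ i : ι, lin ((ζ (e.symm i) none) • ζ0 + fun l => ζ (e.symm i) (some l)) y =
      lin (ζ (e.symm i)) (fun o => o.elim (lin ζ0 y) y) := by
    intro i
    rw [lin_add, lin_smul, lin_option]
  refine ⟨_, List.mem_flatMap.mpr ⟨ζ0, hζ0, List.mem_map_of_mem hζ⟩, ?_, fun x hx => ?_⟩
  · simpa only [e1] using hf
  · simp only [e1]
    exact hc.trans (hmin hpos _ (hsol x hx _ le_rfl))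

/-- `F` is a rational linear form. -/
def IsForm (F : (ι → ℝ) → (P → ℝ) → ℝ) : Prop :=
  ∃ (a : ι → ℚ) (b : P → ℚ), ∀ x y, F x y = lin a x + lin b y

theorem IsForm.add {F G : (ι → ℝ) → (P → ℝ) → ℝ} (hF : IsForm F) (hG : IsForm G) :
    IsForm fun x y => F x y + G x y := by
  obtain ⟨a, b, h⟩ := hF
  obtain ⟨a', b', h'⟩ := hG
  exact ⟨a + a', b + b', fun x y => by simp only [h, h', lin_add]; ring⟩

theorem IsForm.sub {F G : (ι → ℝ) → (P → ℝ) → ℝ} (hF : IsForm F) (hG : IsForm G) :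
    IsForm fun x y => F x y - G x y := by
  obtain ⟨a, b, h⟩ := hF
  obtain ⟨a', b', h'⟩ := hG
  exact ⟨a + (-1 : ℚ) • a', b + (-1 : ℚ) • b', fun x y => by
    simp only [h, h', lin_add, lin_smul]; push_cast; ring⟩

theorem IsForm.sum {κ : Type*} (t : Finset κ) {F : κ → (ι → ℝ) → (P → ℝ) → ℝ}
    (hF : ∀ k, IsForm (F k)) : IsForm fun x y => ∑ k ∈ t, F k x y := by
  choose a b h using hF
  exact ⟨∑ k ∈ t, a k, ∑ k ∈ t, b k, fun x y => by
    rw [lin_sum, lin_sum, ← Finset.sum_add_distrib]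
    exact Finset.sum_congr rfl fun k _ => h k x y⟩

theorem IsForm.var [DecidableEq ι] (i : ι) : IsForm fun (x : ι → ℝ) (_ : P → ℝ) => x i :=
  ⟨Pi.single i 1, 0, fun x y => by simp [lin, Pi.single_apply, apply_ite (Rat.cast : ℚ → ℝ)]⟩

theorem IsForm.param [DecidableEq P] (l : P) : IsForm fun (_ : ι → ℝ) (y : P → ℝ) => y l :=
  ⟨0, Pi.single l 1, fun x y => by simp [lin, Pi.single_apply, apply_ite (Rat.cast : ℚ → ℝ)]⟩

/-- `Φ` is a system of rational linear inequalities. -/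
def IsSystem (Φ : (ι → ℝ) → (P → ℝ) → Prop) : Prop :=
  ∃ S : List ((ι → ℚ) × (P → ℚ)), ∀ x y, Φ x y ↔ ∀ f ∈ S, 0 ≤ lin f.1 x + lin f.2 y

theorem IsForm.le {F G : (ι → ℝ) → (P → ℝ) → ℝ} (hF : IsForm F) (hG : IsForm G) :
    IsSystem fun x y => F x y ≤ G x y := by
  obtain ⟨a, b, h⟩ := hG.sub hF
  exact ⟨[(a, b)], fun x y => by simp [← h]⟩

theorem IsSystem.and {Φ Ψ : (ι → ℝ) → (P → ℝ) → Prop} (h : IsSystem Φ) (h' : IsSystem Ψ) :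
    IsSystem fun x y => Φ x y ∧ Ψ x y := by
  obtain ⟨S, hS⟩ := h
  obtain ⟨S', hS'⟩ := h'
  refine ⟨S ++ S', fun x y => ?_⟩
  simp only [hS, hS', List.forall_mem_append]

theorem IsForm.eq {F G : (ι → ℝ) → (P → ℝ) → ℝ} (hF : IsForm F) (hG : IsForm G) :
    IsSystem fun x y => F x y = G x y := by
  simpa only [le_antisymm_iff] using (hF.le hG).and (hG.le hF)

theorem IsSystem.all {κ : Type*} [Fintype κ] {Φ : κ → (ι → ℝ) → (P → ℝ) → Prop}
    (h : ∀ k, IsSystem (Φ k)) : IsSystem fun x y => ∀ k, Φ k x y := by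
  choose S hS using h
  refine ⟨Finset.univ.toList.flatMap S, fun x y => ?_⟩
  simp only [List.mem_flatMap, Finset.mem_toList, Finset.mem_univ, true_and, hS]
  exact ⟨fun h f ⟨k, hk⟩ => h k f hk, fun h k f hk => h f ⟨k, hk⟩⟩

theorem IsSystem.imp {p : Prop} {Φ : (ι → ℝ) → (P → ℝ) → Prop} (h : IsSystem Φ) :
    IsSystem fun x y => p → Φ x y := by
  by_cases hp : p
  · simpa [hp] using h
  · exact ⟨[], fun x y => by simp [hp]⟩

end Elimination

/-- The indices of the parameters of the linear program with `N` jobs: the processing times, the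
times at which the machines become available, the setup time. -/
abbrev LPParam (m N : ℕ) := (Fin N ⊕ Fin m) ⊕ Unit

/-- The parameters of the linear program. -/
def lpParam {m N : ℕ} {R : Type} (s : R) (q : Fin N → R) (T : Fin m → R) : LPParam m N → R :=
  Sum.elim (Sum.elim q T) fun _ => s

/-- A candidate for an optimal solution of the linear program: the machine sets, the solution as a
linear function of the parameters, and the forms that are nonnegative if it is feasible. -/
structure Candidate (m N : ℕ) where
  M : Fin N → Finset (Fin m)
  x : Fin N → Fin m → LPParam m N → ℚ
  C : Fin N → LPParam m N → ℚ
  checks : List (LPParam m N → ℚ)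

namespace Candidate

variable {m N : ℕ}

/-- The checks of the candidate are right. -/
def Sound (κ : Candidate m N) : Prop :=
  ∀ (s : ℝ) (q : Fin N → ℝ) (T : Fin m → ℝ), (∀ g ∈ κ.checks, 0 ≤ lin g (lpParam s q T)) ↔
    LPFeasible s q 0 T κ.M (fun h i => lin (κ.x h i) (lpParam s q T))
      (fun h => lin (κ.C h) (lpParam s q T))

theorem exists_list_of_sets (M : Fin N → Finset (Fin m)) : ∃ Z : List (Candidate m N),
    (∀ κ ∈ Z, κ.Sound) ∧ ∀ (s : ℝ) (q : Fin N → ℝ) (T : Fin m → ℝ),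
    (∃ x C, LPFeasible s q 0 T M x C) → ∃ κ ∈ Z, κ.M = M ∧
      LPOptimal s q 0 T M (fun h i => lin (κ.x h i) (lpParam s q T))
      (fun h => lin (κ.C h) (lpParam s q T)) := by
  classical
  let ι := (Fin N × Fin m) ⊕ Fin N
  have hX : ∀ h i, IsForm fun (z : ι → ℝ) (_ : LPParam m N → ℝ) => z (.inl (h, i)) :=
    fun h i => IsForm.var _
  have hC : ∀ h, IsForm fun (z : ι → ℝ) (_ : LPParam m N → ℝ) => z (.inr h) := fun h => IsForm.var _
  have hq : ∀ h, IsForm fun (_ : ι → ℝ) (y : LPParam m N → ℝ) => y (.inl (.inl h)) :=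
    fun h => IsForm.param _
  have hT : ∀ i, IsForm fun (_ : ι → ℝ) (y : LPParam m N → ℝ) => y (.inl (.inr i)) :=
    fun h => IsForm.param _
  have hs : IsForm fun (_ : ι → ℝ) (y : LPParam m N → ℝ) => y (.inr ()) := IsForm.param _
  have h0 : IsForm fun (_ : ι → ℝ) (_ : LPParam m N → ℝ) => (0 : ℝ) :=
    ⟨0, 0, fun x y => by simp [lin_zero]⟩
  have hsys : IsSystem fun (z : ι → ℝ) (y : LPParam m N → ℝ) =>
      LPFeasible (y (.inr ())) (fun h => y (.inl (.inl h))) 0 (fun i => y (.inl (.inr i))) M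
        (fun h i => z (.inl (h, i))) (fun h => z (.inr h)) := by
    have : IsSystem fun (z : ι → ℝ) (y : LPParam m N → ℝ) =>
        ((∀ h : Fin N, 0 ≤ h.val → ∑ i ∈ M h, z (.inl (h, i)) = y (.inl (.inl h))) ∧
        (∀ h : Fin N, 0 ≤ h.val → ∀ i, i ∈ M h → y (.inl (.inr i)) +
          ∑ k with 0 ≤ k.val ∧ k ≤ h ∧ i ∈ M k, (y (.inr ()) + z (.inl (k, i))) ≤ z (.inr h))) ∧
        (∀ h : Fin N, 0 ≤ h.val → ∀ i, i ∈ M h → 0 ≤ z (.inl (h, i))) ∧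
        (∀ h : Fin N, 0 ≤ h.val → 0 ≤ z (.inr h)) := by
      refine .and (.and (.all fun h => .imp ?_) (.all fun h => .imp (.all fun i => .imp ?_)))
        (.and (.all fun h => .imp (.all fun i => .imp ?_)) (.all fun h => .imp ?_))
      · exact (IsForm.sum _ fun i => hX h i).eq (hq h)
      · exact ((hT i).add (IsForm.sum _ fun k => hs.add (hX k i))).le (hC h)
      · exact h0.le (hX h i)
      · exact h0.le (hC h)
    obtain ⟨S, hS⟩ := this
    refine ⟨S, fun z y => ?_⟩
    rw [← hS]
    exact ⟨fun h => ⟨⟨h.1, h.2⟩, h.3, h.4⟩, fun h => ⟨h.1.1, h.1.2, h.2.1, h.2.2⟩⟩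
  obtain ⟨c, c', hc⟩ := IsForm.sum (Finset.univ : Finset (Fin N)) fun h => hC h
  have hc' : ∀ z : ι → ℝ, lin c z = ∑ h, z (.inr h) := by
    intro z
    have h1 := hc z 0
    have h2 : lin c' 0 = 0 := by simp [lin]
    rw [h2, add_zero] at h1
    exact h1.symm
  obtain ⟨S, hS⟩ := hsys
  obtain ⟨Z, hZ⟩ := exists_param_optimal S c
  have hcomp : ∀ (ζ : ι → LPParam m N → ℚ) (f : (ι → ℚ) × (LPParam m N → ℚ)) (y : LPParam m N → ℝ),
      lin (f.2 + ∑ i, f.1 i • ζ i) y = lin f.1 (fun i => lin (ζ i) y) + lin f.2 y := by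
    intro ζ f y
    rw [lin_add, lin_sum]
    simp only [lin_smul]
    rw [add_comm]
    rfl
  -- Substituting the solution into the constraints leaves forms in the parameters alone. They are
  -- the checks.
  refine ⟨Z.map fun ζ => ⟨M, fun h i => ζ (.inl (h, i)), fun h => ζ (.inr h),
    S.map fun f => f.2 + ∑ i, f.1 i • ζ i⟩, ?_, ?_⟩
  · intro κ hκ s q T
    obtain ⟨ζ, -, rfl⟩ := List.mem_map.mp hκ
    have := hS (fun i => lin (ζ i) (lpParam s q T)) (lpParam s q T)
    simp only [List.forall_mem_map, hcomp]
    rw [← this]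
    rfl
  · rintro s q T ⟨x, C, hx⟩
    have hfeas : ∀ (x : Fin N → Fin m → ℝ) (C : Fin N → ℝ), LPFeasible s q 0 T M x C →
        ∀ f ∈ S, 0 ≤ lin f.1 (Sum.elim (fun p => x p.1 p.2) C : ι → ℝ) +
          lin f.2 (lpParam s q T) := fun x C h => (hS _ _).mp h
    obtain ⟨ζ, hζ, h1, h2⟩ := hZ (lpParam s q T) ⟨_, hfeas x C hx⟩ ⟨0, fun z hz => by
      rw [hc']
      exact Finset.sum_nonneg fun h _ => ((hS z _).mpr hz).C_nonneg h (Nat.zero_le _)⟩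
    refine ⟨_, List.mem_map_of_mem hζ, rfl, (hS _ _).mpr h1, fun x' C' h' => ?_⟩
    have := h2 _ (hfeas x' C' h')
    rw [hc', hc'] at this
    simpa [lpValue] using this

theorem exists_list (m N : ℕ) : ∃ Z : List (Candidate m N),
    (∀ κ ∈ Z, κ.Sound) ∧ ∀ (M : Fin N → Finset (Fin m)) (s : ℝ) (q : Fin N → ℝ) (T : Fin m → ℝ),
    (∃ x C, LPFeasible s q 0 T M x C) → ∃ κ ∈ Z, κ.M = M ∧
      LPOptimal s q 0 T M (fun h i => lin (κ.x h i) (lpParam s q T))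
      (fun h => lin (κ.C h) (lpParam s q T)) := by
  choose Z h1 h2 using fun M : Fin N → Finset (Fin m) => exists_list_of_sets M
  refine ⟨Finset.univ.toList.flatMap Z, fun κ hκ => ?_, fun M s q T h => ?_⟩
  · obtain ⟨M, -, hM⟩ := List.mem_flatMap.mp hκ
    exact h1 M κ hM
  · obtain ⟨κ, hκ, h⟩ := h2 M s q T h
    exact ⟨κ, List.mem_flatMap.mpr ⟨M, by simp, hκ⟩, h⟩

end Candidate

end SplitSched

namespace SplitSched

/-! ### From schedules to sequences of jobs -/

theorem sum_map_filter_add {α : Type*} (l : List α) (f : α → ℝ) (p : α → Bool) :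
    ((l.filter p).map f).sum + ((l.filter fun a => !p a).map f).sum = (l.map f).sum := by
  rw [← List.sum_append, ← List.map_append]
  exact ((List.filter_append_perm p l).map f).sum_eq

theorem sum_map_fiber {α β : Type*} [Fintype β] [DecidableEq β] (l : List α) (f : α → ℝ)
    (g : α → β) : (l.map f).sum = ∑ b, ((l.filter fun a => g a = b).map f).sum := by
  induction l with
  | nil => simp
  | cons a l ih =>
    rw [List.map_cons, List.sum_cons, ih]
    have : ∀ b, (((a :: l).filter fun a => g a = b).map f).sum =
        (if g a = b then f a else 0) + ((l.filter fun a => g a = b).map f).sum := by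
      intro b
      by_cases h : g a = b <;> simp [h]
    simp only [this, Finset.sum_add_distrib]
    simp

/-- Disjoint time slots `(start, length)` in an interval have total length at most its length. -/
theorem sum_slots_le (d : ℕ) : ∀ (l : List (ℝ × ℝ)) (a b : ℝ), l.length = d → a ≤ b →
    (∀ x ∈ l, a ≤ x.1 ∧ x.1 + x.2 ≤ b ∧ 0 < x.2) →
    (l.Pairwise fun x y => x.1 + x.2 ≤ y.1 ∨ y.1 + y.2 ≤ x.1) → (l.map Prod.snd).sum ≤ b - a := by
  induction d using Nat.strong_induction_on with
  | _ d ih =>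
    intro l a b hd hab hl hp
    cases l with
    | nil => simpa using hab
    | cons x l =>
      have hx := hl x List.mem_cons_self
      have hl' := fun y (hy : y ∈ l) => hl y (List.mem_cons_of_mem _ hy)
      rw [List.pairwise_cons] at hp
      -- Every other slot ends before `x` starts or starts after `x` ends. The two groups lie in the
      -- two intervals that `x` leaves, and induction applies to each.
      let p : ℝ × ℝ → Bool := fun y => decide (y.1 + y.2 ≤ x.1)
      have h1 := ih (l.filter p).length (by
        have := List.length_filter_le p l
        simp only [List.length_cons] at hd; omega) _ a x.1 rfl hx.1 (fun y hy => by
          have h := List.mem_filter.mp hy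
          exact ⟨(hl' y h.1).1, by simpa [p] using h.2, (hl' y h.1).2.2⟩) (hp.2.filter _)
      have h2 := ih (l.filter fun y => !p y).length (by
        have := List.length_filter_le (fun y => !p y) l
        simp only [List.length_cons] at hd; omega) _ (x.1 + x.2) b rfl hx.2.1 (fun y hy => by
          have h := List.mem_filter.mp hy
          refine ⟨?_, (hl' y h.1).2.1, (hl' y h.1).2.2⟩
          rcases hp.1 y h.1 with h' | h'
          · exact h'
          · simp [p, h'] at h) (hp.2.filter _)
      have h3 := sum_map_filter_add l Prod.snd p
      rw [List.map_cons, List.sum_cons]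
      linarith

theorem le_foldr_max (l : List ℝ) (x : ℝ) (hx : x ∈ l) : x ≤ l.foldr max 0 := by
  induction l with
  | nil => simp at hx
  | cons a l ih =>
    rcases List.mem_cons.mp hx with rfl | h
    · exact le_max_left _ _
    · exact (ih h).trans (le_max_right _ _)

theorem foldr_max_le (l : List ℝ) (c : ℝ) (hc : 0 ≤ c) (h : ∀ x ∈ l, x ≤ c) :
    l.foldr max 0 ≤ c := by
  induction l with
  | nil => simpa using hc
  | cons a l ih =>
    exact max_le (h a List.mem_cons_self) (ih fun x hx => h x (List.mem_cons_of_mem _ hx))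

theorem foldr_max_nonneg (l : List ℝ) : 0 ≤ l.foldr max 0 := by
  induction l with
  | nil => simp
  | cons a l ih => exact ih.trans (le_max_right _ _)

/-- Every feasible schedule yields a sequence of the jobs and amounts such that the schedule that
processes the jobs in this order on each machine is not worse. -/
theorem IsFeasible.exists_sequence {m : ℕ} {I : Instance} {σ : Schedule m I.n}
    (hσ : IsFeasible I σ) : ∃ (π : Equiv.Perm (Fin I.n)) (M : Fin I.n → Finset (Fin m))
    (x : Fin I.n → Fin m → ℝ) (C : Fin I.n → ℝ),
    LPFeasible I.s (fun h => (I.p (π h) : ℝ)) 0 (fun _ => 0) M x C ∧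
      ∑ h, C h = totalCompletionTime I σ := by
  classical
  have hs : (0 : ℝ) ≤ I.s := by exact_mod_cast I.s_nonneg
  let x : Fin I.n → Fin m → ℝ := fun j i =>
    ((σ.filter fun a => a.job = j ∧ a.machine = i).map Part.len).sum
  let M : Fin I.n → Finset (Fin m) := fun j =>
    Finset.univ.filter fun i => ∃ a ∈ σ, a.job = j ∧ a.machine = i
  let C := completionTime I σ
  have hx0 : ∀ j i, 0 ≤ x j i := by
    intro j i
    refine List.sum_nonneg fun y hy => ?_
    obtain ⟨a, ha, rfl⟩ := List.mem_map.mp hy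
    exact (hσ.len_pos a (List.mem_filter.mp ha).1).le
  have hfin : ∀ a ∈ σ, a.finish I.s ≤ C a.job := by
    intro a ha
    refine le_foldr_max _ _ (List.mem_map_of_mem (List.mem_filter.mpr ⟨ha, by simp⟩))
  have hC0 : ∀ j, 0 ≤ C j := fun j => foldr_max_nonneg _
  have htot : ∀ j, ∑ i ∈ M j, x j i = I.p j := by
    intro j
    rw [← hσ.total j, sum_map_fiber _ _ Part.machine]
    rw [Finset.sum_filter]
    refine Finset.sum_congr rfl fun i _ => ?_
    rw [List.filter_filter]
    have e : (σ.filter fun a => decide (a.machine = i) && decide (a.job = j)) =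
        σ.filter fun a => a.job = j ∧ a.machine = i := by
      refine List.filter_congr fun a _ => ?_
      simp [Bool.and_comm]
    rw [e]
    split_ifs with h
    · rfl
    · have : (σ.filter fun a => a.job = j ∧ a.machine = i) = [] := by
        rw [List.filter_eq_nil_iff]
        intro a ha h'
        exact h ⟨a, ha, by simpa using h'⟩
      rw [this]; rfl
  -- All parts on machine `i` of jobs completed by time `c` lie in `[0, c]`. Merging the parts of
  -- one job saves setups and never adds any, since each job counted has at least one part on `i`.
  have hload : ∀ (i : Fin m) (c : ℝ), 0 ≤ c → ∑ j with C j ≤ c ∧ i ∈ M j, (I.s + x j i) ≤ c := by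
    intro i c hc
    let l := σ.filter fun a => a.machine = i ∧ C a.job ≤ c
    have h1 := sum_slots_le _ (l.map fun a => (a.start, I.s + a.len)) 0 c rfl hc (by
      intro y hy
      obtain ⟨a, ha, rfl⟩ := List.mem_map.mp hy
      have h := List.mem_filter.mp ha
      have h' : a.machine = i ∧ C a.job ≤ c := by simpa using h.2
      have h2 := hfin a h.1
      have h3 := hσ.len_pos a h.1
      simp only [Part.finish] at h2
      exact ⟨hσ.start_nonneg a h.1, by simp only; linarith, by simp only; linarith⟩) (by
      rw [List.pairwise_map]
      refine List.Pairwise.imp_of_mem ?_ (hσ.disjoint.filter _)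
      intro a b ha hb h
      have ha' := (List.mem_filter.mp ha).2
      have hb' := (List.mem_filter.mp hb).2
      simp only [decide_eq_true_eq] at ha' hb'
      have := h (ha'.1.trans hb'.1.symm)
      simp only [Part.finish] at this
      rwa [← add_assoc, ← add_assoc])
    rw [List.map_map, sum_map_fiber _ _ Part.job, sub_zero] at h1
    refine le_trans ?_ h1
    rw [Finset.sum_filter]
    refine Finset.sum_le_sum fun j _ => ?_
    have hnn : 0 ≤ ((l.filter fun a => a.job = j).map
        (Prod.snd ∘ fun a : Part m I.n => (a.start, (I.s : ℝ) + a.len))).sum := by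
      refine List.sum_nonneg fun y hy => ?_
      obtain ⟨a, ha, rfl⟩ := List.mem_map.mp hy
      have := hσ.len_pos a (List.mem_filter.mp (List.mem_filter.mp ha).1).1
      simp only [Function.comp]
      linarith
    split_ifs with h
    · obtain ⟨hCj, hi⟩ := h
      have e : (l.filter fun a => a.job = j) = σ.filter fun a => a.job = j ∧ a.machine = i := by
        rw [List.filter_filter]
        refine List.filter_congr fun a _ => ?_
        by_cases h1 : a.job = j <;> by_cases h2 : a.machine = i <;> simp [h1, h2, hCj]
      rw [e]
      obtain ⟨a, ha, haj⟩ := (Finset.mem_filter.mp hi).2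
      have hmem : a ∈ σ.filter fun a => a.job = j ∧ a.machine = i :=
        List.mem_filter.mpr ⟨ha, by simpa using haj⟩
      have hgen : ∀ l' : List (Part m I.n), l' ≠ [] → I.s + (l'.map Part.len).sum ≤
          (l'.map (Prod.snd ∘ fun a : Part m I.n => (a.start, (I.s : ℝ) + a.len))).sum := by
        intro l' hl'
        induction l' with
        | nil => exact absurd rfl hl'
        | cons b l' ih =>
          by_cases hb : l' = []
          · simp [hb]
          · have := ih hb
            simp only [List.map_cons, List.sum_cons, Function.comp] at this ⊢
            linarith
      exact hgen _ (List.ne_nil_of_mem hmem)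
    · exact hnn
  -- In the order of completion times, all jobs up to position `h` are completed by the time the job
  -- in position `h` is, so `hload` with this time gives the constraint.
  refine ⟨Tuple.sort C, fun h => M (Tuple.sort C h), fun h => x (Tuple.sort C h),
    fun h => C (Tuple.sort C h), ⟨fun h _ => htot _, fun h _ i hi => ?_, fun h _ i _ => hx0 _ _,
      fun h _ => hC0 _⟩, Equiv.sum_comp (Tuple.sort C) C⟩
  have h1 := hload i (C (Tuple.sort C h)) (hC0 _)
  rw [zero_add]
  refine le_trans ?_ h1
  rw [Finset.sum_filter, Finset.sum_filter, ← Equiv.sum_comp (Tuple.sort C)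
    fun j => if C j ≤ C (Tuple.sort C h) ∧ i ∈ M j then (I.s : ℝ) + x j i else 0]
  refine Finset.sum_le_sum fun k _ => ?_
  have hm : k ≤ h → C (Tuple.sort C k) ≤ C (Tuple.sort C h) := fun hk => Tuple.monotone_sort C hk
  have := hx0 (Tuple.sort C k) i
  split_ifs with h2 h3 h3
  · rfl
  · exact absurd ⟨hm h2.2.1, h2.2.2⟩ h3
  · positivity
  · rfl

/-! ### Exchange of neighbouring jobs -/

section Exchange

variable {m n : ℕ}

/-- Two jobs with amounts `xa` on `A` and then `xb` on `B` share a machine, and the first one is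
not shorter. Then the amounts can be redistributed so that on each machine the shorter job comes
first and ends no later than the longer one did, and the total time needed does not increase. -/
theorem exists_redistribution {s pa pb : ℝ} (hs : 0 ≤ s) {A B : Finset (Fin m)}
    {xa xb : Fin m → ℝ} (hxa : ∀ i ∈ A, 0 ≤ xa i) (hxb : ∀ i ∈ B, 0 ≤ xb i)
    (hA : ∑ i ∈ A, xa i = pa) (hB : ∑ i ∈ B, xb i = pb) (hp : pb ≤ pa)
    (hAB : (A ∩ B).Nonempty) : ∃ (A' B' : Finset (Fin m)) (xa' xb' : Fin m → ℝ),
    A' ⊆ A ∧ B' ⊆ A ∪ B ∧ (∀ i ∈ A', 0 ≤ xa' i ∧ xa' i ≤ xa i) ∧ (∀ i ∈ B', 0 ≤ xb' i) ∧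
    ∑ i ∈ A', xa' i = pb ∧ ∑ i ∈ B', xb' i = pa ∧
    ∀ i, (if i ∈ A' then s + xa' i else 0) + (if i ∈ B' then s + xb' i else 0) ≤
      (if i ∈ A then s + xa i else 0) + (if i ∈ B then s + xb i else 0) := by
  classical
  have hpb : 0 ≤ pb := hB ▸ Finset.sum_nonneg hxb
  set W := ∑ i ∈ A \ B, xa i with hW
  set V := ∑ i ∈ A ∩ B, xa i with hV
  have hWV : W + V = pa := by
    rw [hW, hV, add_comm, ← hA]
    exact Finset.sum_inter_add_sum_sdiff A B xa
  have hV0 : 0 ≤ V := Finset.sum_nonneg fun i hi => hxa i (Finset.mem_inter.mp hi).1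
  -- The shorter job first takes over the amounts of the longer one outside `B`. If these do not
  -- suffice, it also takes the fraction `lam` of the amounts on shared machines. The longer job
  -- gets what remains there and the amounts of the shorter one, and no new setup arises.
  by_cases hWp : W ≤ pb
  · set lam := (pb - W) / V with hlam
    have hlV : lam * V = pb - W := by
      rcases hV0.eq_or_lt with h | h
      · rw [← h]; linarith
      · rw [hlam]; field_simp
    have hl0 : 0 ≤ lam := div_nonneg (by linarith) hV0
    have hl1 : lam ≤ 1 := div_le_one_of_le₀ (by linarith) hV0
    refine ⟨A, B, fun i => if i ∈ B then lam * xa i else xa i,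
      fun i => xb i + if i ∈ A then (1 - lam) * xa i else 0, subset_rfl, Finset.subset_union_right,
      fun i hi => ?_, fun i hi => ?_, ?_, ?_, fun i => ?_⟩
    · have := hxa i hi
      dsimp only
      split_ifs
      · exact ⟨by positivity, by nlinarith⟩
      · exact ⟨this, le_rfl⟩
    · have := hxb i hi
      have hl : 0 ≤ 1 - lam := by linarith
      dsimp only
      split_ifs with h
      · have := hxa i h; positivity
      · simpa using this
    · rw [← Finset.sum_inter_add_sum_sdiff A B]
      rw [Finset.sum_congr rfl (g := fun i => lam * xa i) (s₁ := A ∩ B) fun i hi => by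
          simp [(Finset.mem_inter.mp hi).2],
        Finset.sum_congr rfl (g := xa) (s₁ := A \ B) fun i hi => by
          simp [(Finset.mem_sdiff.mp hi).2], ← Finset.mul_sum]
      linarith
    · rw [Finset.sum_add_distrib, hB, ← Finset.sum_filter, Finset.filter_mem_eq_inter,
        Finset.inter_comm, ← Finset.mul_sum]
      linarith
    · by_cases h1 : i ∈ A <;> by_cases h2 : i ∈ B <;> simp [h1, h2]
      linarith
  · push Not at hWp
    -- Otherwise a largest set `F` of machines outside `B` is taken over completely, and one further
    -- machine `i0` is split: the shorter job gets `u` there. Existence of `i0` follows from `pb <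
    -- W`.
    obtain ⟨F, hF, hFmax⟩ := Finset.exists_max_image
      ((A \ B).powerset.filter fun F => ∑ i ∈ F, xa i ≤ pb) Finset.card
      ⟨∅, by simp [hpb]⟩
    simp only [Finset.mem_filter, Finset.mem_powerset] at hF hFmax
    obtain ⟨hFJ, hFp⟩ := hF
    obtain ⟨i0, hi0, hi0F⟩ : ∃ i ∈ A \ B, i ∉ F := by
      by_contra hcon
      push Not at hcon
      have : F = A \ B := Finset.Subset.antisymm hFJ hcon
      rw [this] at hFp
      linarith
    have hi0p : pb < ∑ i ∈ F, xa i + xa i0 := by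
      by_contra hcon
      push Not at hcon
      have := hFmax (insert i0 F) ⟨Finset.insert_subset hi0 hFJ, by
        rw [Finset.sum_insert hi0F]; linarith⟩
      rw [Finset.card_insert_of_notMem hi0F] at this
      omega
    obtain ⟨b0, hb0⟩ := hAB
    rw [Finset.mem_inter] at hb0
    rw [Finset.mem_sdiff] at hi0
    set u := pb - ∑ i ∈ F, xa i with hu
    have hFA : ∀ i ∈ F, i ∈ A ∧ i ∉ B := fun i hi => Finset.mem_sdiff.mp (hFJ hi)
    -- The time `y` left for the longer job: on a shared machine only one setup remains and the
    -- other becomes processing time; on `i0` a second setup is needed. Dropping `i0` if its `y` is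
    -- negative only increases the total.
    let y : Fin m → ℝ := fun i => if i ∈ A then (if i ∈ B then xa i + xb i + s
      else if i = i0 then xa i - u - s else xa i) else xb i
    let B' := (A ∪ B).filter fun i => i ∉ F ∧ 0 ≤ y i
    have hy0 : ∀ i ∈ B', 0 ≤ y i := fun i hi => (Finset.mem_filter.mp hi).2.2
    have hysum : pa ≤ ∑ i ∈ B', y i := by
      -- The total before dropping machines: the setup gained on the one shared machine `b0`
      -- balances the additional setup on `i0`. Gains on other shared machines are not counted.
      have h1 : pa = ∑ i, ((if i ∈ A then xa i else 0) + (if i ∈ B then xb i else 0) -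
          (if i ∈ F then xa i else 0) - (if i = i0 then u + s else 0) +
          (if i = b0 then s else 0)) := by
        simp only [Finset.sum_add_distrib, Finset.sum_sub_distrib]
        simp only [Finset.sum_ite_mem, Finset.univ_inter, Finset.sum_ite_eq', Finset.mem_univ,
          if_true, hA, hB]
        linarith
      have h2 : ∑ i ∈ B', y i = ∑ i, if i ∈ B' then y i else 0 := by simp
      rw [h1, h2]
      refine Finset.sum_le_sum fun i _ => ?_
      by_cases hiF : i ∈ F
      · have hAi := hFA i hiF
        have h3 : i ≠ i0 := fun h => hi0F (h ▸ hiF)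
        have h4 : i ≠ b0 := fun h => hAi.2 (h ▸ hb0.2)
        have h5 : i ∉ B' := fun h => (Finset.mem_filter.mp h).2.1 hiF
        simp [hiF, hAi, h3, h4, h5]
      · by_cases hB' : i ∈ B'
        · simp only [hiF, hB', if_true, if_false, y]
          by_cases h1 : i ∈ A <;> by_cases h2 : i ∈ B
          · have h3 : i ≠ i0 := fun h => hi0.2 (h ▸ h2)
            simp only [h1, h2, h3, if_true, if_false]
            split_ifs <;> linarith
          · have h4 : i ≠ b0 := fun h => h2 (h ▸ hb0.2)
            simp only [h1, h2, h4, if_true, if_false]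
            split_ifs <;> linarith
          · have h3 : i ≠ i0 := fun h => h1 (h ▸ hi0.1)
            have h4 : i ≠ b0 := fun h => h1 (h ▸ hb0.1)
            simp [h1, h2, h3, h4]
          · have h3 := (Finset.mem_filter.mp hB').1
            simp [h1, h2] at h3
        · simp only [hiF, hB', if_false]
          by_cases h1 : i ∈ A <;> by_cases h2 : i ∈ B
          · have : i ∈ B' := Finset.mem_filter.mpr ⟨by simp [h1], hiF, by
              have := hxa i h1; have := hxb i h2; simp only [y, h1, h2, if_true]; positivity⟩
            exact absurd this hB'
          · have h4 : i ≠ b0 := fun h => h2 (h ▸ hb0.2)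
            by_cases h3 : i = i0
            · have : ¬ 0 ≤ y i := fun h => hB' (Finset.mem_filter.mpr ⟨by simp [h1], hiF, h⟩)
              simp only [y, h1, h2, h3, hi0.1, hi0.2, if_true, if_false] at this
              simp only [h1, h2, h4, h3, hi0.1, hi0.2, if_true, if_false]
              rw [h3] at h4
              simp only [h4, if_false]
              linarith
            · have : i ∈ B' := Finset.mem_filter.mpr ⟨by simp [h1], hiF, by
                have := hxa i h1; simp only [y, h1, h2, h3, if_true, if_false]; positivity⟩
              exact absurd this hB'
          · have : i ∈ B' := Finset.mem_filter.mpr ⟨by simp [h2], hiF, by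
              have := hxb i h2; simp only [y, h1, if_false]; positivity⟩
            exact absurd this hB'
          · have h3 : i ≠ i0 := fun h => h1 (h ▸ hi0.1)
            have h4 : i ≠ b0 := fun h => h1 (h ▸ hb0.1)
            simp [h1, h2, h3, h4]
    have hpa : 0 ≤ pa := hpb.trans hp
    set Y := ∑ i ∈ B', y i with hY
    have hY0 : 0 ≤ Y := hpa.trans hysum
    have hlY : pa / Y * Y = pa := by
      rcases hY0.eq_or_lt with h | h
      · rw [← h]; simp; linarith
      · field_simp
    have hl0 : 0 ≤ pa / Y := div_nonneg hpa hY0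
    have hl1 : pa / Y ≤ 1 := div_le_one_of_le₀ hysum hY0
    have hu0 : 0 ≤ u := by rw [hu]; linarith
    -- The available time may exceed `pa`, so the amounts are scaled down by `pa / Y`.
    refine ⟨insert i0 F, B', fun i => if i = i0 then u else xa i, fun i => pa / Y * y i, ?_,
      Finset.filter_subset _ _, ?_, fun i hi => mul_nonneg hl0 (hy0 i hi), ?_, ?_, ?_⟩
    · exact Finset.insert_subset hi0.1 fun i hi => (hFA i hi).1
    · intro i hi
      rcases Finset.mem_insert.mp hi with rfl | h
      · simp only [if_true]; exact ⟨hu0, by linarith⟩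
      · have h3 : i ≠ i0 := fun h' => hi0F (h' ▸ h)
        simp only [h3, if_false]
        exact ⟨hxa i (hFA i h).1, le_rfl⟩
    · rw [Finset.sum_insert hi0F, if_pos rfl, Finset.sum_congr rfl (g := xa) fun i hi => by
        have h3 : i ≠ i0 := fun h' => hi0F (h' ▸ hi)
        simp [h3]]
      linarith
    · rw [← Finset.mul_sum, hlY]
    · intro i
      have hle : i ∈ B' → pa / Y * y i ≤ y i := fun h => by
        have := hy0 i h
        nlinarith
      have hz : (if i ∈ B' then s + pa / Y * y i else 0) ≤ if i ∈ B' then s + y i else 0 := by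
        split_ifs with h
        · linarith [hle h]
        · rfl
      refine (add_le_add_right hz _).trans ?_
      by_cases hiF : i ∈ F
      · have hAi := hFA i hiF
        have h3 : i ≠ i0 := fun h => hi0F (h ▸ hiF)
        have h5 : i ∉ B' := fun h => (Finset.mem_filter.mp h).2.1 hiF
        simp [hiF, hAi, h3, h5]
      · by_cases h3 : i = i0
        · subst h3
          by_cases hB' : i ∈ B'
          · simp only [Finset.mem_insert_self, if_true, hB', hi0.1, hi0.2, if_false, y]
            linarith
          · simp only [Finset.mem_insert_self, if_true, hB', hi0.1, hi0.2, if_false]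
            linarith
        · have h4 : i ∉ insert i0 F := by simp [h3, hiF]
          simp only [h4, if_false, zero_add]
          by_cases hB' : i ∈ B'
          · have h5 := (Finset.mem_filter.mp hB').1
            simp only [hB', if_true, y]
            by_cases h1 : i ∈ A <;> by_cases h2 : i ∈ B
            · simp only [h1, h2, if_true]; linarith
            · simp [h1, h2, h3]
            · simp [h1, h2]
            · simp [h1, h2] at h5
          · simp only [hB', if_false]
            have h6 : 0 ≤ if i ∈ A then s + xa i else 0 := by
              split_ifs with h
              · linarith [hxa i h]
              · rfl
            have h7 : 0 ≤ if i ∈ B then s + xb i else 0 := by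
              split_ifs with h
              · linarith [hxb i h]
              · rfl
            linarith

end Exchange

end SplitSched

/-! ### Sorting a sequence of jobs by exchanges of neighbours -/

namespace SplitSched

section Exchange

variable {m n : ℕ}

theorem sum_prefix_eq (g : Fin n → ℝ) (M : Fin n → Finset (Fin m)) (i : Fin m) (h : Fin n) :
    ∑ k with 0 ≤ k.val ∧ k ≤ h ∧ i ∈ M k, g k =
      ∑ k, if k ≤ h then (if i ∈ M k then g k else 0) else 0 := by
  rw [Finset.sum_filter]
  refine Finset.sum_congr rfl fun k _ => ?_
  by_cases h1 : k ≤ h <;> by_cases h2 : i ∈ M k <;> simp [h1, h2]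

theorem sum_prefix_eq_self (g : Fin n → ℝ) (a : Fin n) :
    (∑ k, if k ≤ a then g k else 0) = (∑ k, if k < a then g k else 0) + g a := by
  have : g a = ∑ k, if k = a then g k else 0 := by simp
  rw [this, ← Finset.sum_add_distrib]
  refine Finset.sum_congr rfl fun k _ => ?_
  rcases lt_trichotomy k a with h | h | h
  · simp [h, h.le, h.ne]
  · simp [h]
  · simp [h.not_ge, h.not_gt, h.ne']

theorem sum_prefix_split (g : Fin n → ℝ) {a b h : Fin n} (hab : b.val = a.val + 1) (hb : b ≤ h) :
    (∑ k, if k ≤ h then g k else 0) = (∑ k, if k < a then g k else 0) + g a + g b +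
      ∑ k, if b < k ∧ k ≤ h then g k else 0 := by
  have h1 : (∑ k, if k ≤ h then g k else 0) = (∑ k, if k ≤ b then g k else 0) +
      ∑ k, if b < k ∧ k ≤ h then g k else 0 := by
    rw [← Finset.sum_add_distrib]
    refine Finset.sum_congr rfl fun k _ => ?_
    rcases le_or_gt k b with hk | hk
    · simp [hk, hk.trans hb, hk.not_gt]
    · simp [hk, hk.not_ge]
  have h2 : ∀ k : Fin n, k < b ↔ k ≤ a := fun k => by
    rw [Fin.lt_def, Fin.le_def, hab]; omega
  rw [h1, sum_prefix_eq_self g b]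
  simp only [h2]
  rw [sum_prefix_eq_self g a]

/-- Replacing the amounts of two neighbouring jobs. -/
theorem LPFeasible.replace {s : ℝ} {q : Fin n → ℝ} {M : Fin n → Finset (Fin m)}
    {x : Fin n → Fin m → ℝ} {C : Fin n → ℝ} (hx : LPFeasible s q 0 (fun _ => 0) M x C)
    {a b : Fin n} (hab : b.val = a.val + 1) {A B : Finset (Fin m)} {xa xb : Fin m → ℝ} {ca cb : ℝ}
    (hxa : ∀ i ∈ A, 0 ≤ xa i) (hxb : ∀ i ∈ B, 0 ≤ xb i)
    (hA : ∑ i ∈ A, xa i = q b) (hB : ∑ i ∈ B, xb i = q a)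
    (hblock : ∀ i, (if i ∈ A then s + xa i else 0) + (if i ∈ B then s + xb i else 0) ≤
      (if i ∈ M a then s + x a i else 0) + (if i ∈ M b then s + x b i else 0))
    (hca : ∀ i ∈ A, (∑ k, if k < a then (if i ∈ M k then s + x k i else 0) else 0) +
      (if i ∈ A then s + xa i else 0) ≤ ca)
    (hcb : ∀ i ∈ B, (∑ k, if k < a then (if i ∈ M k then s + x k i else 0) else 0) +
      (if i ∈ A then s + xa i else 0) + (if i ∈ B then s + xb i else 0) ≤ cb)
    (hca0 : 0 ≤ ca) (hcb0 : 0 ≤ cb) (hsum : ca + cb = C a + C b) :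
    ∃ (M' : Fin n → Finset (Fin m)) (x' : Fin n → Fin m → ℝ) (C' : Fin n → ℝ),
      LPFeasible s (q ∘ Equiv.swap a b) 0 (fun _ => 0) M' x' C' ∧ ∑ h, C' h = ∑ h, C h := by
  have hne : b ≠ a := fun h => by rw [h] at hab; omega
  let M' : Fin n → Finset (Fin m) := fun k => if k = a then A else if k = b then B else M k
  let x' : Fin n → Fin m → ℝ := fun k => if k = a then xa else if k = b then xb else x k
  let C' : Fin n → ℝ := fun k => if k = a then ca else if k = b then cb else C k
  have hM : M' a = A ∧ M' b = B ∧ ∀ k, k ≠ a → k ≠ b → M' k = M k :=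
    ⟨by simp [M'], by simp [M', hne], fun k h1 h2 => by simp [M', h1, h2]⟩
  have hX : x' a = xa ∧ x' b = xb ∧ ∀ k, k ≠ a → k ≠ b → x' k = x k :=
    ⟨by simp [x'], by simp [x', hne], fun k h1 h2 => by simp [x', h1, h2]⟩
  have hC : C' a = ca ∧ C' b = cb ∧ ∀ k, k ≠ a → k ≠ b → C' k = C k :=
    ⟨by simp [C'], by simp [C', hne], fun k h1 h2 => by simp [C', h1, h2]⟩
  have hsame : ∀ (p : Fin n → Prop) [DecidablePred p] (i : Fin m), ¬ p a → ¬ p b →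
      (∑ k, if p k then (if i ∈ M' k then s + x' k i else 0) else 0) =
      ∑ k, if p k then (if i ∈ M k then s + x k i else 0) else 0 := by
    intro p _ i ha hb
    refine Finset.sum_congr rfl fun k _ => ?_
    by_cases hk : p k
    · have h1 : k ≠ a := fun h => ha (h ▸ hk)
      have h2 : k ≠ b := fun h => hb (h ▸ hk)
      rw [hM.2.2 k h1 h2, hX.2.2 k h1 h2]
    · simp [hk]
  have hlow : ∀ i, (∑ k, if k < a then (if i ∈ M' k then s + x' k i else 0) else 0) =
      ∑ k, if k < a then (if i ∈ M k then s + x k i else 0) else 0 := fun i =>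
    hsame (fun k => k < a) i (lt_irrefl a) (by rw [Fin.lt_def, hab]; omega)
  refine ⟨M', x', C', ⟨fun h _ => ?_, fun h _ i hi => ?_, fun h _ i hi => ?_, fun h _ => ?_⟩, ?_⟩
  · by_cases h1 : h = a
    · subst h1; simp [hM.1, hX.1, hA]
    · by_cases h2 : h = b
      · subst h2; simp [hM.2.1, hX.2.1, hB]
      · rw [hM.2.2 h h1 h2, hX.2.2 h h1 h2, Function.comp, Equiv.swap_apply_of_ne_of_ne h1 h2]
        exact hx.total h (Nat.zero_le _)
  · rw [zero_add, sum_prefix_eq]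
    by_cases h1 : h = a
    · subst h1
      rw [hM.1] at hi
      rw [sum_prefix_eq_self, hlow, hM.1, hX.1, hC.1]
      exact hca i hi
    by_cases h2 : h = b
    · subst h2
      rw [hM.2.1] at hi
      rw [sum_prefix_split _ hab le_rfl, hlow, hM.1, hX.1, hM.2.1, hX.2.1, hC.2.1]
      have : (∑ k, if h < k ∧ k ≤ h then (if i ∈ M' k then s + x' k i else 0) else 0) = 0 :=
        Finset.sum_eq_zero fun k _ => if_neg fun h' => absurd h'.1 h'.2.not_gt
      rw [this, add_zero]
      exact hcb i hi
    rw [hM.2.2 h h1 h2] at hi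
    rw [hC.2.2 h h1 h2]
    have hold := hx.finish h (Nat.zero_le _) i hi
    rw [zero_add, sum_prefix_eq] at hold
    rcases lt_or_ge h b with hb | hb
    · have ha : ¬ a ≤ h := by
        have : h.val ≠ a.val := fun h' => h1 (Fin.ext h')
        rw [Fin.lt_def] at hb
        rw [Fin.le_def]
        omega
      rw [hsame (fun k => k ≤ h) i ha hb.not_ge]
      exact hold
    -- A later job depends only on the time that the two jobs need together on each machine, and by
    -- `hblock` this does not increase.
    · rw [sum_prefix_split _ hab hb] at hold ⊢
      rw [hlow, hM.1, hX.1, hM.2.1, hX.2.1, hsame (fun k => b < k ∧ k ≤ h) i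
        (fun h' => by have := h'.1; rw [Fin.lt_def, hab] at this; omega)
        (fun h' => lt_irrefl _ h'.1)]
      have := hblock i
      linarith
  · by_cases h1 : h = a
    · subst h1
      rw [hM.1] at hi
      rw [hX.1]
      exact hxa i hi
    by_cases h2 : h = b
    · subst h2
      rw [hM.2.1] at hi
      rw [hX.2.1]
      exact hxb i hi
    rw [hM.2.2 h h1 h2] at hi
    rw [hX.2.2 h h1 h2]
    exact hx.x_nonneg h (Nat.zero_le _) i hi
  · by_cases h1 : h = a
    · subst h1; rwa [hC.1]
    by_cases h2 : h = b
    · subst h2; rwa [hC.2.1]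
    rw [hC.2.2 h h1 h2]
    exact hx.C_nonneg h (Nat.zero_le _)
  · have h1 : ∀ D : Fin n → ℝ, ∑ h, D h = D a + D b + ∑ h ∈ (Finset.univ.erase a).erase b, D h := by
      intro D
      rw [← Finset.add_sum_erase _ _ (Finset.mem_univ a), ← Finset.add_sum_erase _ _
        (Finset.mem_erase.mpr ⟨hne, Finset.mem_univ b⟩), add_assoc]
    rw [h1 C', h1 C, hC.1, hC.2.1, hsum]
    congr 1
    refine Finset.sum_congr rfl fun k hk => ?_
    simp only [Finset.mem_erase, Finset.mem_univ, and_true] at hk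
    exact hC.2.2 k hk.2 hk.1

/-- Neighbouring jobs can be brought into the order of their lengths. -/
theorem LPFeasible.swap {s : ℝ} (hs : 0 ≤ s) {q : Fin n → ℝ} {M : Fin n → Finset (Fin m)}
    {x : Fin n → Fin m → ℝ} {C : Fin n → ℝ} (hx : LPFeasible s q 0 (fun _ => 0) M x C)
    {a b : Fin n} (hab : b.val = a.val + 1) (hq : q b ≤ q a) :
    ∃ (M' : Fin n → Finset (Fin m)) (x' : Fin n → Fin m → ℝ) (C' : Fin n → ℝ),
      LPFeasible s (q ∘ Equiv.swap a b) 0 (fun _ => 0) M' x' C' ∧ ∑ h, C' h = ∑ h, C h := by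
  have hca : ∀ i ∈ M a, (∑ k, if k < a then (if i ∈ M k then s + x k i else 0) else 0) +
      (if i ∈ M a then s + x a i else 0) ≤ C a := by
    intro i hi
    have := hx.finish a (Nat.zero_le _) i hi
    rwa [zero_add, sum_prefix_eq, sum_prefix_eq_self] at this
  have hcb : ∀ i ∈ M b, (∑ k, if k < a then (if i ∈ M k then s + x k i else 0) else 0) +
      (if i ∈ M a then s + x a i else 0) + (if i ∈ M b then s + x b i else 0) ≤ C b := by
    intro i hi
    have := hx.finish b (Nat.zero_le _) i hi
    rw [zero_add, sum_prefix_eq, sum_prefix_split _ hab le_rfl] at this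
    have h0 : (∑ k, if b < k ∧ k ≤ b then (if i ∈ M k then s + x k i else 0) else 0) = 0 :=
      Finset.sum_eq_zero fun k _ => if_neg fun h' => absurd h'.1 h'.2.not_gt
    rwa [h0, add_zero] at this
  have hxa := hx.x_nonneg a (Nat.zero_le _)
  have hxb := hx.x_nonneg b (Nat.zero_le _)
  have hta : ∀ i, 0 ≤ if i ∈ M a then s + x a i else 0 := fun i => by
    split_ifs with h
    · linarith [hxa i h]
    · rfl
  have htb : ∀ i, 0 ≤ if i ∈ M b then s + x b i else 0 := fun i => by
    split_ifs with h
    · linarith [hxb i h]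
    · rfl
  -- In these cases the two jobs just change places and keep their amounts and completion times: the
  -- longer job is delayed only on a shared machine, where it now ends by `C b`.
  by_cases hcase : C b ≤ C a ∨ M a ∩ M b = ∅
  · refine hx.replace hab (A := M b) (B := M a) (xa := x b) (xb := x a) (ca := C b) (cb := C a)
      hxb hxa (hx.total b (Nat.zero_le _)) (hx.total a (Nat.zero_le _)) (fun i => by rw [add_comm])
      (fun i hi => ?_) (fun i hi => ?_) (hx.C_nonneg b (Nat.zero_le _))
      (hx.C_nonneg a (Nat.zero_le _)) (add_comm _ _)
    · linarith [hcb i hi, hta i]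
    · by_cases hib : i ∈ M b
      · rcases hcase with h | h
        · linarith [hcb i hib]
        · have : i ∈ M a ∩ M b := Finset.mem_inter.mpr ⟨hi, hib⟩
          rw [h] at this
          exact absurd this (Finset.notMem_empty i)
      · have := hca i hi
        rw [if_neg hib]
        linarith
  · push Not at hcase
    -- Here `C a < C b`. The completion times stay with the positions: the shorter job inherits `C
    -- a` and the longer one `C b`. The latter may now use machines of `M a` outside `M b`, on which
    -- everything ends by `C a`.
    obtain ⟨A, B, xa, xb, hA, hB, hxa', hxb', hsa, hsb, hbl⟩ := exists_redistribution hs hxa hxb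
      (hx.total a (Nat.zero_le _)) (hx.total b (Nat.zero_le _)) hq hcase.2
    refine hx.replace hab (A := A) (B := B) (xa := xa) (xb := xb) (ca := C a) (cb := C b)
      (fun i hi => (hxa' i hi).1) hxb' hsa hsb hbl
      (fun i hi => ?_) (fun i hi => ?_) (hx.C_nonneg a (Nat.zero_le _))
      (hx.C_nonneg b (Nat.zero_le _)) rfl
    · have h1 := hca i (hA hi)
      have h2 := (hxa' i hi).2
      rw [if_pos (hA hi)] at h1
      rw [if_pos hi]
      linarith
    · have h1 := hbl i
      by_cases hib : i ∈ M b
      · linarith [hcb i hib]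
      · have hia : i ∈ M a := by
          rcases Finset.mem_union.mp (hB hi) with h | h
          · exact h
          · exact absurd h hib
        have := hca i hia
        rw [if_neg hib] at h1
        linarith [hcase.1]

/-- The jobs can be brought into SPT order. -/
theorem LPFeasible.exists_spt {s : ℝ} (hs : 0 ≤ s) {p : Fin n → ℝ} {π₀ : Equiv.Perm (Fin n)}
    {M : Fin n → Finset (Fin m)} {x : Fin n → Fin m → ℝ} {C : Fin n → ℝ}
    (hx : LPFeasible s (p ∘ π₀) 0 (fun _ => 0) M x C) :
    ∃ (π : Equiv.Perm (Fin n)) (M' : Fin n → Finset (Fin m)) (x' : Fin n → Fin m → ℝ)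
      (C' : Fin n → ℝ), Monotone (p ∘ π) ∧ LPFeasible s (p ∘ π) 0 (fun _ => 0) M' x' C' ∧
      ∑ h, C' h = ∑ h, C h := by
  classical
  let good : Set (Equiv.Perm (Fin n)) := {π | ∃ (M' : Fin n → Finset (Fin m))
    (x' : Fin n → Fin m → ℝ) (C' : Fin n → ℝ), LPFeasible s (p ∘ π) 0 (fun _ => 0) M' x' C' ∧
      ∑ h, C' h = ∑ h, C h}
  -- The potential `∑ h * p (π h)` strictly increases when a neighbouring pair in the wrong order is
  -- exchanged, so a maximizer among the attainable orders is sorted.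
  obtain ⟨π, ⟨M', x', C', hf, hC⟩, hmax⟩ := Set.exists_max_image good
    (fun π => ∑ h, (h.val : ℝ) * p (π h)) (Set.toFinite _) ⟨π₀, M, x, C, hx, rfl⟩
  refine ⟨π, M', x', C', ?_, hf, hC⟩
  by_contra hmono
  obtain ⟨a, b, hab, hlt⟩ : ∃ a b : Fin n, b.val = a.val + 1 ∧ p (π b) < p (π a) := by
    cases n with
    | zero => exact absurd (fun i => i.elim0) hmono
    | succ n =>
      rw [Fin.monotone_iff_le_succ] at hmono
      push Not at hmono
      obtain ⟨i, hi⟩ := hmono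
      exact ⟨i.castSucc, i.succ, by simp, hi⟩
  have hne : b ≠ a := fun h => by rw [h] at hab; omega
  obtain ⟨M2, x2, C2, hf2, hC2⟩ := hf.swap hs hab hlt.le
  have := hmax (Equiv.swap a b |>.trans π) ⟨M2, x2, C2, hf2, hC2.trans hC⟩
  have h1 : ∀ D : Fin n → ℝ, ∑ h, D h = D a + D b + ∑ h ∈ (Finset.univ.erase a).erase b, D h := by
    intro D
    rw [← Finset.add_sum_erase _ _ (Finset.mem_univ a), ← Finset.add_sum_erase _ _
      (Finset.mem_erase.mpr ⟨hne, Finset.mem_univ b⟩), add_assoc]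
  have h2 : ∑ h ∈ (Finset.univ.erase a).erase b, (h.val : ℝ) * p (((Equiv.swap a b).trans π) h) =
      ∑ h ∈ (Finset.univ.erase a).erase b, (h.val : ℝ) * p (π h) := by
    refine Finset.sum_congr rfl fun k hk => ?_
    simp only [Finset.mem_erase, Finset.mem_univ, and_true] at hk
    rw [Equiv.trans_apply, Equiv.swap_apply_of_ne_of_ne hk.2 hk.1]
  rw [h1, h1 fun h => (h.val : ℝ) * p (π h), h2] at this
  simp only [Equiv.trans_apply, Equiv.swap_apply_left, Equiv.swap_apply_right, hab] at this
  push_cast at this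
  linarith

end Exchange

end SplitSched

namespace SplitSched

/-! ### List scheduling -/

section ListScheduling

variable {m n : ℕ}

theorem listLoad_congr {s : ℝ} {q : Fin n → ℝ} {f g : Fin n → Fin m} {h : ℕ}
    (hfg : ∀ k : Fin n, k.val < h → f k = g k) (i : Fin m) :
    listLoad s q f h i = listLoad s q g h i := by
  unfold listLoad
  congr 1
  ext k
  simp only [Finset.mem_filter, Finset.mem_univ, true_and]
  exact and_congr_right fun hk => by rw [hfg k hk]

theorem listLoad_zero (s : ℝ) (q : Fin n → ℝ) (f : Fin n → Fin m) (i : Fin m) :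
    listLoad s q f 0 i = 0 := by
  simp [listLoad]

theorem listLoad_succ (s : ℝ) (q : Fin n → ℝ) (f : Fin n → Fin m) (h : Fin n) (i : Fin m) :
    listLoad s q f (h.val + 1) i = listLoad s q f h i + if f h = i then s + q h else 0 := by
  have : (if f h = i then s + q h else 0) = ∑ k, if k = h then (if f k = i then s + q k else 0) else 0 := by
    simp
  rw [this]
  simp only [listLoad, Finset.sum_filter]
  rw [← Finset.sum_add_distrib]
  refine Finset.sum_congr rfl fun k _ => ?_
  rcases lt_trichotomy k h with hk | hk | hk
  · have h1 : k.val < h.val := hk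
    simp [h1, hk.ne, h1.le]
  · subst hk; simp
  · have h1 : h.val < k.val := hk
    simp [hk.ne', h1.not_gt, h1.not_ge]

theorem listLoad_update_of_le {s : ℝ} {q : Fin n → ℝ} (f : Fin n → Fin m) (h : Fin n) (i : Fin m)
    {k : ℕ} (hk : k ≤ h.val) (i' : Fin m) :
    listLoad s q (Function.update f h i) k i' = listLoad s q f k i' := by
  refine listLoad_congr (fun l hl => ?_) i'
  have : l ≠ h := fun e => by rw [e] at hl; omega
  simp [this]

theorem listLoad_nonneg {s : ℝ} {q : Fin n → ℝ} (hsq : ∀ k, 0 ≤ s + q k) (f : Fin n → Fin m)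
    (h : ℕ) (i : Fin m) : 0 ≤ listLoad s q f h i :=
  Finset.sum_nonneg fun k _ => hsq k

theorem sum_listLoad (s : ℝ) (q : Fin n → ℝ) (f : Fin n → Fin m) (h : ℕ) :
    ∑ i, listLoad s q f h i = ∑ k with k.val < h, (s + q k) := by
  simp only [listLoad, Finset.sum_filter]
  rw [Finset.sum_comm]
  refine Finset.sum_congr rfl fun k _ => ?_
  by_cases hk : k.val < h <;> simp [hk]

theorem IsListSchedule.mono {s : ℝ} {q : Fin n → ℝ} {K K' : ℕ} {t : Fin m → ℝ} {f : Fin n → Fin m}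
    (hf : IsListSchedule s q K t f) (hK : K' ≤ K) : IsListSchedule s q K' t f :=
  fun h hh => hf h (hh.trans_le hK)

/-- Assigning one more job. -/
theorem IsListSchedule.extend {s : ℝ} {q : Fin n → ℝ} {t : Fin m → ℝ} {f : Fin n → Fin m}
    {h : Fin n} (hf : IsListSchedule s q h t f) {i : Fin m} (hi : listLoad s q f h i < t i)
    (hmin : ∀ i', listLoad s q f h i' < t i' → listLoad s q f h i < listLoad s q f h i' ∨
      (listLoad s q f h i = listLoad s q f h i' ∧ i ≤ i')) :
    IsListSchedule s q (h.val + 1) t (Function.update f h i) := by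
  intro k hk
  have hle : k.val ≤ h.val := Nat.lt_succ_iff.mp hk
  simp only [listLoad_update_of_le f h i hle]
  rcases hle.eq_or_lt with he | hlt
  · obtain rfl : k = h := Fin.ext he
    simpa using ⟨hi, hmin⟩
  · have : k ≠ h := fun e => by rw [e] at hlt; omega
    simpa [this] using hf k hlt

/-- The list schedule is unique. -/
theorem IsListSchedule.unique {s : ℝ} {q : Fin n → ℝ} {K : ℕ} {t : Fin m → ℝ}
    {f g : Fin n → Fin m} (hf : IsListSchedule s q K t f) (hg : IsListSchedule s q K t g) :
    ∀ k : Fin n, k.val < K → f k = g k := by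
  intro k
  induction k using WellFoundedLT.induction with
  | _ k ih =>
    intro hk
    have hl : ∀ i, listLoad s q f k i = listLoad s q g k i :=
      listLoad_congr fun l hl => ih l hl (hl.trans hk)
    obtain ⟨h1, h2⟩ := hf k hk
    obtain ⟨h3, h4⟩ := hg k hk
    rw [hl] at h1
    have h5 := h4 (f k) h1
    rw [← hl] at h3
    have h6 := h2 (g k) h3
    rw [hl, hl] at h6
    rcases h5 with h5 | h5 <;> rcases h6 with h6 | h6
    · exact absurd h5 h6.not_gt
    · exact absurd h5 h6.1.not_gt
    · exact absurd h6 h5.1.not_gt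
    · exact le_antisymm h6.2 h5.2

/-- There is a list schedule if the machines are open for long enough. -/
theorem exists_isListSchedule {s : ℝ} {q : Fin n → ℝ} (hsq : ∀ k, 0 < s + q k) (t : Fin m → ℝ)
    (i₀ : Fin m) {K : ℕ} (hK : K ≤ n) (ht : ∑ k with k.val < K, (s + q k) ≤ ∑ i, t i) :
    ∃ f : Fin n → Fin m, IsListSchedule s q K t f := by
  suffices H : ∀ K' ≤ K, ∃ f : Fin n → Fin m, IsListSchedule s q K' t f from H K le_rfl
  intro K' hK'
  induction K' with
  | zero => exact ⟨fun _ => i₀, fun h hh => absurd hh (Nat.not_lt_zero _)⟩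
  | succ k ih =>
    obtain ⟨f, hf⟩ := ih (by omega)
    let h : Fin n := ⟨k, by omega⟩
    -- If all machines were closed, the jobs before `h` would fill the sum of all `t i`, which
    -- suffices for all `K` jobs, including `h` of positive length.
    have hopen : ∃ i, listLoad s q f h i < t i := by
      by_contra hcon
      push Not at hcon
      have h1 : ∑ i, t i ≤ ∑ i, listLoad s q f h i := Finset.sum_le_sum fun i _ => hcon i
      rw [sum_listLoad] at h1
      have h2 : ∑ l with l.val < h.val, (s + q l) < ∑ l with l.val < K, (s + q l) := by
        refine Finset.sum_lt_sum_of_subset (i := h) ?_ ?_ ?_ (hsq h) fun l _ _ => (hsq l).le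
        · intro l hl
          simp only [Finset.mem_filter, Finset.mem_univ, true_and] at hl ⊢
          exact hl.trans (by simp only [h]; omega)
        · simpa [h] using (by omega : k < K)
        · simp
      linarith
    obtain ⟨i1, hi1, hmin1⟩ := Set.exists_min_image {i | listLoad s q f h i < t i}
      (fun i => listLoad s q f h i) (Set.toFinite _) hopen
    obtain ⟨i, ⟨hi, hie⟩, hmin⟩ := Set.exists_min_image
      {i | listLoad s q f h i < t i ∧ listLoad s q f h i = listLoad s q f h i1} id
      (Set.toFinite _) ⟨i1, hi1, rfl⟩
    refine ⟨_, IsListSchedule.extend (h := h) hf hi fun i' hi' => ?_⟩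
    rw [hie]
    rcases (hmin1 i' hi').lt_or_eq with hl | he
    · exact .inl hl
    · exact .inr ⟨he, hmin i' ⟨hi', he.symm⟩⟩

/-- A list schedule exceeds the guessed loads by less than one job. -/
theorem IsListSchedule.listLoad_le {s δ : ℝ} {q : Fin n → ℝ} {K : ℕ} {t : Fin m → ℝ}
    {f : Fin n → Fin m} (hf : IsListSchedule s q K t f) (hK : K ≤ n) (ht : ∀ i, 0 ≤ t i)
    (hδ : 0 ≤ δ) (hq : ∀ k : Fin n, k.val < K → s + q k ≤ δ) (i : Fin m) :
    listLoad s q f K i ≤ t i + δ := by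
  suffices H : ∀ k ≤ K, listLoad s q f k i ≤ t i + δ from H K le_rfl
  intro k hk
  induction k with
  | zero => rw [listLoad_zero]; exact add_nonneg (ht i) hδ
  | succ k ih =>
    let h : Fin n := ⟨k, by omega⟩
    have := listLoad_succ s q f h i
    change listLoad s q f (k + 1) i = listLoad s q f k i + _ at this
    rw [this]
    split_ifs with hfi
    · have h1 := (hf h (by simp only [h]; omega)).1
      rw [hfi] at h1
      have h2 := hq h (by simp only [h]; omega)
      change listLoad s q f k i < t i at h1
      linarith
    · rw [add_zero]; exact ih (by omega)

end ListScheduling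

/-! ### Lower bounds -/

section LowerBounds

variable {m n : ℕ}

/-- The smallest sum of `h + 1` values of a monotone function is the sum of the first ones. -/
theorem sum_prefix_le_of_perm {g : Fin n → ℝ} (hg : Monotone g) (τ : Equiv.Perm (Fin n))
    (h : Fin n) : ∑ k with k ≤ h, g k ≤ ∑ k with k ≤ h, g (τ k) := by
  classical
  set P : Finset (Fin n) := Finset.univ.filter fun k => k ≤ h with hP
  set A := P.map τ.toEmbedding with hA
  have h1 : ∑ k ∈ P, g (τ k) = ∑ k ∈ A, g k := by rw [hA, Finset.sum_map]; rfl
  -- Every value in `P \ A` is at most `g h` and every value in `A \ P` at least `g h`, and the two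
  -- sets have equally many elements.
  have hcard : (P \ A).card = (A \ P).card := by
    have e1 := Finset.card_sdiff_add_card_inter P A
    have e2 := Finset.card_sdiff_add_card_inter A P
    rw [Finset.inter_comm] at e2
    have e3 : A.card = P.card := Finset.card_map _
    omega
  rw [h1, ← Finset.sum_inter_add_sum_sdiff P A, ← Finset.sum_inter_add_sum_sdiff A P,
    Finset.inter_comm A P]
  have h2 : ∑ k ∈ P \ A, g k ≤ (P \ A).card • g h := Finset.sum_le_card_nsmul _ _ _ fun k hk =>
    hg (Finset.mem_filter.mp (Finset.mem_sdiff.mp hk).1).2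
  have h3 : (A \ P).card • g h ≤ ∑ k ∈ A \ P, g k := Finset.card_nsmul_le_sum _ _ _ fun k hk => by
    have := (Finset.mem_sdiff.mp hk).2
    simp only [hP, Finset.mem_filter, Finset.mem_univ, true_and, not_le] at this
    exact hg this.le
  rw [hcard] at h2
  linarith

/-- Some ordering of the values of `C` dominates the prefix sums of `g`. -/
theorem exists_perm_prefix_le {g : Fin n → ℝ} (hg : Monotone g) (hg0 : ∀ k, 0 ≤ g k)
    (C : Fin n → ℝ) : ∃ τ : Equiv.Perm (Fin n),
    ∀ h, ∑ k with k ≤ h, g k ≤ ∑ k with C k ≤ C (τ h), g k := by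
  -- Up to the `(h + 1)`-st smallest value of `C` there are at least `h + 1` indices, and the sum of
  -- `g` over them is at least the one over the first `h + 1`.
  refine ⟨Tuple.sort C, fun h => (sum_prefix_le_of_perm hg (Tuple.sort C) h).trans ?_⟩
  rw [Finset.sum_filter, Finset.sum_filter, ← Equiv.sum_comp (Tuple.sort C)
    fun k => if C k ≤ C (Tuple.sort C h) then g k else 0]
  refine Finset.sum_le_sum fun k _ => ?_
  have hm : k ≤ h → C (Tuple.sort C k) ≤ C (Tuple.sort C h) := fun hk => Tuple.monotone_sort C hk
  by_cases h1 : k ≤ h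
  · simp [h1, hm h1]
  · rw [if_neg h1]
    split_ifs
    · exact hg0 _
    · rfl

/-- On one machine, the jobs that are completed by time `c` need at most time `c`. -/
theorem LPFeasible.sum_completed_le {s : ℝ} (hs : 0 ≤ s) {q : Fin n → ℝ}
    {M : Fin n → Finset (Fin m)} {x : Fin n → Fin m → ℝ} {C : Fin n → ℝ}
    (hx : LPFeasible s q 0 (fun _ => 0) M x C) {c : ℝ} (hc : 0 ≤ c) (i : Fin m) :
    ∑ k with C k ≤ c ∧ i ∈ M k, (s + x k i) ≤ c := by
  classical
  rcases (Finset.univ.filter fun k => C k ≤ c ∧ i ∈ M k).eq_empty_or_nonempty with h | h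
  · rw [h]; simpa using hc
  -- The constraint of the last of these jobs in the sequence already covers all of them.
  · obtain ⟨k0, hk0, hmax⟩ := Finset.exists_max_image _ id h
    simp only [Finset.mem_filter, Finset.mem_univ, true_and, id] at hk0 hmax
    have := hx.finish k0 (Nat.zero_le _) i hk0.2
    rw [zero_add] at this
    refine le_trans ?_ (this.trans hk0.1)
    refine Finset.sum_le_sum_of_subset_of_nonneg (fun k hk => ?_) fun k hk _ => ?_
    · simp only [Finset.mem_filter, Finset.mem_univ, true_and] at hk ⊢
      exact ⟨Nat.zero_le _, hmax k hk, hk.2⟩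
    · simp only [Finset.mem_filter, Finset.mem_univ, true_and] at hk
      linarith [hx.x_nonneg k (Nat.zero_le _) i hk.2.2]

/-- The work of jobs in terms of the machine loads. -/
theorem LPFeasible.sum_work_le {s : ℝ} (hs : 0 ≤ s) {q : Fin n → ℝ} (hq : ∀ k, 0 < q k)
    {M : Fin n → Finset (Fin m)} {x : Fin n → Fin m → ℝ} {C : Fin n → ℝ}
    (hx : LPFeasible s q 0 (fun _ => 0) M x C) (p : Fin n → Prop) [DecidablePred p] :
    ∑ k with p k, (s + q k) ≤ ∑ i, ∑ k with p k ∧ i ∈ M k, (s + x k i) := by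
  classical
  have : ∑ i, ∑ k with p k ∧ i ∈ M k, (s + x k i) = ∑ k with p k, ∑ i ∈ M k, (s + x k i) := by
    simp only [Finset.sum_filter]
    rw [Finset.sum_comm]
    refine Finset.sum_congr rfl fun k _ => ?_
    by_cases hk : p k
    · simp only [hk, true_and, if_true]
      rw [← Finset.sum_filter, Finset.filter_mem_eq_inter, Finset.univ_inter]
    · simp [hk]
  rw [this]
  refine Finset.sum_le_sum fun k _ => ?_
  rw [Finset.sum_add_distrib, hx.total k (Nat.zero_le _), Finset.sum_const, nsmul_eq_mul]
  -- A job of positive length uses some machine and therefore needs at least one setup.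
  have hne : (M k).Nonempty := by
    by_contra h
    rw [Finset.not_nonempty_iff_eq_empty] at h
    have := hx.total k (Nat.zero_le _)
    rw [h, Finset.sum_empty] at this
    exact absurd this (hq k).ne
  have : (1 : ℝ) ≤ (M k).card := by exact_mod_cast hne.card_pos
  nlinarith

/-- The total completion time is at least the average of the total work of the initial segments. -/
theorem LPFeasible.sum_prefix_le {s : ℝ} (hs : 0 ≤ s) {q : Fin n → ℝ} (hq : ∀ k, 0 < q k)
    (hmono : Monotone q) {M : Fin n → Finset (Fin m)} {x : Fin n → Fin m → ℝ} {C : Fin n → ℝ}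
    (hx : LPFeasible s q 0 (fun _ => 0) M x C) :
    ∑ h, ∑ k with k ≤ h, (s + q k) ≤ m * ∑ h, C h := by
  classical
  obtain ⟨τ, hτ⟩ := exists_perm_prefix_le (g := fun k => s + q k)
    (fun a b h => add_le_add_right (hmono h) s) (fun k => by linarith [hq k]) C
  rw [← Equiv.sum_comp τ C, Finset.mul_sum]
  refine Finset.sum_le_sum fun h _ => (hτ h).trans ((hx.sum_work_le hs hq _).trans ?_)
  refine (Finset.sum_le_sum fun i _ => hx.sum_completed_le hs (hx.C_nonneg _ (Nat.zero_le _)) i).trans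
    (le_of_eq ?_)
  simp

/-- If the machines are open for at least as long as they process the first `K` jobs, list
scheduling starts these jobs, in total, no later than they are completed. -/
theorem LPFeasible.sum_listLoad_le {s : ℝ} (hs : 0 ≤ s) {q : Fin n → ℝ} (hq : ∀ k, 0 < q k)
    (hmono : Monotone q) {M : Fin n → Finset (Fin m)} {x : Fin n → Fin m → ℝ} {C : Fin n → ℝ}
    (hx : LPFeasible s q 0 (fun _ => 0) M x C) {K : ℕ} (hK : K ≤ n) {t : Fin m → ℝ}
    (ht : ∀ i, ∑ k with k.val < K ∧ i ∈ M k, (s + x k i) ≤ t i) {f : Fin n → Fin m}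
    (hf : IsListSchedule s q K t f) :
    ∑ h : Fin n with h.val < K, listLoad s q f h (f h) ≤ ∑ h : Fin n with h.val < K, C h := by
  classical
  have hre : ∀ D : Fin n → ℝ, ∑ h with h.val < K, D h = ∑ h : Fin K, D (Fin.castLE hK h) := by
    intro D
    refine (Finset.sum_nbij (Fin.castLE hK) ?_ ?_ ?_ fun _ _ => rfl).symm
    · intro h _; simp
    · intro h _ h' _ e; exact Fin.castLE_injective hK e
    · intro h hh
      exact ⟨⟨h.val, (Finset.mem_filter.mp hh).2⟩, by simp, by ext; simp⟩
  have hre2 : ∀ (p : Fin n → Prop) [DecidablePred p] (D : Fin n → ℝ),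
      ∑ h with h.val < K ∧ p h, D h = ∑ h : Fin K with p (Fin.castLE hK h), D (Fin.castLE hK h) := by
    intro p _ D
    rw [← Finset.filter_filter, Finset.sum_filter, hre, Finset.sum_filter]
  obtain ⟨τ, hτ⟩ := exists_perm_prefix_le (g := fun k : Fin K => s + q (Fin.castLE hK k))
    (fun a b h => add_le_add_right (hmono ((Fin.strictMono_castLE hK).monotone h)) s)
    (fun k => by linarith [hq (Fin.castLE hK k)]) fun k => C (Fin.castLE hK k)
  rw [hre, hre, ← Equiv.sum_comp τ fun h => C (Fin.castLE hK h)]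
  refine Finset.sum_le_sum fun h _ => ?_
  -- Suppose that the job in position `h` starts at `L`, later than the `(h + 1)`-st smallest
  -- completion time `c` of the first `K` jobs. The jobs among these that are completed by `c` then
  -- fit into the loads before `h`, although their work is at least that of the first `h + 1` jobs.
  by_contra hcon
  push Not at hcon
  set c := C (Fin.castLE hK (τ h)) with hc
  set L := listLoad s q f (Fin.castLE hK h) (f (Fin.castLE hK h)) with hL
  have hc0 : 0 ≤ c := hx.C_nonneg _ (Nat.zero_le _)
  have h1 := hτ h
  rw [← hre2 (fun k => C k ≤ c) fun k => s + q k] at h1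
  have h2 := h1.trans (hx.sum_work_le hs hq fun k => k.val < K ∧ C k ≤ c)
  have hnn : ∀ (k : Fin n) (i : Fin m), i ∈ M k → 0 ≤ s + x k i := fun k i hi => by
    linarith [hx.x_nonneg k (Nat.zero_le _) i hi]
  -- An open machine has load at least `L`, more than `c`. A closed one has load at least `t i`,
  -- which covers all it processes of the first `K` jobs.
  have h3 : ∀ i, ∑ k with (k.val < K ∧ C k ≤ c) ∧ i ∈ M k, (s + x k i) ≤
      listLoad s q f (Fin.castLE hK h) i := by
    intro i
    obtain ⟨-, hmin⟩ := hf (Fin.castLE hK h) h.2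
    by_cases hop : listLoad s q f (Fin.castLE hK h) i < t i
    · have hLi : L ≤ listLoad s q f (Fin.castLE hK h) i := by
        rcases hmin i hop with h' | h'
        · exact h'.le
        · exact h'.1.le
      refine le_trans ?_ ((hx.sum_completed_le hs hc0 i).trans (hcon.le.trans hLi))
      refine Finset.sum_le_sum_of_subset_of_nonneg (fun k hk => ?_) fun k hk _ => ?_
      · simp only [Finset.mem_filter, Finset.mem_univ, true_and] at hk ⊢
        exact ⟨hk.1.2, hk.2⟩
      · exact hnn k i (Finset.mem_filter.mp hk).2.2
    · push Not at hop
      refine le_trans ?_ ((ht i).trans hop)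
      refine Finset.sum_le_sum_of_subset_of_nonneg (fun k hk => ?_) fun k hk _ => ?_
      · simp only [Finset.mem_filter, Finset.mem_univ, true_and] at hk ⊢
        exact ⟨hk.1.1, hk.2⟩
      · exact hnn k i (Finset.mem_filter.mp hk).2.2
  have h4 := h2.trans (Finset.sum_le_sum fun i _ => h3 i)
  rw [sum_listLoad] at h4
  have h5 : ∑ k : Fin n with k.val < (Fin.castLE hK h).val, (s + q k) <
      ∑ k : Fin K with k ≤ h, (s + q (Fin.castLE hK k)) := by
    have e := hre2 (fun k => k.val ≤ h.val) fun k => s + q k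
    simp only [Fin.val_castLE, Fin.val_fin_le] at e
    rw [← e]
    refine Finset.sum_lt_sum_of_subset (i := Fin.castLE hK h) ?_ ?_ ?_ ?_ ?_
    · intro k hk
      simp only [Finset.mem_filter, Finset.mem_univ, true_and, Fin.val_castLE] at hk ⊢
      omega
    · simp
    · simp
    · linarith [hq (Fin.castLE hK h)]
    · intro k _ _; linarith [hq k]
  linarith

end LowerBounds

end SplitSched

namespace SplitSched

/-! ### The linear program for the last jobs -/

section Tail

variable {m n K : ℕ}

/-- The position of job `l` among the jobs from position `K` on. -/
def tailPos (l : Fin (n - K)) : Fin n := ⟨K + l.val, by omega⟩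

/-- A function on the last jobs, extended by a default value. -/
def extendTail {β : Type*} (d : β) (y : Fin (n - K) → β) : Fin n → β :=
  fun h => if hh : K ≤ h.val then y ⟨h.val - K, by omega⟩ else d

theorem extendTail_tailPos {β : Type*} (d : β) (y : Fin (n - K) → β) (l : Fin (n - K)) :
    extendTail d y (tailPos l) = y l := by
  simp [extendTail, tailPos]

theorem exists_tailPos {h : Fin n} (hh : K ≤ h.val) : ∃ l : Fin (n - K), tailPos l = h :=
  ⟨⟨h.val - K, by omega⟩, Fin.ext (by simp only [tailPos]; omega)⟩

theorem tailPos_le {l l' : Fin (n - K)} : tailPos l ≤ tailPos l' ↔ l ≤ l' := by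
  rw [Fin.le_def, Fin.le_def]
  simp only [tailPos]
  omega

theorem sum_tail (p : Fin n → Prop) [DecidablePred p] (F : Fin n → ℝ) :
    ∑ k with K ≤ k.val ∧ p k, F k = ∑ l : Fin (n - K) with p (tailPos l), F (tailPos l) := by
  refine (Finset.sum_nbij tailPos ?_ ?_ ?_ fun _ _ => rfl).symm
  · intro l hl
    have := (Finset.mem_filter.mp hl).2
    exact Finset.mem_filter.mpr ⟨Finset.mem_univ _, Nat.le_add_right _ _, this⟩
  · intro l _ l' _ e
    have := congrArg Fin.val e
    simp only [tailPos] at this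
    exact Fin.ext (by omega)
  · intro k hk
    simp only [Finset.coe_filter, Finset.mem_univ, true_and, Set.mem_ofPred_eq] at hk
    obtain ⟨l, rfl⟩ := exists_tailPos hk.1
    exact ⟨l, by simpa using hk.2, rfl⟩

theorem lpValue_tail (C : Fin n → ℝ) :
    lpValue K C = lpValue 0 fun l : Fin (n - K) => C (tailPos l) := by
  have := sum_tail (K := K) (fun _ => True) C
  simpa [lpValue] using this

/-- The constraints only involve positions from `K` on, so they are those of a program with `n - K`
jobs numbered from 0. In this form the number of jobs is at most `⌈m / ε⌉` for the scheme, and the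
finite lists of candidates apply. -/
theorem lpFeasible_tail {s : ℝ} {q : Fin n → ℝ} {T : Fin m → ℝ} {M : Fin n → Finset (Fin m)}
    {x : Fin n → Fin m → ℝ} {C : Fin n → ℝ} : LPFeasible s q K T M x C ↔
    LPFeasible s (fun l : Fin (n - K) => q (tailPos l)) 0 T (fun l => M (tailPos l))
      (fun l => x (tailPos l)) (fun l => C (tailPos l)) := by
  have hK : ∀ l : Fin (n - K), K ≤ (tailPos l).val := fun l => Nat.le_add_right _ _
  have hsum : ∀ (l : Fin (n - K)) (i : Fin m),
      ∑ k with K ≤ k.val ∧ k ≤ tailPos l ∧ i ∈ M k, (s + x k i) =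
      ∑ k : Fin (n - K) with 0 ≤ k.val ∧ k ≤ l ∧ i ∈ M (tailPos k), (s + x (tailPos k) i) := by
    intro l i
    rw [sum_tail (fun k => k ≤ tailPos l ∧ i ∈ M k)]
    simp [tailPos_le]
  constructor
  · intro h
    exact ⟨fun l _ => h.total _ (hK l), fun l _ i hi => hsum l i ▸ h.finish _ (hK l) i hi,
      fun l _ => h.x_nonneg _ (hK l), fun l _ => h.C_nonneg _ (hK l)⟩
  · intro h
    refine ⟨fun k hk => ?_, fun k hk i hi => ?_, fun k hk => ?_, fun k hk => ?_⟩ <;>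
      obtain ⟨l, rfl⟩ := exists_tailPos hk
    · exact h.total l (Nat.zero_le _)
    · rw [hsum]; exact h.finish l (Nat.zero_le _) i hi
    · exact h.x_nonneg l (Nat.zero_le _)
    · exact h.C_nonneg l (Nat.zero_le _)

theorem lpOptimal_tail {s : ℝ} {q : Fin n → ℝ} {T : Fin m → ℝ} {M : Fin n → Finset (Fin m)}
    {x : Fin n → Fin m → ℝ} {C : Fin n → ℝ} : LPOptimal s q K T M x C ↔
    LPOptimal s (fun l : Fin (n - K) => q (tailPos l)) 0 T (fun l => M (tailPos l))
      (fun l => x (tailPos l)) (fun l => C (tailPos l)) := by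
  unfold LPOptimal
  rw [lpFeasible_tail, lpValue_tail C]
  refine and_congr_right fun _ => ⟨fun h x' C' h' => ?_, fun h x' C' h' => ?_⟩
  · have := h (extendTail (fun _ => 0) x') (extendTail 0 C') (lpFeasible_tail.mpr (by
      simpa only [extendTail_tailPos] using h'))
    rw [lpValue_tail (extendTail 0 C')] at this
    simpa only [extendTail_tailPos] using this
  · rw [lpValue_tail C']
    exact h _ _ (lpFeasible_tail.mp h')

/-- A feasible linear program has an optimal solution. -/
theorem LPFeasible.exists_optimal {s : ℝ} {q : Fin n → ℝ} {T : Fin m → ℝ}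
    {M : Fin n → Finset (Fin m)} {x : Fin n → Fin m → ℝ} {C : Fin n → ℝ}
    (h : LPFeasible s q K T M x C) : ∃ x' C', LPOptimal s q K T M x' C' := by
  obtain ⟨Z, -, hZ⟩ := Candidate.exists_list m (n - K)
  obtain ⟨κ, -, -, hκ⟩ := hZ (fun l => M (tailPos l)) s (fun l => q (tailPos l)) T
    ⟨_, _, lpFeasible_tail.mp h⟩
  refine ⟨extendTail (fun _ => 0) fun h i => lin (κ.x h i) (lpParam s (fun l => q (tailPos l)) T),
    extendTail 0 fun h => lin (κ.C h) (lpParam s (fun l => q (tailPos l)) T),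
    lpOptimal_tail.mpr ?_⟩
  simpa only [extendTail_tailPos] using hκ

end Tail

/-! ### The approximation guarantee -/

section Ratio

variable {m n : ℕ}

theorem gridStep_zero (s : ℝ) (q : Fin n → ℝ) : gridStep s q 0 = 0 := by simp [gridStep]

theorem le_gridStep {s : ℝ} {q : Fin n → ℝ} (hmono : Monotone q) {K : ℕ} (hK : K ≤ n) {k : Fin n}
    (hk : k.val < K) : s + q k ≤ gridStep s q K := by
  rw [gridStep, dif_pos ⟨by omega, hK⟩]
  exact add_le_add_right (hmono (by rw [Fin.le_def]; simp only; omega)) s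

theorem gridStep_le {s : ℝ} (hs : 0 ≤ s) {q : Fin n → ℝ} (hq : ∀ k, 0 < q k) (hmono : Monotone q)
    {K : ℕ} {k : Fin n} (hk : K ≤ k.val) : gridStep s q K ≤ s + q k := by
  unfold gridStep
  split_ifs
  · exact add_le_add_right (hmono (by rw [Fin.le_def]; simp only; omega)) s
  · linarith [hq k]

theorem gridStep_nonneg {s : ℝ} (hs : 0 ≤ s) {q : Fin n → ℝ} (hq : ∀ k, 0 < q k) (K : ℕ) :
    0 ≤ gridStep s q K := by
  unfold gridStep
  split_ifs
  · linarith [hq ⟨K - 1, by omega⟩]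
  · rfl

theorem sum_range_add_one (r : ℕ) : ∑ l ∈ Finset.range r, ((l : ℝ) + 1) = r * (r + 1) / 2 := by
  induction r with
  | zero => simp
  | succ r ih => rw [Finset.sum_range_succ, ih]; push_cast; ring

/-- The work of the initial segments in terms of the last `n - K` jobs. -/
theorem le_sum_prefix {s : ℝ} (hs : 0 ≤ s) {q : Fin n → ℝ} (hq : ∀ k, 0 < q k)
    (hmono : Monotone q) (K : ℕ) :
    (n - K : ℕ) * ∑ k : Fin n with k.val < K, (s + q k) ≤ ∑ h : Fin n, ∑ k with k ≤ h, (s + q k) ∧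
    gridStep s q K * ((n - K : ℕ) * ((n - K : ℕ) + 1) / 2) ≤
      ∑ h : Fin n, ∑ k with k ≤ h, (s + q k) := by
  have hnn : ∀ k, 0 ≤ s + q k := fun k => by linarith [hq k]
  have h0 : ∑ l : Fin (n - K), ∑ k with k ≤ tailPos l, (s + q k) ≤
      ∑ h : Fin n, ∑ k with k ≤ h, (s + q k) := by
    have := sum_tail (K := K) (fun _ => True) fun h : Fin n => ∑ k with k ≤ h, (s + q k)
    simp only [and_true, Finset.filter_true] at this
    rw [← this]
    exact Finset.sum_le_sum_of_subset_of_nonneg (Finset.filter_subset _ _) fun h _ _ =>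
      Finset.sum_nonneg fun k _ => hnn k
  constructor
  -- Each of the last `n - K` initial segments contains the first `K` jobs.
  · refine le_trans ?_ h0
    have : ((n - K : ℕ) : ℝ) * ∑ k : Fin n with k.val < K, (s + q k) =
        ∑ _l : Fin (n - K), ∑ k : Fin n with k.val < K, (s + q k) := by simp
    rw [this]
    refine Finset.sum_le_sum fun l _ => Finset.sum_le_sum_of_subset_of_nonneg (fun k hk => ?_)
      fun k _ _ => hnn k
    simp only [Finset.mem_filter, Finset.mem_univ, true_and, Fin.le_def, tailPos] at hk ⊢
    omega
  -- The segment that ends with the `l`-th of the last jobs, counted from 0, contains `l + 1` of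
  -- them, each of work at least the grid step.
  · refine le_trans ?_ h0
    rw [← sum_range_add_one, ← Fin.sum_univ_eq_sum_range fun l => (l : ℝ) + 1, Finset.mul_sum]
    refine Finset.sum_le_sum fun l _ => ?_
    have h1 : ∑ k : Fin n with K ≤ k.val ∧ k ≤ tailPos l, (s + q k) ≤
        ∑ k with k ≤ tailPos l, (s + q k) :=
      Finset.sum_le_sum_of_subset_of_nonneg (fun k hk => by
        simp only [Finset.mem_filter, Finset.mem_univ, true_and] at hk ⊢; exact hk.2)
        fun k _ _ => hnn k
    refine le_trans ?_ h1
    rw [sum_tail]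
    simp only [tailPos_le]
    refine le_trans (le_of_eq ?_) (Finset.card_nsmul_le_sum _ _ (gridStep s q K) fun k _ =>
      gridStep_le hs hq hmono (Nat.le_add_right _ _))
    have hc : (Finset.univ.filter fun k : Fin (n - K) => k ≤ l).card = l.val + 1 := by
      rw [← Fin.card_Iic]
      congr 1
      ext k
      simp
    rw [hc, nsmul_eq_mul]
    push_cast
    ring

/-- For every sequence of the jobs in SPT order there is a round that is almost as good. -/
theorem LPFeasible.exists_round {s : ℝ} (hs : 0 ≤ s) {q : Fin n → ℝ} (hq : ∀ k, 0 < q k)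
    (hmono : Monotone q) (hm : 1 ≤ m) {ε : ℝ} (hε : 0 < ε) {M : Fin n → Finset (Fin m)}
    {x : Fin n → Fin m → ℝ} {C : Fin n → ℝ} (hx : LPFeasible s q 0 (fun _ => 0) M x C) :
    ∃ r : Round m n, r.Valid s q (numFirst m ε n) ∧
      r.value s q (numFirst m ε n) ≤ (1 + 5 * ε) * ∑ h, C h := by
  set K := numFirst m ε n with hKdef
  have hK : K ≤ n := Nat.sub_le _ _
  set δ := gridStep s q K with hδ
  have hδ0 : 0 ≤ δ := gridStep_nonneg hs hq K
  have hsq : ∀ k, 0 < s + q k := fun k => by linarith [hq k]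
  -- The time that machine `i` spends on the first `K` jobs. It is at most `K * δ`, so its rounding
  -- is an admissible guess.
  let ld : Fin m → ℝ := fun i => ∑ k with k.val < K ∧ i ∈ M k, (s + x k i)
  have hxq : ∀ k i, i ∈ M k → x k i ≤ q k := fun k i hi => by
    rw [← hx.total k (Nat.zero_le _)]
    exact Finset.single_le_sum (f := fun i => x k i) (hx.x_nonneg k (Nat.zero_le _)) hi
  have hld0 : ∀ i, 0 ≤ ld i := fun i => Finset.sum_nonneg fun k hk => by
    linarith [hx.x_nonneg k (Nat.zero_le _) i (Finset.mem_filter.mp hk).2.2]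
  have hldK : ∀ i, ld i ≤ K * δ := by
    intro i
    have h1 : ld i ≤ (Finset.univ.filter fun k : Fin n => k.val < K ∧ i ∈ M k).card • δ :=
      Finset.sum_le_card_nsmul _ _ _ fun k hk => by
        have hk := (Finset.mem_filter.mp hk).2
        linarith [hxq k i hk.2, le_gridStep (s := s) hmono hK hk.1]
    refine h1.trans ?_
    rw [nsmul_eq_mul]
    refine mul_le_mul_of_nonneg_right ?_ hδ0
    have h2 : (Finset.univ.filter fun k : Fin n => k.val < K ∧ i ∈ M k).card ≤
        (Finset.range K).card := by
      refine Finset.card_le_card_of_injOn Fin.val (fun k hk => ?_) fun k _ k' _ e => Fin.ext e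
      simp only [Finset.coe_filter, Finset.mem_univ, true_and, Set.mem_ofPred_eq] at hk
      simpa using hk.1
    rw [Finset.card_range] at h2
    exact_mod_cast h2
  -- If `δ = 0`, then `ld i = 0` as well by `hldK`, and division by zero gives the correct guess 0.
  let a : Fin m → ℕ := fun i => ⌈ld i / δ⌉₊
  have haK : ∀ i, a i ≤ K := fun i => Nat.ceil_le.mpr (by
    rcases hδ0.eq_or_lt with h | h
    · rw [← h]; simp
    · rw [div_le_iff₀ h]; exact hldK i)
  have hla : ∀ i, ld i ≤ a i * δ := by
    intro i
    rcases hδ0.eq_or_lt with h | h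
    · have := hldK i
      rw [← h] at this ⊢
      simpa using this
    · rw [← div_le_iff₀ h]; exact Nat.le_ceil _
  have hal : ∀ i, a i * δ ≤ ld i + δ := by
    intro i
    rcases hδ0.eq_or_lt with h | h
    · rw [← h]; simpa using hld0 i
    · have := (Nat.ceil_lt_add_one (div_nonneg (hld0 i) hδ0)).le
      calc (a i : ℝ) * δ ≤ (ld i / δ + 1) * δ := mul_le_mul_of_nonneg_right this hδ0
        _ = ld i + δ := by field_simp
  have hta : ∀ i, 0 ≤ (a i : ℝ) * δ := fun i => by positivity
  obtain ⟨f, hf⟩ := exists_isListSchedule hsq (fun i => (a i : ℝ) * δ) ⟨0, hm⟩ hK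
    ((hx.sum_work_le hs hq _).trans (Finset.sum_le_sum fun i _ => hla i))
  have hT : ∀ i, listLoad s q f K i ≤ ld i + 2 * δ := fun i => by
    have := hf.listLoad_le hK hta hδ0 (fun k hk => le_gridStep hmono hK hk) i
    linarith [hal i]
  -- The machines become available at most `2 * δ` later than in the given sequence: one `δ` from
  -- rounding, one from the job with which a machine is closed. Delaying all remaining jobs by `2 *
  -- δ` suffices.
  have hfeas : LPFeasible s q K (listLoad s q f K) M x fun h => C h + 2 * δ := by
    refine ⟨fun h _ => hx.total h (Nat.zero_le _), fun h hh i hi => ?_,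
      fun h _ => hx.x_nonneg h (Nat.zero_le _), fun h _ => ?_⟩
    · have h1 := hx.finish h (Nat.zero_le _) i hi
      rw [zero_add] at h1
      have h2 : ∑ k with 0 ≤ k.val ∧ k ≤ h ∧ i ∈ M k, (s + x k i) =
          ld i + ∑ k with K ≤ k.val ∧ k ≤ h ∧ i ∈ M k, (s + x k i) := by
        simp only [ld, Finset.sum_filter]
        rw [← Finset.sum_add_distrib]
        refine Finset.sum_congr rfl fun k _ => ?_
        by_cases hi' : i ∈ M k
        · rcases lt_or_ge k.val K with hk | hk
          · have h3 : k ≤ h := by rw [Fin.le_def]; omega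
            simp [hi', hk, hk.not_ge, h3]
          · simp [hi', hk, hk.not_gt]
        · simp [hi']
      linarith [hT i]
    · have := hx.C_nonneg h (Nat.zero_le _); positivity
  obtain ⟨x', C', hopt⟩ := hfeas.exists_optimal
  refine ⟨⟨a, f, M, x', C'⟩, ⟨haK, hf, hopt⟩, ?_⟩
  set c := ∑ h, C h with hc
  set W := ∑ k : Fin n with k.val < K, (s + q k) with hW
  have hv1 : ∑ h : Fin n with h.val < K, listLoad s q f (h.val + 1) (f h) ≤
      ∑ h : Fin n with h.val < K, C h + W := by
    have h1 := hx.sum_listLoad_le hs hq hmono hK hla hf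
    have h2 : ∑ h : Fin n with h.val < K, listLoad s q f (h.val + 1) (f h) =
        ∑ h : Fin n with h.val < K, listLoad s q f h (f h) + W := by
      rw [hW, ← Finset.sum_add_distrib]
      exact Finset.sum_congr rfl fun h _ => by rw [listLoad_succ, if_pos rfl]
    linarith
  have hv2 : lpValue K C' ≤ ∑ h : Fin n with K ≤ h.val, C h + (n - K : ℕ) * (2 * δ) := by
    refine (hopt.2 _ _ hfeas).trans (le_of_eq ?_)
    rw [lpValue, Finset.sum_add_distrib]
    congr 1
    have := sum_tail (n := n) (K := K) (fun _ => True) fun _ => 2 * δ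
    simpa using this
  have hv3 : ∑ h : Fin n with h.val < K, C h + ∑ h : Fin n with K ≤ h.val, C h = c := by
    rw [hc, ← Finset.sum_filter_add_sum_filter_not Finset.univ fun h : Fin n => h.val < K]
    simp only [not_lt]
  have hval : Round.value s q K ⟨a, f, M, x', C'⟩ ≤ c + W + (n - K : ℕ) * (2 * δ) := by
    simp only [Round.value]
    linarith
  have hc0 : 0 ≤ c := Finset.sum_nonneg fun h _ => hx.C_nonneg h (Nat.zero_le _)
  refine hval.trans ?_
  have hm' : (0 : ℝ) < m := by exact_mod_cast hm
  have hS := hx.sum_prefix_le hs hq hmono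
  obtain ⟨hS1, hS2⟩ := le_sum_prefix hs hq hmono K
  rcases Nat.eq_zero_or_pos K with hK0 | hKpos
  · have h1 : δ = 0 := by rw [hδ, hK0, gridStep_zero]
    have h2 : W = 0 := by rw [hW, hK0]; simp
    rw [h1, h2]
    nlinarith
  -- For `K > 0` the truncated subtraction in `numFirst` is exact, so there are `⌈m / ε⌉` remaining
  -- jobs. This turns the factor `m` of the lower bound into `ε` times their number.
  · have hr : (m : ℝ) ≤ ε * (n - K : ℕ) := by
      have : n - K = ⌈(m : ℝ) / ε⌉₊ := by
        rw [hKdef, numFirst] at hKpos ⊢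
        omega
      rw [this, ← div_le_iff₀' hε]
      exact Nat.le_ceil _
    set r : ℝ := ((n - K : ℕ) : ℝ) with hrdef
    have hr0 : 0 ≤ r := Nat.cast_nonneg _
    have hW0 : 0 ≤ W := Finset.sum_nonneg fun k _ => (hsq k).le
    have e1 : W ≤ ε * c := by
      have h1 : m * W ≤ m * (ε * c) := by
        calc m * W ≤ ε * r * W := mul_le_mul_of_nonneg_right hr hW0
          _ = ε * (r * W) := by ring
          _ ≤ ε * (m * c) := mul_le_mul_of_nonneg_left (hS1.trans hS) hε.le
          _ = m * (ε * c) := by ring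
      exact le_of_mul_le_mul_left h1 hm'
    -- The delay `2rδ` is charged to the segments of the last jobs, whose work is quadratic in `r`;
    -- the factor 4 is 2 for the delay times 2 from `r(r+1)/2`.
    have e2 : r * (2 * δ) ≤ 4 * (ε * c) := by
      have h1 : m * (r * (2 * δ)) ≤ m * (4 * (ε * c)) := by
        calc m * (r * (2 * δ)) ≤ ε * r * (r * (2 * δ)) :=
              mul_le_mul_of_nonneg_right hr (by positivity)
          _ ≤ ε * r * ((r + 1) * (2 * δ)) := by
              refine mul_le_mul_of_nonneg_left ?_ (by positivity)
              exact mul_le_mul_of_nonneg_right (by linarith) (by positivity)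
          _ = 4 * ε * (δ * (r * (r + 1) / 2)) := by ring
          _ ≤ 4 * ε * (m * c) := mul_le_mul_of_nonneg_left (hS2.trans hS) (by positivity)
          _ = m * (4 * (ε * c)) := by ring
      exact le_of_mul_le_mul_left h1 hm'
    linarith

end Ratio

end SplitSched

namespace SplitSched

/-! ### The schedule of a round -/

section RoundSchedule

variable {m n : ℕ}

theorem mem_scheduleOf {len start : Fin n → Fin m → ℝ} {a : Part m n} :
    a ∈ scheduleOf len start ↔ ∃ j i, 0 < len j i ∧ a = ⟨i, j, start j i, len j i⟩ := by
  simp only [scheduleOf, List.mem_flatMap, List.mem_map, List.mem_filter, List.mem_finRange,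
    true_and, decide_eq_true_eq]
  exact exists_congr fun j => exists_congr fun i => and_congr_right fun _ => eq_comm

theorem sum_map_filter_eq {α : Type*} (l : List α) (p : α → Prop) [DecidablePred p] (f : α → ℝ) :
    ((l.filter p).map f).sum = (l.map fun a => if p a then f a else 0).sum := by
  induction l with
  | nil => simp
  | cons a l ih => by_cases h : p a <;> simp [h, ih]

theorem sum_map_scheduleOf (len start : Fin n → Fin m → ℝ) (f : Part m n → ℝ) :
    ((scheduleOf len start).map f).sum =
      ∑ j, ∑ i, if 0 < len j i then f ⟨i, j, start j i, len j i⟩ else 0 := by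
  have h1 : ∀ l : List (Fin n), ((l.flatMap fun j =>
      ((List.finRange m).filter fun i => 0 < len j i).map fun i =>
        (⟨i, j, start j i, len j i⟩ : Part m n)).map f).sum =
      (l.map fun j => ∑ i, if 0 < len j i then f ⟨i, j, start j i, len j i⟩ else 0).sum := by
    intro l
    induction l with
    | nil => simp
    | cons j l ih =>
      rw [List.flatMap_cons, List.map_append, List.sum_append, ih, List.map_cons, List.sum_cons,
        List.map_map, sum_map_filter_eq, Fin.sum_univ_def]
      rfl
  rw [scheduleOf, h1, Fin.sum_univ_def]

variable {s : ℝ} {q : Fin n → ℝ} {K : ℕ} {r : Round m n}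

namespace Round

theorem Valid.amount_nonneg (hr : r.Valid s q K) (hq : ∀ k, 0 < q k) (h : Fin n) (i : Fin m) :
    0 ≤ r.amount q K h i := by
  unfold amount
  split_ifs with h1 h2 h3
  · exact (hq h).le
  · rfl
  · exact hr.lp.1.x_nonneg h (not_lt.mp h1) i h3
  · rfl

theorem Valid.sum_amount (hr : r.Valid s q K) (h : Fin n) : ∑ i, r.amount q K h i = q h := by
  unfold amount
  split_ifs with h1
  · simp
  · rw [← hr.lp.1.total h (not_lt.mp h1)]
    simp

/-- The bound on the completion time of the job in position `h`. -/
noncomputable def bound (s : ℝ) (q : Fin n → ℝ) (K : ℕ) (r : Round m n) (h : Fin n) : ℝ :=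
  if h.val < K then listLoad s q r.f (h.val + 1) (r.f h) else r.C h

theorem sum_bound : ∑ h, r.bound s q K h = r.value s q K := by
  rw [value, lpValue, ← Finset.sum_filter_add_sum_filter_not Finset.univ fun h : Fin n => h.val < K]
  simp only [not_lt]
  congr 1
  · exact Finset.sum_congr rfl fun h hh => if_pos (Finset.mem_filter.mp hh).2
  · exact Finset.sum_congr rfl fun h hh => if_neg (not_lt.mpr (Finset.mem_filter.mp hh).2)

theorem Valid.bound_nonneg (hr : r.Valid s q K) (hs : 0 ≤ s) (hq : ∀ k, 0 < q k) (h : Fin n) :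
    0 ≤ r.bound s q K h := by
  unfold bound
  split_ifs with h1
  · exact listLoad_nonneg (fun k => by linarith [hq k]) _ _ _
  · exact hr.lp.1.C_nonneg h (not_lt.mp h1)

theorem startTime_add (h : Fin n) (i : Fin m) (ha : 0 < r.amount q K h i) :
    r.startTime s q K h i + (s + r.amount q K h i) =
      ∑ k, if k ≤ h then (if 0 < r.amount q K k i then s + r.amount q K k i else 0) else 0 := by
  rw [sum_prefix_eq_self, if_pos ha, startTime, Finset.sum_filter]
  congr 1
  refine Finset.sum_congr rfl fun k _ => ?_
  by_cases h1 : k < h <;> simp [h1]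

theorem Valid.finish_le_startTime (hr : r.Valid s q K) (hs : 0 ≤ s) (hq : ∀ k, 0 < q k)
    {h h' : Fin n} (hh : h < h') (i : Fin m) (ha : 0 < r.amount q K h i) :
    r.startTime s q K h i + s + r.amount q K h i ≤ r.startTime s q K h' i := by
  rw [add_assoc, startTime_add h i ha, startTime, Finset.sum_filter]
  refine Finset.sum_le_sum fun k _ => ?_
  have := hr.amount_nonneg hq k i
  by_cases h1 : k ≤ h
  · simp [h1, h1.trans_lt hh]
  · rw [if_neg h1]
    split_ifs
    · positivity
    · rfl

/-- The list schedule and the linear program account for every part that the machine processes up to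
position `h`. The actual schedule additionally omits parts of length zero with their setups, so it
is never later. -/
theorem Valid.finish_le_bound (hr : r.Valid s q K) (hs : 0 ≤ s) (hq : ∀ k, 0 < q k)
    (h : Fin n) (i : Fin m) (ha : 0 < r.amount q K h i) :
    r.startTime s q K h i + s + r.amount q K h i ≤ r.bound s q K h := by
  rw [add_assoc, startTime_add h i ha, bound]
  have hsq : ∀ k, 0 ≤ s + q k := fun k => by linarith [hq k]
  split_ifs with h1
  · have hfi : r.f h = i := by
      by_contra hne
      simp [amount, h1, hne] at ha
    rw [listLoad, Finset.sum_filter]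
    refine Finset.sum_le_sum fun k _ => ?_
    by_cases hk : k ≤ h
    · have hk' : k.val < h.val + 1 := Nat.lt_succ_iff.mpr hk
      have hkK : k.val < K := by omega
      by_cases hf : r.f k = i
      · simp [hk, hk', hf, hfi, amount, hkK, hq k]
      · simp [hk, hf, hfi, amount, hkK]
    · have hk' : ¬ k.val < h.val + 1 := fun h' => hk (Nat.lt_succ_iff.mp h')
      simp [hk, hk']
  · have hhK := not_lt.mp h1
    have hi : i ∈ r.M h := by
      by_contra hne
      simp [amount, h1, hne] at ha
    refine le_trans ?_ (hr.lp.1.finish h hhK i hi)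
    rw [listLoad, Finset.sum_filter, Finset.sum_filter, ← Finset.sum_add_distrib]
    refine Finset.sum_le_sum fun k _ => ?_
    have hsqk := hsq k
    by_cases hkK : k.val < K
    · have hk : k ≤ h := by rw [Fin.le_def]; omega
      by_cases hf : r.f k = i
      · simp [hk, hf, amount, hkK, hq k, hkK.not_ge]
      · simp [hk, hf, amount, hkK, hkK.not_ge]
    · have hkK' := not_lt.mp hkK
      by_cases hk : k ≤ h
      · by_cases hM : i ∈ r.M k
        · have := hr.lp.1.x_nonneg k hkK' i hM
          simp only [hk, hM, amount, hkK, hkK', if_true, if_false, false_and, and_self, zero_add]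
          split_ifs
          · rfl
          · positivity
        · simp [hk, hM, amount, hkK, hkK']
      · simp [hk, hkK]

end Round

/-- The schedule of a valid round is feasible and not worse than the value of the round. -/
theorem Round.Valid.isFeasible {I : Instance} {r : Round m I.n} {π : Equiv.Perm (Fin I.n)} {K : ℕ}
    (hr : r.Valid I.s (fun h => (I.p (π h) : ℝ)) K) :
    let σ := scheduleOf (fun j i => r.amount (fun h => (I.p (π h) : ℝ)) K (π.symm j) i)
      (fun j i => r.startTime I.s (fun h => (I.p (π h) : ℝ)) K (π.symm j) i)
    IsFeasible I σ ∧ totalCompletionTime I σ ≤ r.value I.s (fun h => (I.p (π h) : ℝ)) K := by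
  intro σ
  set q : Fin I.n → ℝ := fun h => (I.p (π h) : ℝ) with hqdef
  have hq : ∀ k, 0 < q k := fun k => by simpa [q] using I.p_pos (π k)
  have hs : (0 : ℝ) ≤ I.s := by exact_mod_cast I.s_nonneg
  refine ⟨⟨fun a ha => ?_, fun a ha => ?_, ?_, fun j => ?_⟩, ?_⟩
  · obtain ⟨j, i, -, rfl⟩ := mem_scheduleOf.mp ha
    simp only [Round.startTime]
    exact Finset.sum_nonneg fun k hk => add_nonneg hs (Finset.mem_filter.mp hk).2.2.le
  · obtain ⟨j, i, hlen, rfl⟩ := mem_scheduleOf.mp ha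
    exact hlen
  · simp only [σ, scheduleOf]
    rw [List.pairwise_flatMap]
    refine ⟨fun j _ => ?_, ?_⟩
    · rw [List.pairwise_map]
      exact ((List.nodup_finRange m).filter _).imp fun hne h => absurd h hne
    · refine (List.nodup_finRange I.n).imp fun {j j'} hne a ha b hb hab => ?_
      simp only [List.mem_map, List.mem_filter, List.mem_finRange, true_and,
        decide_eq_true_eq] at ha hb
      obtain ⟨i, hi, rfl⟩ := ha
      obtain ⟨i', hi', rfl⟩ := hb
      obtain rfl : i = i' := hab
      have hne' : π.symm j ≠ π.symm j' := fun h => hne (π.symm.injective h)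
      rcases lt_or_gt_of_ne hne' with h | h
      · exact .inl (hr.finish_le_startTime hs hq h i hi)
      · exact .inr (hr.finish_le_startTime hs hq h i hi')
  · rw [sum_map_filter_eq, sum_map_scheduleOf]
    have : ∀ j', (∑ i, if 0 < r.amount q K (π.symm j') i then
        (if j' = j then r.amount q K (π.symm j') i else 0) else 0) =
        if j' = j then (I.p j : ℝ) else 0 := by
      intro j'
      split_ifs with h
      · subst h
        have h1 := hr.sum_amount (π.symm j')
        simp only [hqdef, Equiv.apply_symm_apply] at h1
        rw [← h1]
        refine Finset.sum_congr rfl fun i _ => ?_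
        split_ifs with h2
        · rfl
        · exact le_antisymm (hr.amount_nonneg hq _ _) (not_lt.mp h2)
      · simp
    refine (Finset.sum_congr rfl fun j' _ => this j').trans ?_
    simp
  · rw [totalCompletionTime, ← Round.sum_bound, ← Equiv.sum_comp π.symm (r.bound _ _ K)]
    refine Finset.sum_le_sum fun j _ => foldr_max_le _ _ (hr.bound_nonneg hs hq _) fun y hy => ?_
    obtain ⟨a, ha, rfl⟩ := List.mem_map.mp hy
    obtain ⟨ha, haj⟩ := List.mem_filter.mp ha
    obtain ⟨j', i, hlen, rfl⟩ := mem_scheduleOf.mp ha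
    simp only [decide_eq_true_eq] at haj
    subst haj
    exact hr.finish_le_bound hs hq _ i hlen

/-- Every schedule that the scheme produces is feasible and almost optimal. -/
theorem IsSchemeOutput.guarantee (hm : 1 ≤ m) {ε : ℝ} (hε : 0 < ε) {I : Instance}
    {σ : Schedule m I.n} (h : IsSchemeOutput ε I σ) :
    IsFeasible I σ ∧ totalCompletionTime I σ ≤ (1 + 5 * ε) * OPT m I := by
  obtain ⟨π, q, K, r, rfl, hmono, rfl, hbest, rfl⟩ := h
  obtain ⟨hfeas, htotal⟩ := hbest.1.isFeasible
  refine ⟨hfeas, ?_⟩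
  have hs : (0 : ℝ) ≤ I.s := by exact_mod_cast I.s_nonneg
  have h5 : 0 < 1 + 5 * ε := by linarith
  rw [← div_le_iff₀' h5]
  -- The bound is proved against every feasible schedule, so the infimum need not be attained.
  refine le_csInf ⟨_, _, hfeas, rfl⟩ ?_
  rintro c ⟨σ, hσ, rfl⟩
  rw [div_le_iff₀' h5]
  obtain ⟨π₀, M, x, C, hx, hC⟩ := hσ.exists_sequence
  obtain ⟨π', M', x', C', hmono', hx', hC'⟩ :=
    LPFeasible.exists_spt (p := fun j => (I.p j : ℝ)) (π₀ := π₀) hs hx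
  -- The two SPT orders may break ties differently, but the sorted sequences of processing times
  -- agree.
  have hqq : (fun j => (I.p j : ℝ)) ∘ π' = fun h => (I.p (π h) : ℝ) :=
    Tuple.unique_monotone hmono' hmono
  rw [hqq] at hx'
  obtain ⟨r', hr', hval⟩ := hx'.exists_round hs (fun k => by exact_mod_cast I.p_pos (π k)) hmono hm hε
  rw [hC', hC] at hval
  exact htotal.trans ((hbest.2 r' hr').trans hval)

/-- There is a valid round. -/
theorem exists_valid_round (hm : 1 ≤ m) {ε : ℝ} (hε : 0 < ε) (I : Instance)
    {π : Equiv.Perm (Fin I.n)} (hmono : Monotone fun h => (I.p (π h) : ℝ)) :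
    ∃ r : Round m I.n, r.Valid I.s (fun h => (I.p (π h) : ℝ)) (numFirst m ε I.n) := by
  have hs : (0 : ℝ) ≤ I.s := by exact_mod_cast I.s_nonneg
  have hq : ∀ k, (0 : ℝ) < I.p (π k) := fun k => by exact_mod_cast I.p_pos (π k)
  -- All jobs on the first machine, with the total work as a common bound on the completion times,
  -- give a sequence from which a round can be constructed.
  have hx : LPFeasible (I.s : ℝ) (fun h => (I.p (π h) : ℝ)) 0 (fun _ => 0)
      (fun _ => {(⟨0, hm⟩ : Fin m)}) (fun h _ => (I.p (π h) : ℝ))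
      (fun _ => ∑ k, ((I.s : ℝ) + I.p (π k))) := by
    refine ⟨fun h _ => by simp, fun h _ i hi => ?_, fun h _ i hi => (hq h).le, fun h _ => ?_⟩
    · rw [zero_add]
      exact Finset.sum_le_sum_of_subset_of_nonneg (Finset.filter_subset _ _) fun k _ _ => by
        linarith [hq k]
    · exact Finset.sum_nonneg fun k _ => by linarith [hq k]
  obtain ⟨r, hr, -⟩ := hx.exists_round hs hq hmono hm hε
  exact ⟨r, hr⟩

end RoundSchedule

end SplitSched

namespace SplitSched

/-! ### The size of the numbers that occur -/

namespace Instance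

/-- A common denominator of the numbers of the instance. -/
def den (I : Instance) : ℕ := I.s.den * ∏ j, (I.p j).den

/-- A bound on the numbers of the instance. -/
def total (I : Instance) : ℚ := 1 + I.s + ∑ j, I.p j

theorem den_pos (I : Instance) : 0 < I.den :=
  Nat.mul_pos I.s.den_pos (Finset.prod_pos fun j _ => (I.p j).den_pos)

theorem one_le_total (I : Instance) : 1 ≤ I.total := by
  have h1 := I.s_nonneg
  have h2 : 0 ≤ ∑ j, I.p j := Finset.sum_nonneg fun j _ => (I.p_pos j).le
  unfold total
  linarith

end Instance

/-- The number `x` is a multiple of `1 / (d * I.den)` and at most `w` times the bound `I.total`. -/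
def Adm (I : Instance) (d w : ℕ) (x : ℚ) : Prop :=
  (∃ z : ℤ, x * (d * I.den) = z) ∧ |x| ≤ w * I.total

section Adm

variable {I : Instance} {d w w' : ℕ} {x y : ℚ}

theorem Adm.add (hx : Adm I d w x) (hy : Adm I d w' y) : Adm I d (w + w') (x + y) := by
  obtain ⟨⟨a, ha⟩, hx⟩ := hx
  obtain ⟨⟨b, hb⟩, hy⟩ := hy
  refine ⟨⟨a + b, by push_cast; rw [← ha, ← hb]; ring⟩, (abs_add_le _ _).trans ?_⟩
  push_cast
  linarith

theorem Adm.mono (hx : Adm I d w x) (h : w ≤ w') : Adm I d w' x := by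
  refine ⟨hx.1, hx.2.trans ?_⟩
  have := I.one_le_total
  have h' : (w : ℚ) ≤ w' := by exact_mod_cast h
  exact mul_le_mul_of_nonneg_right h' (by linarith)

theorem Adm.of_one (hx : Adm I 1 w x) : Adm I d w x := by
  obtain ⟨⟨a, ha⟩, hx⟩ := hx
  refine ⟨⟨d * a, ?_⟩, hx⟩
  push_cast at ha ⊢
  rw [← ha]; ring

theorem Adm.zero : Adm I d w 0 := by
  refine ⟨⟨0, by simp⟩, ?_⟩
  have := I.one_le_total
  simp only [abs_zero]
  positivity

/-- The summand 1 in `I.total` is there so that counters are admissible, with their own value as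
weight. -/
theorem Adm.natCast (k : ℕ) : Adm I d k k := by
  refine ⟨⟨k * (d * I.den), by push_cast; ring⟩, ?_⟩
  rw [abs_of_nonneg (Nat.cast_nonneg k)]
  exact le_mul_of_one_le_right (Nat.cast_nonneg k) I.one_le_total

theorem Adm.nat {k : ℕ} (h : k ≤ w) : Adm I d w k := (Adm.natCast k).mono h

/-- Only numbers with denominator factor 1 are multiplied by coefficients of candidates, so the
factor `d` enters once and denominators do not accumulate. -/
theorem Adm.const_mul (hx : Adm I 1 w x) {c : ℚ} {C : ℕ} (hc : ∃ z : ℤ, c * d = z)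
    (hC : |c| ≤ C) : Adm I d (C * w) (c * x) := by
  obtain ⟨⟨a, ha⟩, hx⟩ := hx
  obtain ⟨b, hb⟩ := hc
  refine ⟨⟨a * b, ?_⟩, ?_⟩
  · push_cast at ha ⊢
    rw [← ha, ← hb]; ring
  · rw [abs_mul]
    push_cast
    rw [mul_assoc]
    exact mul_le_mul hC hx (abs_nonneg _) (Nat.cast_nonneg _)

theorem Adm.sum {κ : Type*} (t : Finset κ) {f : κ → ℚ} (h : ∀ k ∈ t, Adm I d w (f k)) :
    Adm I d (t.card * w) (∑ k ∈ t, f k) := by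
  classical
  induction t using Finset.induction_on with
  | empty => simpa using Adm.zero
  | insert a t ha ih =>
    rw [Finset.sum_insert ha, Finset.card_insert_of_notMem ha]
    have := (h a (Finset.mem_insert_self _ _)).add (ih fun k hk => h k (Finset.mem_insert_of_mem hk))
    exact this.mono (by ring_nf; rfl)

theorem mul_den_of_dvd {e : ℕ} (h : x.den ∣ e) : ∃ z : ℤ, x * e = z := by
  obtain ⟨k, rfl⟩ := h
  refine ⟨x.num * k, ?_⟩
  push_cast
  nth_rewrite 1 [← Rat.num_div_den x]
  have : (x.den : ℚ) ≠ 0 := by exact_mod_cast x.den_nz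
  field_simp

theorem adm_s (I : Instance) : Adm I 1 1 I.s := by
  have h : I.s.den ∣ 1 * I.den := by rw [one_mul]; exact Dvd.intro _ rfl
  refine ⟨by simpa using mul_den_of_dvd h, ?_⟩
  have h2 : 0 ≤ ∑ j, I.p j := Finset.sum_nonneg fun j _ => (I.p_pos j).le
  rw [abs_of_nonneg I.s_nonneg, Instance.total]
  push_cast
  linarith

theorem adm_p (I : Instance) (j : Fin I.n) : Adm I 1 1 (I.p j) := by
  have h : (I.p j).den ∣ 1 * I.den := by
    rw [one_mul]
    exact Dvd.dvd.mul_left (Finset.dvd_prod_of_mem (fun j => (I.p j).den) (Finset.mem_univ j)) _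
  refine ⟨by simpa using mul_den_of_dvd h, ?_⟩
  have h2 : I.p j ≤ ∑ j, I.p j :=
    Finset.single_le_sum (f := I.p) (fun j _ => (I.p_pos j).le) (Finset.mem_univ j)
  have := I.s_nonneg
  rw [abs_of_nonneg (I.p_pos j).le, Instance.total]
  push_cast
  linarith

/-- Setup and processing time of one job together are bounded by `I.total`, so they have weight 1
and a load after `h` jobs has weight `h`. -/
theorem adm_s_add_p (I : Instance) (j : Fin I.n) : Adm I 1 1 (I.s + I.p j) := by
  refine ⟨((adm_s I).add (adm_p I j)).1, ?_⟩
  have h2 : I.p j ≤ ∑ j, I.p j :=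
    Finset.single_le_sum (f := I.p) (fun j _ => (I.p_pos j).le) (Finset.mem_univ j)
  have h1 := I.s_nonneg
  have h3 := I.p_pos j
  rw [abs_of_nonneg (by linarith), Instance.total]
  push_cast
  linarith

end Adm

theorem natSize_prod_le {κ : Type*} (t : Finset κ) (f : κ → ℕ) :
    Nat.size (∏ k ∈ t, f k) ≤ 1 + ∑ k ∈ t, Nat.size (f k) := by
  classical
  induction t using Finset.induction_on with
  | empty => simp
  | insert a t ha ih =>
    rw [Finset.prod_insert ha, Finset.sum_insert ha]
    have := natSize_mul_le (f a) (∏ k ∈ t, f k)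
    omega

theorem one_add_sum_le_prod {κ : Type*} (t : Finset κ) (f : κ → ℕ) :
    1 + ∑ k ∈ t, f k ≤ ∏ k ∈ t, (1 + f k) := by
  classical
  induction t using Finset.induction_on with
  | empty => simp
  | insert a t ha ih =>
    rw [Finset.prod_insert ha, Finset.sum_insert ha]
    nlinarith [Nat.zero_le (f a * ∑ k ∈ t, f k)]

namespace Instance

theorem n_le_size (I : Instance) : I.n ≤ I.size := by
  have : ∑ _j : Fin I.n, 1 ≤ ∑ j, bitLength (I.p j) :=
    Finset.sum_le_sum fun j _ => one_le_bitLength _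
  simp only [Finset.sum_const, Finset.card_univ, Fintype.card_fin, smul_eq_mul, mul_one] at this
  unfold size
  omega

theorem size_den_le (I : Instance) : Nat.size I.den ≤ I.size := by
  have h1 := natSize_mul_le I.s.den (∏ j, (I.p j).den)
  have h2 := natSize_prod_le Finset.univ fun j => (I.p j).den
  have h3 : ∑ j, Nat.size (I.p j).den ≤ ∑ j, bitLength (I.p j) :=
    Finset.sum_le_sum fun j _ => by unfold bitLength; omega
  have h4 : 1 + Nat.size I.s.den ≤ bitLength I.s := by unfold bitLength; omega
  unfold size den
  omega

/-- The sum of the numerators is bounded by the product of the numbers `1 + numerator`, whose bit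
length is controlled by the sum of the individual bit lengths. -/
theorem exists_total_mul_den (I : Instance) :
    ∃ k : ℕ, I.total * I.den ≤ k ∧ Nat.size k ≤ 2 * I.size + 2 := by
  have hx : ∀ x : ℚ, 0 ≤ x → x ≤ x.num.natAbs := fun x hx => by
    have h1 : ((x.num.natAbs : ℤ) : ℚ) = x.num := by
      rw [Int.natAbs_of_nonneg (Rat.num_nonneg.mpr hx)]
    have h2 : x * x.den = x.num := Rat.mul_den_eq_num x
    have h3 : (1 : ℚ) ≤ x.den := by exact_mod_cast x.den_pos
    have h4 : x ≤ x * x.den := le_mul_of_one_le_right hx h3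
    rw [h2, ← h1] at h4
    simpa only [Int.cast_natCast] using h4
  let k : ℕ := (1 + I.s.num.natAbs) * ∏ j, (1 + (I.p j).num.natAbs)
  have hk : I.total ≤ k := by
    have h1 := hx _ I.s_nonneg
    have h2 : ∑ j, I.p j ≤ ∑ j, ((I.p j).num.natAbs : ℚ) :=
      Finset.sum_le_sum fun j _ => hx _ (I.p_pos j).le
    have h3 := one_add_sum_le_prod Finset.univ fun j => (I.p j).num.natAbs
    have h4 : 1 + I.s.num.natAbs + ∑ j, (I.p j).num.natAbs ≤ k := by
      have : (1 + I.s.num.natAbs) * (1 + ∑ j, (I.p j).num.natAbs) ≤ k := Nat.mul_le_mul_left _ h3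
      nlinarith [Nat.zero_le (I.s.num.natAbs * ∑ j, (I.p j).num.natAbs)]
    have h5 : (1 : ℚ) + I.s.num.natAbs + ∑ j, ((I.p j).num.natAbs : ℚ) ≤ k := by exact_mod_cast h4
    unfold total
    linarith
  have hsize : Nat.size k ≤ I.size + 2 := by
    have h1 := natSize_mul_le (1 + I.s.num.natAbs) (∏ j, (1 + (I.p j).num.natAbs))
    have h2 := natSize_prod_le Finset.univ fun j => 1 + (I.p j).num.natAbs
    have h3 : ∑ j, Nat.size (1 + (I.p j).num.natAbs) ≤ ∑ j, bitLength (I.p j) :=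
      Finset.sum_le_sum fun j _ => by
        have := natSize_add_le 1 (I.p j).num.natAbs
        have h6 : 1 ≤ Nat.size (I.p j).den := Nat.size_pos.mpr (I.p j).den_pos
        rw [Nat.size_one] at this
        unfold bitLength; omega
    have h4 := natSize_add_le 1 I.s.num.natAbs
    rw [Nat.size_one] at h4
    have h6 : 1 ≤ Nat.size I.s.den := Nat.size_pos.mpr I.s.den_pos
    have h5 : bitLength I.s = 1 + Nat.size I.s.num.natAbs + Nat.size I.s.den := rfl
    change Nat.size ((1 + I.s.num.natAbs) * ∏ j, (1 + (I.p j).num.natAbs)) ≤ _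
    unfold size
    omega
  refine ⟨k * I.den, ?_, ?_⟩
  · push_cast
    exact mul_le_mul_of_nonneg_right hk (Nat.cast_nonneg _)
  · have := natSize_mul_le k I.den
    have := I.size_den_le
    omega

end Instance

theorem natSize_le_self (w : ℕ) : Nat.size w ≤ w := by
  rw [Nat.size_le]; exact Nat.lt_two_pow_self

/-- Clearing the common denominator leaves an integer of absolute value at most `w * (d * k)`, where
`k` bounds `I.total * I.den`. Both numerator and denominator then have size linear in that of the
instance. -/
theorem Adm.bitLength_le {I : Instance} {d w : ℕ} (hd : 0 < d) {x : ℚ} (hx : Adm I d w x) :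
    bitLength x ≤ w + 2 * d + 3 * I.size + 3 := by
  obtain ⟨⟨z, hz⟩, hx⟩ := hx
  obtain ⟨k, hk, hks⟩ := I.exists_total_mul_den
  have h1 := bitLength_le_of_mul_eq (e := d * I.den) (Nat.mul_pos hd I.den_pos)
    (by push_cast; exact hz)
  have h2 : z.natAbs ≤ w * (d * k) := by
    have h3 : ((z.natAbs : ℤ) : ℚ) ≤ w * (d * k) := by
      rw [Int.natCast_natAbs, Int.cast_abs, ← hz, abs_mul, abs_of_nonneg (a := (d * I.den : ℚ))
        (by positivity)]
      calc |x| * (d * I.den) ≤ w * I.total * (d * I.den) :=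
            mul_le_mul_of_nonneg_right hx (by positivity)
        _ = w * (d * (I.total * I.den)) := by ring
        _ ≤ w * (d * k) := by gcongr
    exact_mod_cast h3
  have h4 := Nat.size_le_size h2
  have h5 := natSize_mul_le w (d * k)
  have h6 := natSize_mul_le d k
  have h7 := natSize_mul_le d I.den
  have h8 := I.size_den_le
  have h9 := natSize_le_self w
  have h10 := natSize_le_self d
  omega

end SplitSched

namespace SplitSched

/-! ### The program: sorting and parameters -/

@[simp] theorem State.setReg_reg (σ : State) (v w : ℕ) (x : ℚ) :
    (σ.setReg v x).reg w = if w = v then x else σ.reg w := by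
  simp [State.setReg, Function.update_apply]

@[simp] theorem State.setReg_arr (σ : State) (v : ℕ) (x : ℚ) : (σ.setReg v x).arr = σ.arr := rfl

@[simp] theorem State.setArr_reg (σ : State) (b k : ℕ) (x : ℚ) : (σ.setArr b k x).reg = σ.reg := rfl

@[simp] theorem State.setArr_arr (σ : State) (b k : ℕ) (x : ℚ) (b' k' : ℕ) :
    (σ.setArr b k x).arr b' k' = if b' = b ∧ k' = k then x else σ.arr b' k' := by
  by_cases h : b' = b
  · subst h; simp [State.setArr, Function.update_apply]
  · simp [State.setArr, h]

/-- All numbers that occur have bit length at most `B`, and `N` bounds the lengths of the loops.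
Here `A` is the weight of the numbers that solve linear programs. -/
structure Fits (m : ℕ) (I : Instance) (d A W B N : ℕ) : Prop where
  bitLength_le : ∀ x, Adm I d W x → bitLength x ≤ B
  le_weight : I.n + m + 1 ≤ W
  value_le_weight : I.n * I.n + A ≤ W
  clock_le_weight : I.n * (A + 1) ≤ W
  le_loop : I.n + m + 1 ≤ N

section Fits

variable {m : ℕ} {I : Instance} {d A W B N : ℕ}

theorem Fits.nat (F : Fits m I d A W B N) {k : ℕ} (hk : k ≤ I.n + m + 1) : bitLength (k : ℚ) ≤ B :=
  F.bitLength_le _ (Adm.nat (hk.trans F.le_weight))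

theorem Fits.zero (F : Fits m I d A W B N) : bitLength 0 ≤ B := by
  simpa using F.nat (k := 0) (Nat.zero_le _)

theorem Fits.one (F : Fits m I d A W B N) : bitLength 1 ≤ B := by
  simpa using F.nat (k := 1) (Nat.le_add_left _ _)

theorem Fits.adm (F : Fits m I d A W B N) {w : ℕ} {x : ℚ} (hx : Adm I 1 w x) (hw : w ≤ W) :
    bitLength x ≤ B := F.bitLength_le _ (hx.of_one.mono hw)

end Fits

/-- The rank of each job is computed by counting. -/
def sortCmd : Cmd :=
  -- Variable `8` counts the jobs that precede job `6`, where ties are broken by the index. Arrays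
  -- `3` and `4` receive the job and its processing time at this position.
  .cfor 6 0 (.seq (.set 8 (.lit 0)) (.seq
    (.cfor 7 0 (.ite (.get 0 (.var 7)) (.get 0 (.var 6)) (.set 8 (.add (.var 8) (.lit 1)))
      (.ite (.get 0 (.var 6)) (.get 0 (.var 7)) .skip
        (.ite (.var 7) (.var 6) (.set 8 (.add (.var 8) (.lit 1))) .skip))))
    (.seq (.put 3 (.var 8) (.var 6)) (.put 4 (.var 8) (.get 0 (.var 6))))))

/-- `Tuple.sort` is stable, so it orders the pairs of value and index lexicographically, and the
rank of `j` is the number of smaller pairs. -/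
theorem card_before {n : ℕ} (p : Fin n → ℚ) (j : Fin n) :
    (Finset.univ.filter fun k => p k < p j ∨ (p k = p j ∧ k < j)).card =
      ((Tuple.sort p).symm j).val := by
  obtain ⟨hmono, hstable⟩ := Tuple.eq_sort_iff.mp (rfl : Tuple.sort p = Tuple.sort p)
  set π := Tuple.sort p
  have hlt : ∀ a b : Fin n, a < b → p (π a) < p (π b) ∨ (p (π a) = p (π b) ∧ π a < π b) := by
    intro a b hab
    rcases (hmono hab.le).lt_or_eq with h | h
    · exact .inl h
    · exact .inr ⟨h, hstable a b hab h⟩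
  have : (Finset.univ.filter fun k => p k < p j ∨ (p k = p j ∧ k < j)) =
      (Finset.univ.filter fun h => h < π.symm j).map π.toEmbedding := by
    ext k
    obtain ⟨a, rfl⟩ := π.surjective k
    obtain ⟨b, rfl⟩ := π.surjective j
    simp only [Finset.mem_filter, Finset.mem_univ, true_and, Finset.mem_map_equiv,
      Equiv.symm_apply_apply]
    refine ⟨fun h => ?_, hlt a b⟩
    rcases lt_trichotomy a b with h' | h' | h'
    · exact h'
    · subst h'; simp at h
    · rcases hlt b a h' with h1 | h1 <;> rcases h with h2 | h2
      · exact absurd h1 h2.not_gt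
      · exact absurd h1 h2.1.not_gt
      · exact absurd h2 h1.1.not_gt
      · exact absurd h1.2 h2.2.not_gt
  rw [this, Finset.card_map]
  have hc : (Finset.univ.filter fun h => h < π.symm j) = Finset.Iio (π.symm j) := by
    ext h; simp
  rw [hc, Fin.card_Iio]

theorem card_filter_lt_succ {n : ℕ} (p : Fin n → Prop) [DecidablePred p] (k : Fin n) :
    (Finset.univ.filter fun a : Fin n => a.val < k.val + 1 ∧ p a).card =
      (Finset.univ.filter fun a : Fin n => a.val < k.val ∧ p a).card + if p k then 1 else 0 := by
  have h : (if p k then 1 else 0) = (Finset.univ.filter fun a : Fin n => a = k ∧ p a).card := by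
    split_ifs with h
    · rw [eq_comm, Finset.card_eq_one]
      refine ⟨k, ?_⟩
      ext a
      simp only [Finset.mem_filter, Finset.mem_univ, true_and, Finset.mem_singleton]
      exact ⟨fun h => h.1, fun e => ⟨e, e ▸ h⟩⟩
    · rw [eq_comm, Finset.card_eq_zero, Finset.filter_eq_empty_iff]
      rintro a - ⟨rfl, ha⟩
      exact h ha
  rw [h, ← Finset.card_union_of_disjoint]
  · congr 1
    ext a
    simp only [Finset.mem_filter, Finset.mem_univ, true_and, Finset.mem_union, Fin.ext_iff]
    constructor
    · rintro ⟨h1, h2⟩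
      rcases Nat.lt_succ_iff_lt_or_eq.mp h1 with h3 | h3
      · exact .inl ⟨h3, h2⟩
      · exact .inr ⟨h3, h2⟩
    · rintro (⟨h1, h2⟩ | ⟨h1, h2⟩)
      · exact ⟨by omega, h2⟩
      · exact ⟨by omega, h2⟩
  · rw [Finset.disjoint_filter]
    rintro a - ⟨h1, -⟩ ⟨h2, -⟩
    rw [h2] at h1
    exact lt_irrefl _ h1

theorem wp_sortCmd {m : ℕ} {I : Instance} {d A W B N : ℕ} (F : Fits m I d A W B N) {σ : State}
    (h0 : σ.reg 0 = I.n) (hp : ∀ j : Fin I.n, σ.arr 0 j = I.p j) :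
    Cmd.wp B N sortCmd (fun τ => ∀ h : Fin I.n, τ.arr 3 h = ((Tuple.sort I.p h).val : ℚ) ∧
      τ.arr 4 h = I.p (Tuple.sort I.p h)) σ := by
  set π := Tuple.sort I.p with hπ
  have hnN : I.n ≤ N := by have := F.le_loop; omega
  refine Cmd.wp_cfor (by decide) (by simp [Cmd.wreg]) (by simp [Cmd.wreg]) I.n h0 hnN
    (fun j τ => ∀ h : Fin I.n, (π h).val < j → τ.arr 3 h = ((π h).val : ℚ) ∧
      τ.arr 4 h = I.p (π h)) (fun h hh => absurd hh (Nat.not_lt_zero _)) ?_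
    (fun τ hτ _ h => hτ h (π h).2)
  intro j hj τ hτ hag
  let jF : Fin I.n := ⟨j, hj⟩
  have hτ0 : τ.reg 0 = I.n := by rw [hag.1 0 (by simp [Cmd.wreg]), h0]
  have hτp : ∀ j : Fin I.n, τ.arr 0 j = I.p j := fun j => by rw [hag.2 0 (by simp [Cmd.warr]), hp]
  refine ⟨trivial, F.zero, ?_⟩
  refine Cmd.wp_seq (R := fun ρ => ρ.reg 8 = ((π.symm jF).val : ℚ)) ?_ ?_
  · refine Cmd.wp_cfor (by decide) (by simp [Cmd.wreg]) (by simp [Cmd.wreg]) I.n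
      (by simp [hτ0]) hnN (fun k ρ => ρ.reg 8 = ((Finset.univ.filter fun a : Fin I.n =>
        a.val < k ∧ (I.p a < I.p jF ∨ (I.p a = I.p jF ∧ a < jF))).card : ℚ)) (by simp [Exp.eval]) ?_ ?_
    · intro k hk ρ hρ hag'
      let kF : Fin I.n := ⟨k, hk⟩
      have h6 : ρ.reg 6 = j := by rw [hag'.1 6 (by simp [Cmd.wreg])]; simp
      have hρp : ∀ j : Fin I.n, ρ.arr 0 j = I.p j := fun j => by
        rw [hag'.2 0 (by simp [Cmd.warr])]; exact hτp j
      have hpj := hρp jF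
      have hpk := hρp kF
      have hcard := card_filter_lt_succ (fun a : Fin I.n => I.p a < I.p jF ∨ (I.p a = I.p jF ∧ a < jF)) kF
      simp only [kF, jF] at hpj hpk hcard
      have hbl : ∀ c : ℕ, c ≤ I.n → bitLength ((c : ℚ)) ≤ B := fun c hc => F.nat (by omega)
      have hle : (Finset.univ.filter fun a : Fin I.n => a.val < k + 1 ∧
          (I.p a < I.p jF ∨ (I.p a = I.p jF ∧ a < jF))).card ≤ I.n :=
        (Finset.card_le_univ _).trans (by simp)
      have hset : (I.p kF < I.p jF ∨ (I.p kF = I.p jF ∧ kF < jF)) →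
          ρ.reg 8 + 1 = ((Finset.univ.filter fun a : Fin I.n => a.val < k + 1 ∧
          (I.p a < I.p jF ∨ (I.p a = I.p jF ∧ a < jF))).card : ℚ) := by
        intro h
        rw [if_pos h] at hcard
        rw [hρ, hcard]
        push_cast; rfl
      have hskip : ¬ (I.p kF < I.p jF ∨ (I.p kF = I.p jF ∧ kF < jF)) →
          ρ.reg 8 = ((Finset.univ.filter fun a : Fin I.n => a.val < k + 1 ∧
          (I.p a < I.p jF ∨ (I.p a = I.p jF ∧ a < jF))).card : ℚ) := by
        intro h
        rw [if_neg h] at hcard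
        rw [hρ, hcard]
        push_cast; simp [jF]
      have hset' : (I.p kF < I.p jF ∨ (I.p kF = I.p jF ∧ kF < jF)) →
          bitLength (ρ.reg 8 + 1) ≤ B := fun h => by rw [hset h]; exact hbl _ hle
      clear hcard
      generalize (Finset.univ.filter fun a : Fin I.n => a.val < k + 1 ∧
          (I.p a < I.p jF ∨ (I.p a = I.p jF ∧ a < jF))).card = c at *
      simp only [Cmd.wp, Exp.ok, Exp.eval, State.setReg_reg, State.setReg_arr, h6]
      norm_num [hpj, hpk]
      refine ⟨fun h => ⟨hset' (.inl h), ?_⟩, fun h => ⟨fun h' => ?_, fun h' => ⟨fun hl => ⟨?_, ?_⟩, fun hl => ?_⟩⟩⟩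
      · exact hset (.inl h)
      · refine hskip ?_
        rintro (h1 | h1)
        · exact absurd h1 h.not_gt
        · exact h'.ne' h1.1
      · exact hset' (.inr ⟨le_antisymm h' h, hl⟩)
      · exact hset (.inr ⟨le_antisymm h' h, hl⟩)
      · refine hskip ?_
        rintro (h1 | h1)
        · exact absurd h1 h.not_gt
        · exact absurd (show k < j from h1.2) hl.not_gt
    · intro ρ hρ _
      rw [← card_before I.p jF]
      simp only [State.setReg_reg]
      rw [if_neg (by decide), hρ]
      congr 2
      ext a
      simp
  · intro ρ hρ hag'
    have h6 : ρ.reg 6 = j := by rw [hag'.1 6 (by simp [Cmd.wreg])]; simp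
    have hρp : ρ.arr 0 j = I.p jF := by
      rw [hag'.2 0 (by simp [Cmd.warr])]; exact hτp jF
    have h3 : ρ.arr 3 = τ.arr 3 := by rw [hag'.2 3 (by simp [Cmd.warr])]; rfl
    have h4 : ρ.arr 4 = τ.arr 4 := by rw [hag'.2 4 (by simp [Cmd.warr])]; rfl
    refine ⟨trivial, trivial, _, hρ, by simpa [Exp.eval, h6] using F.nat (by omega), ?_⟩
    refine ⟨trivial, ⟨trivial, j, h6⟩, _, hρ, ?_, ?_⟩
    · simp only [Exp.eval, State.setArr_reg, State.setArr_arr, h6, Nat.floor_natCast, hρp]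
      simpa [hρp] using F.adm (adm_p I jF) (by have := F.le_weight; omega)
    · intro h hh
      simp only [Exp.eval, State.setArr_reg, State.setArr_arr, h6, Nat.floor_natCast, h3, h4]
      by_cases hj' : (π h).val = j
      · have : h = π.symm jF := by rw [Equiv.eq_symm_apply]; exact Fin.ext hj'
        have e2 : π h = jF := Fin.ext hj'
        simp [← this, hρp, e2, jF]
      · have hne : h.val ≠ (π.symm jF).val := fun e => hj' (by
          have : h = π.symm jF := Fin.ext e
          rw [this]; simp [jF])
        simpa [hne] using hτ h (by omega)

end SplitSched

namespace SplitSched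

/-! ### The program: list scheduling -/

/-- The numbering of the jobs in SPT order. -/
abbrev Instance.perm (I : Instance) : Equiv.Perm (Fin I.n) := Tuple.sort I.p

/-- The processing times in SPT order. -/
noncomputable abbrev Instance.sorted (I : Instance) (h : Fin I.n) : ℝ := (I.p (I.perm h) : ℝ)

/-- The part of the state that is the same in all rounds. -/
structure Env (m : ℕ) (I : Instance) (K : ℕ) (σ : State) : Prop where
  -- Not part of the environment: variables `4` and `5` hold the value of the best round and whether
  -- there is one, `18` the value of the current candidate, `20, 21, …` the guesses. Arrays `1` and
  -- `2` are the output; `5`, `6`, `7` hold machines, loads and guesses of the current round.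
  n_eq : σ.reg 0 = I.n
  s_eq : σ.reg 1 = I.s
  K_eq : σ.reg 2 = K
  grid_eq : (σ.reg 3 : ℝ) = gridStep I.s I.sorted K
  m_eq : σ.reg 16 = m
  succ_eq : σ.reg 17 = (K + 1 : ℕ)
  perm_eq : ∀ h : Fin I.n, σ.arr 3 h = ((I.perm h).val : ℚ)
  sorted_eq : ∀ h : Fin I.n, σ.arr 4 h = I.p (I.perm h)

/-- The command does not change that part of the state. -/
structure Cmd.KeepsEnv (c : Cmd) : Prop where
  reg : ∀ v, v < 4 ∨ v = 16 ∨ v = 17 → ¬ c.wreg v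
  arr : ∀ b, b = 3 ∨ b = 4 → ¬ c.warr b

theorem Env.of_agree {m : ℕ} {I : Instance} {K : ℕ} {σ τ : State} {c : Cmd} (h : Env m I K σ)
    (hc : c.KeepsEnv) (hag : c.Agree σ τ) : Env m I K τ := by
  have hr : ∀ v, v < 4 ∨ v = 16 ∨ v = 17 → τ.reg v = σ.reg v := fun v hv => hag.1 v (hc.reg v hv)
  have ha : ∀ b, b = 3 ∨ b = 4 → τ.arr b = σ.arr b := fun b hb => hag.2 b (hc.arr b hb)
  exact ⟨by rw [hr 0 (by omega), h.n_eq], by rw [hr 1 (by omega), h.s_eq],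
    by rw [hr 2 (by omega), h.K_eq], by rw [hr 3 (by omega), h.grid_eq],
    by rw [hr 16 (by omega), h.m_eq], by rw [hr 17 (by omega), h.succ_eq],
    fun k => by rw [ha 3 (by omega), h.perm_eq], fun k => by rw [ha 4 (by omega), h.sorted_eq]⟩

theorem Env.setReg {m : ℕ} {I : Instance} {K : ℕ} {σ : State} (h : Env m I K σ) {v : ℕ}
    (hv : ¬ (v < 4 ∨ v = 16 ∨ v = 17)) (x : ℚ) : Env m I K (σ.setReg v x) := by
  have hr : ∀ w, w < 4 ∨ w = 16 ∨ w = 17 → (σ.setReg v x).reg w = σ.reg w := fun w hw => by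
    rw [State.setReg_reg, if_neg (by rintro rfl; exact hv hw)]
  exact ⟨by rw [hr 0 (by omega), h.n_eq], by rw [hr 1 (by omega), h.s_eq],
    by rw [hr 2 (by omega), h.K_eq], by rw [hr 3 (by omega), h.grid_eq],
    by rw [hr 16 (by omega), h.m_eq], by rw [hr 17 (by omega), h.succ_eq],
    h.perm_eq, h.sorted_eq⟩

/-- The number of list scheduled jobs, the grid step and the constants of `Env`; no round has been
found yet. Here all but at most `R` jobs are list scheduled. -/
def paramCmd (m R : ℕ) : Cmd :=
  .seq (.ite (.lit R) (.var 0) (.set 2 (.add (.var 0) (.lit (-R)))) (.set 2 (.lit 0))) (.seq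
    (.ite (.lit 0) (.var 2) (.set 3 (.add (.var 1) (.get 4 (.add (.var 2) (.lit (-1))))))
      (.set 3 (.lit 0))) (.seq
    (.set 16 (.lit m)) (.seq (.set 17 (.add (.var 2) (.lit 1))) (.set 5 (.lit 0)))))

section Commands

variable {m : ℕ} {I : Instance} {d A W B N : ℕ}

theorem wp_paramCmd (F : Fits m I d A W B N) (R : ℕ) {σ : State} (h0 : σ.reg 0 = I.n)
    (h1 : σ.reg 1 = I.s) (h3 : ∀ h : Fin I.n, σ.arr 3 h = ((I.perm h).val : ℚ))
    (h4 : ∀ h : Fin I.n, σ.arr 4 h = I.p (I.perm h)) :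
    Cmd.wp B N (paramCmd m R) (fun τ => Env m I (I.n - R) τ ∧ τ.reg 5 = 0) σ := by
  refine Cmd.wp_seq (R := fun τ => τ.reg 2 = (I.n - R : ℕ)) ?_ ?_
  · refine ⟨trivial, trivial, fun h => ?_, fun h => ?_⟩
    · simp only [Exp.eval, h0] at h
      have hle : R < I.n := by exact_mod_cast h
      have e : (I.n : ℚ) + -(R : ℚ) = (I.n - R : ℕ) := by
        rw [Nat.cast_sub hle.le]; ring
      refine ⟨⟨trivial, trivial⟩, ?_, ?_⟩
      · simp only [Exp.eval, h0, e]
        exact F.nat (by omega)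
      · simp [Exp.eval, h0, e]
    · simp only [Exp.eval, h0] at h
      have hle : ¬ R < I.n := by exact_mod_cast h
      refine ⟨trivial, F.zero, ?_⟩
      simp [Exp.eval, Nat.sub_eq_zero_of_le (not_lt.mp hle)]
  intro τ hτ2 hag
  have hτ0 : τ.reg 0 = I.n := by rw [hag.1 0 (by simp [Cmd.wreg]), h0]
  have hτ1 : τ.reg 1 = I.s := by rw [hag.1 1 (by simp [Cmd.wreg]), h1]
  have hτ3 : τ.arr 3 = σ.arr 3 := hag.2 3 (by simp [Cmd.warr])
  have hτ4 : τ.arr 4 = σ.arr 4 := hag.2 4 (by simp [Cmd.warr])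
  clear hag
  set K := I.n - R with hK
  refine Cmd.wp_seq (R := fun τ => (τ.reg 3 : ℝ) = gridStep I.s I.sorted K) ?_ ?_
  · refine ⟨trivial, trivial, fun h => ?_, fun h => ?_⟩
    · simp only [Exp.eval, hτ2] at h
      have hpos : 0 < K := by exact_mod_cast h
      have e : (K : ℚ) + -1 = (K - 1 : ℕ) := by
        rw [Nat.cast_sub hpos]; push_cast; ring
      have hlt : K - 1 < I.n := by omega
      have e4 : τ.arr 4 (K - 1) = I.p (I.perm ⟨K - 1, hlt⟩) := by rw [hτ4]; exact h4 ⟨K - 1, hlt⟩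
      have ev : τ.reg 1 + τ.arr 4 ⌊τ.reg 2 + -1⌋₊ = I.s + I.p (I.perm ⟨K - 1, hlt⟩) := by
        rw [hτ2, e, Nat.floor_natCast, hτ1, e4]
      refine ⟨⟨trivial, ⟨trivial, trivial⟩, K - 1, by simp only [Exp.eval, hτ2, e]⟩, ?_, ?_⟩
      · simp only [Exp.eval, ev]
        exact F.adm (adm_s_add_p I _) (by have := F.le_weight; omega)
      · simp only [Exp.eval, ev, State.setReg_reg, if_true]
        rw [gridStep, dif_pos ⟨hpos, by omega⟩]
        push_cast; rfl
    · simp only [Exp.eval, hτ2] at h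
      have hpos : ¬ 0 < K := by exact_mod_cast h
      refine ⟨trivial, F.zero, ?_⟩
      simp [Exp.eval, gridStep, hpos]
  intro ρ hρ3 hag
  have hr : ∀ v, v ≠ 3 → ρ.reg v = τ.reg v := fun v hv => hag.1 v (by simp [Cmd.wreg, hv])
  have ha : ρ.arr = τ.arr := by
    funext b; exact hag.2 b (by simp [Cmd.warr])
  have e2 : ρ.reg 2 = K := by rw [hr 2 (by decide), hτ2]
  refine ⟨trivial, F.nat (by omega), ⟨trivial, trivial⟩, ?_, trivial, F.zero, ?_⟩
  · have : bitLength ((K + 1 : ℕ) : ℚ) ≤ B := by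
      refine F.nat ?_
      omega
    simpa [Exp.eval, e2] using this
  · refine ⟨⟨?_, ?_, ?_, ?_, ?_, ?_, ?_, ?_⟩, ?_⟩
    · simp [Exp.eval, hr, hτ0]
    · simp [Exp.eval, hr, hτ1]
    · simp [Exp.eval, e2]
    · simpa using hρ3
    · simp [Exp.eval]
    · simp [Exp.eval, e2]
    · intro h; simpa [ha, hτ3] using h3 h
    · intro h; simpa [ha, hτ4] using h4 h
    · simp [Exp.eval]

/-- The selection of the machine for the next job. -/
def selectCmd : Cmd :=
  .seq (.set 15 (.lit 0)) (.cfor 12 16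
    (.ite (.get 6 (.var 12)) (.mul (.get 7 (.var 12)) (.var 3))
      (.ite (.var 15) (.lit 1)
        (.seq (.set 13 (.var 12)) (.seq (.set 14 (.get 6 (.var 12))) (.set 15 (.lit 1))))
        (.ite (.get 6 (.var 12)) (.var 14)
          (.seq (.set 13 (.var 12)) (.set 14 (.get 6 (.var 12)))) .skip))
      .skip))

/-- Machine `i` is the first open machine of least load `L i` among the first `k` machines. -/
def IsSelected (L t : Fin m → ℚ) (k : ℕ) (i : Fin m) : Prop :=
  L i < t i ∧ ∀ i' : Fin m, i'.val < k → L i' < t i' → L i < L i' ∨ (L i = L i' ∧ i ≤ i')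

/-- Variable `15` tells whether an open machine has been met, `13` and `14` are the best one and its
load. It is replaced only by a machine of strictly smaller load, so the first machine wins ties.
Comparing rationals is the same as comparing the real loads. -/
theorem wp_selectCmd (F : Fits m I d A W B N) {w : ℕ} (hw : w ≤ W) {L t : Fin m → ℚ}
    (hL : ∀ i, Adm I 1 w (L i)) {σ : State} (h16 : σ.reg 16 = m) (h6 : ∀ i : Fin m, σ.arr 6 i = L i)
    (h7 : ∀ i : Fin m, σ.arr 7 i * σ.reg 3 = t i) :
    Cmd.wp B N selectCmd (fun τ => (τ.reg 15 = 0 ∧ ∀ i, ¬ L i < t i) ∨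
      (τ.reg 15 = 1 ∧ ∃ i, τ.reg 13 = (i.val : ℚ) ∧ τ.reg 14 = L i ∧ IsSelected L t m i)) σ := by
  refine ⟨trivial, F.zero, ?_⟩
  refine Cmd.wp_cfor (by decide) (by simp [Cmd.wreg]) (by simp [Cmd.wreg]) m (by simp [h16])
    (by have := F.le_loop; omega)
    (fun k τ => (τ.reg 15 = 0 ∧ ∀ i : Fin m, i.val < k → ¬ L i < t i) ∨
      (τ.reg 15 = 1 ∧ ∃ i : Fin m, i.val < k ∧ τ.reg 13 = (i.val : ℚ) ∧ τ.reg 14 = L i ∧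
        IsSelected L t k i))
    (.inl ⟨by simp [Exp.eval], fun i hi => absurd hi (Nat.not_lt_zero _)⟩) ?_ ?_
  · intro k hk τ hτ hag
    let i : Fin m := ⟨k, hk⟩
    have e6 : τ.arr 6 k = L i := by rw [hag.2 6 (by simp [Cmd.warr])]; exact h6 i
    have e7 : τ.arr 7 k * τ.reg 3 = t i := by
      rw [hag.2 7 (by simp [Cmd.warr]), hag.1 3 (by simp [Cmd.wreg])]
      simpa using h7 i
    have hkB : bitLength ((k : ℕ) : ℚ) ≤ B := F.nat (by omega)
    have hLB : bitLength (L i) ≤ B := F.adm (hL i) hw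
    have hlast : ∀ i' : Fin m, i'.val < k + 1 → i'.val < k ∨ i' = i := by
      intro i' hi'
      rcases Nat.lt_succ_iff_lt_or_eq.mp hi' with h | h
      · exact .inl h
      · exact .inr (Fin.ext h)
    simp only [Cmd.wp, Exp.ok, Exp.eval, State.setReg_reg, State.setReg_arr, Nat.floor_natCast,
      if_true, e6, true_and, and_true, Nat.cast_inj, exists_eq',
      Nat.reduceEqDiff, if_false, e7, hkB, hLB, F.one]
    refine ⟨fun hlt => ⟨fun h15 => .inr ⟨i, Nat.lt_succ_self _, rfl, rfl, hlt, fun i' hi' ho => ?_⟩,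
      fun h15 => ⟨fun hl => .inr ?_, fun hl => .inr ?_⟩⟩, fun hlt => ?_⟩
    · rcases hτ with hτ | hτ
      · rcases hlast i' hi' with h | rfl
        · exact absurd ho (hτ.2 i' h)
        · exact .inr ⟨rfl, le_rfl⟩
      · rw [hτ.1] at h15; exact absurd h15 (lt_irrefl _)
    · rcases hτ with hτ | ⟨h1, i₀, hi₀, h13, h14, hsel⟩
      · rw [hτ.1] at h15; exact absurd one_pos h15
      · refine ⟨h1, i, Nat.lt_succ_self _, rfl, rfl, hlt, fun i' hi' ho => ?_⟩
        rw [h14] at hl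
        rcases hlast i' hi' with h | rfl
        · rcases hsel.2 i' h ho with h2 | h2
          · exact .inl (hl.trans h2)
          · exact .inl (h2.1 ▸ hl)
        · exact .inr ⟨rfl, le_rfl⟩
    · rcases hτ with hτ | ⟨h1, i₀, hi₀, h13, h14, hsel⟩
      · rw [hτ.1] at h15; exact absurd one_pos h15
      · refine ⟨h1, i₀, hi₀.trans (Nat.lt_succ_self _), h13, h14, hsel.1, fun i' hi' ho => ?_⟩
        rcases hlast i' hi' with h | rfl
        · exact hsel.2 i' h ho
        · rw [h14] at hl
          rcases (not_lt.mp hl).lt_or_eq with h2 | h2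
          · exact .inl h2
          · exact .inr ⟨h2, hi₀.le⟩
    · rcases hτ with hτ | ⟨h1, i₀, hi₀, h13, h14, hsel⟩
      · refine .inl ⟨hτ.1, fun i' hi' => ?_⟩
        rcases hlast i' hi' with h | rfl
        · exact hτ.2 i' h
        · exact hlt
      · refine .inr ⟨h1, i₀, hi₀.trans (Nat.lt_succ_self _), h13, h14, hsel.1, fun i' hi' ho => ?_⟩
        rcases hlast i' hi' with h | rfl
        · exact hsel.2 i' h ho
        · exact absurd ho hlt
  · intro τ hτ _
    rcases hτ with hτ | ⟨h1, i₀, hi₀, h13, h14, hsel⟩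
    · exact .inl ⟨by simpa using hτ.1, fun i => hτ.2 i i.2⟩
    · exact .inr ⟨by simpa using h1, i₀, by simpa using h13, by simpa using h14, hsel⟩

end Commands

end SplitSched

/-! ### The program: the loop of list scheduling -/

namespace SplitSched

/-- List scheduling of the first jobs. Variable `9` tells whether it succeeds, variable `10` is the
total completion time, array `5` holds the machines of the jobs, array `6` the loads. -/
def listCmd : Cmd :=
  .seq (.cfor 12 16 (.put 6 (.var 12) (.lit 0))) (.seq (.set 9 (.lit 1)) (.seq (.set 10 (.lit 0))
    (.cfor 11 2 (.ite (.var 9) (.lit 1) .skip (.seq selectCmd (.ite (.var 15) (.lit 1)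
      (.set 9 (.lit 0))
      (.seq (.put 5 (.var 11) (.var 13))
        (.seq (.set 14 (.add (.var 14) (.add (.var 1) (.get 4 (.var 11)))))
          (.seq (.put 6 (.var 13) (.var 14)) (.set 10 (.add (.var 10) (.var 14))))))))))))

/-- The state after the first `h` jobs have been list scheduled according to `f`. -/
structure ListState {m : ℕ} (I : Instance) (t : Fin m → ℝ) (f : Fin I.n → Fin m) (h : ℕ)
    (σ : State) : Prop where
  list : IsListSchedule I.s I.sorted h t f
  job_eq : ∀ k : Fin I.n, k.val < h → σ.arr 5 k = ((f k).val : ℚ)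
  load_eq : ∀ i : Fin m, (σ.arr 6 i : ℝ) = listLoad I.s I.sorted f h i
  load_adm : ∀ i : Fin m, Adm I 1 h (σ.arr 6 i)
  value_eq : (σ.reg 10 : ℝ) = ∑ k with k.val < h, listLoad I.s I.sorted f (k.val + 1) (f k)
  -- A sum of `h` completion times, each of weight at most the number of jobs.
  value_adm : Adm I 1 (h * I.n) (σ.reg 10)

theorem ListState.of_agree {m : ℕ} {I : Instance} {t : Fin m → ℝ} {f : Fin I.n → Fin m} {h : ℕ}
    {σ τ : State} {c : Cmd} (H : ListState I t f h σ) (hr : ¬ c.wreg 10) (ha5 : ¬ c.warr 5)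
    (ha6 : ¬ c.warr 6) (hag : c.Agree σ τ) : ListState I t f h τ :=
  ⟨H.list, by rw [hag.2 5 ha5]; exact H.job_eq, by rw [hag.2 6 ha6]; exact H.load_eq,
    by rw [hag.2 6 ha6]; exact H.load_adm, by rw [hag.1 10 hr]; exact H.value_eq,
    by rw [hag.1 10 hr]; exact H.value_adm⟩

theorem sum_filter_lt_succ {n : ℕ} (F : Fin n → ℝ) (h : Fin n) :
    ∑ k with k.val < h.val + 1, F k = ∑ k with k.val < h.val, F k + F h := by
  have : (Finset.univ.filter fun k : Fin n => k.val < h.val + 1) =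
      insert h (Finset.univ.filter fun k : Fin n => k.val < h.val) := by
    ext k
    simp only [Finset.mem_filter, Finset.mem_univ, true_and, Finset.mem_insert, Fin.ext_iff]
    omega
  rw [this, Finset.sum_insert (by simp), add_comm]

section Commands

variable {m : ℕ} {I : Instance} {d A W B N K : ℕ}

theorem wp_listCmd (F : Fits m I d A W B N) (hK : K ≤ I.n) {σ : State} (henv : Env m I K σ)
    {a : Fin m → ℕ} (i₀ : Fin m) (ha : ∀ i : Fin m, σ.arr 7 i = a i) :
    Cmd.wp B N listCmd (fun τ =>
      (τ.reg 9 = 1 ∧ ∃ f : Fin I.n → Fin m,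
        ListState I (fun i => a i * gridStep I.s I.sorted K) f K τ) ∨
      (τ.reg 9 = 0 ∧ ∀ f : Fin I.n → Fin m,
        ¬ IsListSchedule I.s I.sorted K (fun i => a i * gridStep I.s I.sorted K) f)) σ := by
  set t : Fin m → ℝ := fun i => a i * gridStep I.s I.sorted K with ht
  refine Cmd.wp_seq (R := fun τ => ∀ i : Fin m, τ.arr 6 i = 0) ?_ ?_
  · refine Cmd.wp_cfor (by decide) (by simp [Cmd.wreg]) (by simp [Cmd.wreg]) m henv.m_eq
      (by have := F.le_loop; omega) (fun k τ => ∀ i : Fin m, i.val < k → τ.arr 6 i = 0)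
      (fun i hi => absurd hi (Nat.not_lt_zero _)) ?_ (fun τ hτ _ i => hτ i i.2)
    intro k hk τ hτ _
    refine ⟨trivial, trivial, k, by simp [Exp.eval], F.zero, fun i hi => ?_⟩
    rw [State.setArr_arr]
    split_ifs with h
    · rfl
    · exact hτ i (by simp at h; omega)
  intro τ hτ6 hag
  have henvτ : Env m I K τ := henv.of_agree
    ⟨fun v hv => by simp only [Cmd.wreg, or_false]; omega,
      fun b hb => by simp only [Cmd.warr]; omega⟩ hag
  have haτ : τ.arr 7 = σ.arr 7 := hag.2 7 (by simp [Cmd.warr])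
  clear hag
  refine ⟨trivial, F.one, trivial, F.zero, ?_⟩
  refine Cmd.wp_cfor (by decide) (by simp [Cmd.wreg, selectCmd]) (by simp [Cmd.wreg, selectCmd]) K
    (by simp [henvτ.K_eq]) (by have := F.le_loop; omega)
    (fun h τ => (τ.reg 9 = 1 ∧ ∃ f : Fin I.n → Fin m, ListState I t f h τ) ∨
      (τ.reg 9 = 0 ∧ ∀ f : Fin I.n → Fin m, ¬ IsListSchedule I.s I.sorted K t f))
    (.inl ⟨by simp [Exp.eval], fun _ => i₀, ?_⟩) ?_ ?_
  · refine ⟨fun h hh => absurd hh (Nat.not_lt_zero _), fun k hk => absurd hk (Nat.not_lt_zero _),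
      fun i => ?_, fun i => ?_, ?_, ?_⟩
    · rw [listLoad_zero]; simp [hτ6]
    · simpa [hτ6] using Adm.zero
    · simp [Exp.eval]
    · simpa [Exp.eval] using Adm.zero
  · intro h hh ρ hρ hag
    have henvρ : Env m I K ρ := ((henvτ.setReg (by decide) _).setReg (by decide) _).of_agree
      ⟨fun v hv => by simp only [Cmd.wreg, selectCmd, or_false, false_or]; omega,
        fun b hb => by simp only [Cmd.warr, selectCmd, or_false, false_or]; omega⟩ hag
    have haρ : ρ.arr 7 = σ.arr 7 := by
      rw [hag.2 7 (by simp [Cmd.warr, selectCmd]), ← haτ]; rfl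
    clear hag
    refine ⟨trivial, trivial, fun h9 => ?_, fun h9 => ?_⟩
    · rcases hρ with hρ | hρ
      · simp [Exp.eval, hρ.1] at h9
      · exact .inr ⟨by simpa using hρ.1, hρ.2⟩
    rcases hρ with ⟨h91, f, hf⟩ | hρ
    swap
    · simp [Exp.eval, hρ.1] at h9
    let hF : Fin I.n := ⟨h, by omega⟩
    have hcast : ∀ i : Fin m, ((ρ.arr 7 i * ρ.reg 3 : ℚ) : ℝ) = t i := by
      intro i
      rw [haρ, ha i]
      push_cast
      rw [henvρ.grid_eq]
    refine Cmd.wp_seq (wp_selectCmd F (w := h) (by have := F.le_weight; omega)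
      (L := fun i => ρ.arr 6 i) (t := fun i => ρ.arr 7 i * ρ.reg 3) hf.load_adm
      (by simp [henvρ.m_eq]) (fun i => rfl) (fun i => by simp)) ?_
    intro κ hκ hag
    have henvκ : Env m I K κ := (henvρ.setReg (by decide) _).of_agree
      ⟨fun v hv => by simp only [Cmd.wreg, selectCmd, or_false]; omega,
        fun b hb => by simp only [Cmd.warr, selectCmd, false_or, not_false_eq_true]⟩ hag
    have h9κ : κ.reg 9 = 1 := by rw [hag.1 9 (by simp [Cmd.wreg, selectCmd])]; simpa using h91
    have h11κ : κ.reg 11 = h := by rw [hag.1 11 (by simp [Cmd.wreg, selectCmd])]; simp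
    have h6κ : κ.arr 6 = ρ.arr 6 := by rw [hag.2 6 (by simp [Cmd.warr, selectCmd])]; rfl
    have hfκ : ListState I t f h κ := by
      refine ListState.of_agree (σ := ρ.setReg 11 h) ?_ (by simp [Cmd.wreg, selectCmd])
        (by simp [Cmd.warr, selectCmd]) (by simp [Cmd.warr, selectCmd]) hag
      exact ⟨hf.list, hf.job_eq, hf.load_eq, hf.load_adm, by simpa using hf.value_eq,
        by simpa using hf.value_adm⟩
    refine ⟨trivial, trivial, fun h15 => ?_, fun h15 => ?_⟩
    · refine ⟨trivial, F.zero, .inr ⟨by simp [Exp.eval], fun g hg => ?_⟩⟩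
      rcases hκ with hκ | hκ
      swap
      · simp [Exp.eval, hκ.1] at h15
      -- By uniqueness, any list schedule `g` of all `K` jobs agrees with the partial one
      -- constructed so far. It would put the next job on an open machine, but there is none.
      refine hκ.2 (g hF) ?_
      have h1 := (hg hF hh).1
      have h2 : listLoad (I.s : ℝ) I.sorted g h (g hF) = listLoad I.s I.sorted f h (g hF) :=
        listLoad_congr (fun k hk => (hg.mono hh.le).unique hf.list k hk) _
      rw [show hF.val = h from rfl, h2, ← hf.load_eq, ← hcast] at h1
      exact_mod_cast h1
    · rcases hκ with hκ | ⟨-, i, h13, h14, hopen, hmin⟩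
      · simp [Exp.eval, hκ.1] at h15
      have e4 : κ.arr 4 h = I.p (I.perm hF) := henvκ.sorted_eq hF
      have hadm : Adm I 1 (h + 1) (ρ.arr 6 i + (I.s + I.p (I.perm hF))) :=
        (hf.load_adm i).add (adm_s_add_p I _)
      have hvadm : Adm I 1 (h * I.n + I.n) (κ.reg 10 + (ρ.arr 6 i + (I.s + I.p (I.perm hF)))) :=
        hfκ.value_adm.add (hadm.mono (by omega))
      have hWn : h + 1 ≤ W := by have := F.le_weight; omega
      have hWv : h * I.n + I.n ≤ W := by
        have := F.value_le_weight
        have : (h + 1) * I.n ≤ I.n * I.n := Nat.mul_le_mul_right _ (by omega)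
        linarith [Nat.zero_le A]
      have hB1 : bitLength ((i.val : ℕ) : ℚ) ≤ B := F.nat (by omega)
      have hnew : listLoad I.s I.sorted (Function.update f hF i) (h + 1) i =
          ((ρ.arr 6 i + (I.s + I.p (I.perm hF)) : ℚ) : ℝ) := by
        rw [show h + 1 = hF.val + 1 from rfl, listLoad_succ, listLoad_update_of_le _ _ _ le_rfl,
          ← hf.load_eq]
        simp
      simp only [Cmd.wp, Exp.ok, Exp.eval, State.setReg_reg, State.setArr_reg,
        State.setArr_arr, Nat.floor_natCast, h11κ, h13, h14, e4, henvκ.s_eq, if_true, true_and,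
        Nat.cast_inj, exists_eq', Nat.reduceEqDiff, if_false, false_and, hB1, exists_eq_left',
        F.adm hadm hWn, F.adm hvadm hWv]
      refine .inl ⟨by simpa using h9κ, Function.update f hF i, ?_, ?_, ?_, ?_, ?_, ?_⟩
      · refine IsListSchedule.extend (h := hF) hf.list ?_ ?_
        · rw [← hcast, show hF.val = h from rfl, ← hf.load_eq]
          exact_mod_cast hopen
        · intro i' hi'
          rw [← hcast, show hF.val = h from rfl, ← hf.load_eq] at hi'
          have := hmin i' i'.2 (by exact_mod_cast hi')
          rw [show hF.val = h from rfl, ← hf.load_eq, ← hf.load_eq]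
          exact_mod_cast this
      · intro k hk
        by_cases e : k = hF
        · subst e; simp [hF]
        · have hne : k.val ≠ h := fun e' => e (Fin.ext e')
          simpa [hne, e] using hfκ.job_eq k (by omega)
      · intro i'
        by_cases e : i' = i
        · subst e; simp [hnew]
        · have hne : i'.val ≠ i.val := fun e' => e (Fin.ext e')
          rw [show h + 1 = hF.val + 1 from rfl, listLoad_succ, listLoad_update_of_le _ _ _ le_rfl]
          simpa [hne, Ne.symm e] using hfκ.load_eq i'
      · intro i'
        by_cases e : i' = i
        · subst e; simpa using hadm
        · have hne : i'.val ≠ i.val := fun e' => e (Fin.ext e')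
          simpa [hne] using (hfκ.load_adm i').mono (Nat.le_succ h)
      · rw [show h + 1 = hF.val + 1 from rfl, sum_filter_lt_succ]
        have e1 : ∑ k : Fin I.n with k.val < hF.val, listLoad I.s I.sorted (Function.update f hF i)
            (k.val + 1) (Function.update f hF i k) = ((κ.reg 10 : ℚ) : ℝ) := by
          rw [hfκ.value_eq]
          refine Finset.sum_congr rfl fun k hk => ?_
          have hk' : k.val < hF.val := (Finset.mem_filter.mp hk).2
          have hne : k ≠ hF := fun e => by rw [e] at hk'; exact lt_irrefl _ hk'
          rw [listLoad_update_of_le _ _ _ hk', Function.update_of_ne hne]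
        rw [e1, Function.update_self, show hF.val + 1 = h + 1 from rfl, hnew]
        push_cast
        simp
      · have : (h + 1) * I.n = h * I.n + I.n := by ring
        rw [this]
        simpa using hvadm
  · intro ρ hρ _
    rcases hρ with ⟨h9, f, hf⟩ | hρ
    · exact .inl ⟨by simpa using h9, f, hf.list, hf.job_eq, hf.load_eq, hf.load_adm,
        by simpa using hf.value_eq, by simpa using hf.value_adm⟩
    · exact .inr ⟨by simpa using hρ.1, hρ.2⟩

end Commands

end SplitSched

namespace SplitSched

/-! ### The program: evaluation of linear forms -/

/-- The sum of a list of expressions. -/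
def Exp.sum (l : List Exp) : Exp := l.foldr .add (.lit 0)

theorem Exp.eval_sum {ι : Type*} (σ : State) (e : ι → Exp) (l : List ι) :
    (Exp.sum (l.map e)).eval σ = (l.map fun i => (e i).eval σ).sum := by
  induction l with
  | nil => rfl
  | cons i l ih => simp only [Exp.sum, List.map_cons, List.foldr_cons, Exp.eval, List.sum_cons] at ih ⊢; rw [ih]

theorem Exp.ok_sum {ι : Type*} {σ : State} {e : ι → Exp} {l : List ι} (h : ∀ i, (e i).ok σ) :
    (Exp.sum (l.map e)).ok σ := by
  induction l with
  | nil => trivial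
  | cons i l ih => exact ⟨h i, ih⟩

/-- The value of a linear form in the parameters of the linear program for the last `N` jobs. -/
def formExp {m N : ℕ} (g : LPParam m N → ℚ) : Exp :=
  .add (.sum ((List.finRange N).map fun l =>
      .mul (.lit (g (.inl (.inl l)))) (.get 4 (.add (.var 2) (.lit (l.val : ℕ))))))
    (.add (.sum ((List.finRange m).map fun i => .mul (.lit (g (.inl (.inr i)))) (.get 6 (.lit (i.val : ℕ)))))
      (.mul (.lit (g (.inr ()))) (.var 1)))

/-- The coefficients are multiples of `1 / d` and at most `c`. -/
def GoodForm {m N : ℕ} (d c : ℕ) (g : LPParam m N → ℚ) : Prop :=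
  ∀ j, (∃ z : ℤ, g j * d = z) ∧ |g j| ≤ c

theorem exists_common_bound {S : Set ℚ} (hS : S.Finite) :
    ∃ d c : ℕ, 0 < d ∧ ∀ x ∈ S, (∃ z : ℤ, x * d = z) ∧ |x| ≤ c := by
  induction S, hS using Set.Finite.induction_on with
  | empty => exact ⟨1, 0, one_pos, fun x hx => absurd hx (Set.notMem_empty x)⟩
  | @insert a S _ _ ih =>
    obtain ⟨d, c, hd, h⟩ := ih
    refine ⟨d * a.den, c + ⌈|a|⌉₊, Nat.mul_pos hd a.den_pos, fun x hx => ?_⟩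
    rcases hx with rfl | hx
    · refine ⟨mul_den_of_dvd (Dvd.intro_left _ rfl), ?_⟩
      push_cast
      have := Nat.le_ceil |x|
      have : (0 : ℚ) ≤ c := Nat.cast_nonneg c
      linarith
    · obtain ⟨⟨z, hz⟩, hc⟩ := h x hx
      refine ⟨⟨z * a.den, ?_⟩, ?_⟩
      · push_cast
        rw [← mul_assoc, hz]
      · push_cast
        have : (0 : ℚ) ≤ (⌈|a|⌉₊ : ℚ) := Nat.cast_nonneg _
        linarith

/-- The numbers that the candidate computes have coefficients with denominator `d` and bound `c`. -/
def Candidate.Good {m N : ℕ} (d c : ℕ) (κ : Candidate m N) : Prop :=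
  (∀ l i, GoodForm d c (κ.x l i)) ∧ GoodForm d c (∑ l, κ.C l)

/-- Only the finitely many programs with at most `R` jobs occur, so one denominator and one bound
serve all coefficients. Both are independent of the instance. -/
theorem Candidate.exists_good {m : ℕ} (Z : ∀ N, List (Candidate m N)) (R : ℕ) :
    ∃ d c : ℕ, 0 < d ∧ ∀ N ≤ R, ∀ κ ∈ Z N, κ.Good d c := by
  have hfin : (⋃ N ∈ Set.Iic R, ⋃ κ ∈ {κ | κ ∈ Z N},
      (Set.range fun p : Fin N × Fin m × LPParam m N => κ.x p.1 p.2.1 p.2.2) ∪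
        Set.range (∑ l, κ.C l)).Finite :=
    (Set.finite_Iic R).biUnion fun N _ => (List.finite_toSet (Z N)).biUnion fun κ _ =>
      (Set.finite_range _).union (Set.finite_range _)
  obtain ⟨d, c, hd, h⟩ := exists_common_bound hfin
  refine ⟨d, c, hd, fun N hN κ hκ => ⟨fun l i j => h _ ?_, fun j => h _ ?_⟩⟩
  · exact Set.mem_biUnion (x := N) hN (Set.mem_biUnion (x := κ) hκ (.inl ⟨(l, i, j), rfl⟩))
  · exact Set.mem_biUnion (x := N) hN (Set.mem_biUnion (x := κ) hκ (.inr ⟨j, rfl⟩))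

section Form

variable {m : ℕ} {I : Instance} {K : ℕ} {σ : State}

theorem Env.get_eq (henv : Env m I K σ) (b : ℕ) (l : Fin (I.n - K)) :
    (Exp.get b (.add (.var 2) (.lit (l.val : ℕ)))).eval σ = σ.arr b (tailPos l).val := by
  simp only [Exp.eval, henv.K_eq, tailPos]
  rw [← Nat.cast_add, Nat.floor_natCast]

theorem Env.get_ok (henv : Env m I K σ) (b : ℕ) (l : ℕ) :
    (Exp.get b (.add (.var 2) (.lit (l : ℕ)))).ok σ :=
  ⟨⟨trivial, trivial⟩, K + l, by simp [Exp.eval, henv.K_eq]⟩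

theorem Env.formExp_ok (henv : Env m I K σ) {N : ℕ} (g : LPParam m N → ℚ) : (formExp g).ok σ :=
  ⟨Exp.ok_sum fun l => ⟨trivial, henv.get_ok 4 l⟩,
    Exp.ok_sum fun i => ⟨trivial, trivial, i.val, rfl⟩, trivial, trivial⟩

theorem Env.formExp_eval (henv : Env m I K σ) (g : LPParam m (I.n - K) → ℚ) :
    (formExp g).eval σ = ∑ l, g (.inl (.inl l)) * I.p (I.perm (tailPos l)) +
      (∑ i : Fin m, g (.inl (.inr i)) * σ.arr 6 i + g (.inr ()) * I.s) := by
  rw [Fin.sum_univ_def, Fin.sum_univ_def]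
  change (Exp.sum _).eval σ + ((Exp.sum _).eval σ + g (.inr ()) * σ.reg 1) = _
  rw [Exp.eval_sum, Exp.eval_sum, henv.s_eq]
  congr 2
  · refine List.map_congr_left fun l _ => ?_
    change _ * (Exp.get 4 (.add (.var 2) (.lit (l.val : ℕ)))).eval σ = _
    rw [henv.get_eq, henv.sorted_eq]
    rfl

theorem Env.cast_formExp_eval (henv : Env m I K σ) {T : Fin m → ℝ}
    (hT : ∀ i : Fin m, (σ.arr 6 i : ℝ) = T i) (g : LPParam m (I.n - K) → ℚ) :
    ((formExp g).eval σ : ℝ) = lin g (lpParam (I.s : ℝ) (fun l => I.sorted (tailPos l)) T) := by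
  rw [henv.formExp_eval]
  push_cast
  simp only [hT, lin, Fintype.sum_sum_type, lpParam, Sum.elim_inl, Sum.elim_inr,
    Finset.univ_unique, Finset.sum_singleton]
  rw [add_assoc]

/-- The weights come from at most `n` processing times of weight 1, `m` loads of weight at most `n`,
and the setup time, each with a coefficient of absolute value at most `c`. -/
theorem Env.adm_formExp (henv : Env m I K σ) (hK : K ≤ I.n)
    (hT : ∀ i : Fin m, Adm I 1 K (σ.arr 6 i)) {d c : ℕ} {g : LPParam m (I.n - K) → ℚ}
    (hg : GoodForm d c g) : Adm I d (c * (I.n + m * I.n + 1)) ((formExp g).eval σ) := by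
  rw [henv.formExp_eval]
  have h1 := Adm.sum (I := I) (d := d) (Finset.univ : Finset (Fin (I.n - K)))
    (f := fun l => g (.inl (.inl l)) * I.p (I.perm (tailPos l))) (w := c * 1)
    fun l _ => (adm_p I _).const_mul (hg _).1 (hg _).2
  have h2 := Adm.sum (I := I) (d := d) (Finset.univ : Finset (Fin m))
    (f := fun i => g (.inl (.inr i)) * σ.arr 6 i) (w := c * K)
    fun i _ => (hT i).const_mul (hg _).1 (hg _).2
  have h3 := (adm_s I).const_mul (hg (.inr ())).1 (hg (.inr ())).2
  refine (h1.add (h2.add h3)).mono ?_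
  simp only [Finset.card_univ, Fintype.card_fin]
  have e1 : (I.n - K) * (c * 1) ≤ I.n * c := by rw [mul_one]; exact Nat.mul_le_mul_right _ (by omega)
  have e2 : m * (c * K) ≤ m * (c * I.n) := Nat.mul_le_mul_left _ (Nat.mul_le_mul_left _ hK)
  nlinarith

end Form

end SplitSched

namespace SplitSched

/-! ### The program: rounds -/

namespace Cmd

/-- One command after the other. -/
def seqs (l : List Cmd) : Cmd := l.foldr .seq .skip

theorem wreg_seqs {l : List Cmd} {v : ℕ} : (seqs l).wreg v ↔ ∃ c ∈ l, c.wreg v := by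
  induction l with
  | nil => simp [seqs, wreg]
  | cons c l ih => simp only [seqs, List.foldr_cons, wreg, List.mem_cons, exists_eq_or_imp] at ih ⊢; rw [ih]

theorem warr_seqs {l : List Cmd} {b : ℕ} : (seqs l).warr b ↔ ∃ c ∈ l, c.warr b := by
  induction l with
  | nil => simp [seqs, warr]
  | cons c l ih => simp only [seqs, List.foldr_cons, warr, List.mem_cons, exists_eq_or_imp] at ih ⊢; rw [ih]

/-- Every command establishes one of a family of properties, and retains the others. -/
theorem wp_seqs {B N : ℕ} {ι : Type*} (c : ι → Cmd) (Inv : State → Prop) (P : ι → State → Prop)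
    (l : List ι) (h : ∀ i, ∀ τ, Inv τ →
      wp B N (c i) (fun ρ => Inv ρ ∧ P i ρ ∧ ∀ j, P j τ → P j ρ) τ) {σ : State} (hσ : Inv σ) :
    wp B N (seqs (l.map c)) (fun τ => Inv τ ∧ (∀ i ∈ l, P i τ) ∧ ∀ j, P j σ → P j τ) σ := by
  induction l generalizing σ with
  | nil => exact ⟨hσ, by simp, fun _ => id⟩
  | cons i l ih =>
    refine wp_mono (c := c i) (h i σ hσ) fun τ hτ => wp_mono (c := seqs (l.map c)) (ih hτ.1) ?_
    rintro ρ ⟨h1, h2, h3⟩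
    refine ⟨h1, fun j hj => ?_, fun j hj => h3 j (hτ.2.2 j hj)⟩
    rcases List.mem_cons.mp hj with rfl | hj
    · exact h3 _ hτ.2.1
    · exact h2 j hj

/-- The command `c` is executed if the values of all expressions are nonnegative. -/
def guard (l : List Exp) (c : Cmd) : Cmd := l.foldr (fun e c' => .ite e (.lit 0) .skip c') c

theorem wp_guard {B N : ℕ} {l : List Exp} {c : Cmd} {Q : State → Prop} {σ : State}
    (hok : ∀ e ∈ l, e.ok σ) (h : (∀ e ∈ l, 0 ≤ e.eval σ) → wp B N c Q σ)
    (h' : (¬ ∀ e ∈ l, 0 ≤ e.eval σ) → Q σ) : wp B N (guard l c) Q σ := by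
  induction l with
  | nil => exact h (by simp)
  | cons e l ih =>
    refine ⟨hok e (by simp), trivial, fun hlt => h' fun hall => ?_, fun hlt => ?_⟩
    · exact absurd hlt (hall e (by simp)).not_gt
    · have he : 0 ≤ e.eval σ := not_lt.mp hlt
      refine ih (fun e' he' => hok e' (by simp [he'])) (fun hall => h ?_) (fun hall => h' ?_)
      · simpa [he] using hall
      · simpa [he] using hall

theorem wreg_guard {l : List Exp} {c : Cmd} {v : ℕ} : (guard l c).wreg v ↔ c.wreg v := by
  induction l with
  | nil => rfl
  | cons e l ih => simp only [guard, List.foldr_cons, wreg, false_or] at ih ⊢; rw [ih]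

theorem warr_guard {l : List Exp} {c : Cmd} {b : ℕ} : (guard l c).warr b ↔ c.warr b := by
  induction l with
  | nil => rfl
  | cons e l ih => simp only [guard, List.foldr_cons, warr, false_or] at ih ⊢; rw [ih]

/-- The command `c (n - K)`, where `n` and `K` are the values of the variables `0` and `2`,
provided that `n - K ≤ k`. -/
def cases (c : ℕ → Cmd) : ℕ → Cmd
  | 0 => c 0
  -- The type of a candidate depends on the number of remaining jobs, so there is separate code for
  -- each number. The test `K + k < n` selects the case `k + 1`; larger numbers have been excluded
  -- before.
  | k + 1 => .ite (.add (.var 2) (.lit (k : ℕ))) (.var 0) (c (k + 1)) (cases c k)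

theorem wp_cases {B N : ℕ} {c : ℕ → Cmd} {Q : State → Prop} {σ : State} {n K : ℕ}
    (h0 : σ.reg 0 = n) (h2 : σ.reg 2 = K) {k : ℕ} (hk : n - K ≤ k) (h : wp B N (c (n - K)) Q σ) :
    wp B N (cases c k) Q σ := by
  induction k with
  | zero => rwa [Nat.le_zero.mp hk] at h
  | succ k ih =>
    refine ⟨⟨trivial, trivial⟩, trivial, fun hlt => ?_, fun hlt => ?_⟩
    · simp only [Exp.eval, h0, h2] at hlt
      have : K + k < n := by exact_mod_cast hlt
      rwa [show n - K = k + 1 by omega] at h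
    · simp only [Exp.eval, h0, h2] at hlt
      have : ¬ K + k < n := by exact_mod_cast hlt
      exact ih (by omega)

theorem wreg_cases {c : ℕ → Cmd} {k v : ℕ} (h : (cases c k).wreg v) : ∃ i ≤ k, (c i).wreg v := by
  induction k with
  | zero => exact ⟨0, le_rfl, h⟩
  | succ k ih =>
    rcases h with h | h
    · exact ⟨_, le_rfl, h⟩
    · obtain ⟨i, hi, h⟩ := ih h
      exact ⟨i, by omega, h⟩

theorem warr_cases {c : ℕ → Cmd} {k b : ℕ} (h : (cases c k).warr b) : ∃ i ≤ k, (c i).warr b := by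
  induction k with
  | zero => exact ⟨0, le_rfl, h⟩
  | succ k ih =>
    rcases h with h | h
    · exact ⟨_, le_rfl, h⟩
    · obtain ⟨i, hi, h⟩ := ih h
      exact ⟨i, by omega, h⟩

end Cmd

theorem cell_injective {m n : ℕ} {j j' : Fin n} {i i' : Fin m}
    (h : j.val * m + i.val = j'.val * m + i'.val) : j = j' ∧ i = i' := by
  have hm : 0 < m := i.pos
  have h1 : j.val = j'.val := by
    have := congrArg (· / m) h
    simpa [Nat.add_div_of_dvd_right, Nat.mul_div_cancel _ hm, Nat.div_eq_of_lt i.2,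
      Nat.div_eq_of_lt i'.2] using this
  have h2 : i.val = i'.val := by rw [h1] at h; omega
  exact ⟨Fin.ext h1, Fin.ext h2⟩

/-- The address of the part of the job in position `e` on machine `e'`. -/
def cellExp (m : ℕ) (e e' : Exp) : Exp := .add (.mul (.get 3 e) (.lit (m : ℕ))) e'

/-- The parts of the list scheduled jobs. -/
def writeHeadCmd (m : ℕ) : Cmd :=
  -- The whole row is cleared first, because it may still contain the schedule of an earlier round.
  .cfor 11 2 (.seq (.cfor 12 16 (.put 1 (cellExp m (.var 11) (.var 12)) (.lit 0)))
    (.put 1 (cellExp m (.var 11) (.get 5 (.var 11))) (.get 4 (.var 11))))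

open Classical in
/-- The parts of the other jobs, according to a candidate. -/
noncomputable def writeTailCmd {m N : ℕ} (κ : Candidate m N) : Cmd :=
  Cmd.seqs ((List.finRange N ×ˢ List.finRange m).map fun p =>
    .put 1 (cellExp m (.add (.var 2) (.lit (p.1.val : ℕ))) (.lit (p.2.val : ℕ)))
      (if p.2 ∈ κ.M p.1 then formExp (κ.x p.1 p.2) else .lit 0))

section Commands

variable {m : ℕ} {I : Instance} {d A W B N K : ℕ}

/-- The parts of the job in position `h` are stored in array `1`. -/
def Row (I : Instance) (m : ℕ) (Y : Fin I.n → Fin m → ℚ) (h : Fin I.n) (τ : State) : Prop :=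
  ∀ i : Fin m, τ.arr 1 ((I.perm h).val * m + i.val) = Y h i

theorem wp_writeHeadCmd (F : Fits m I d A W B N) (hK : K ≤ I.n) {σ : State} (henv : Env m I K σ)
    {t : Fin m → ℝ} {f : Fin I.n → Fin m} (hf : ListState I t f K σ) :
    Cmd.wp B N (writeHeadCmd m) (fun τ => ∀ h : Fin I.n, h.val < K →
      Row I m (fun h i => if f h = i then I.p (I.perm h) else 0) h τ) σ := by
  refine Cmd.wp_cfor (by decide) (by simp [Cmd.wreg]) (by simp [Cmd.wreg]) K henv.K_eq
    (by have := F.le_loop; omega) (fun k τ => ∀ h : Fin I.n, h.val < k →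
      Row I m (fun h i => if f h = i then I.p (I.perm h) else 0) h τ)
    (fun h hh => absurd hh (Nat.not_lt_zero _)) ?_ (fun τ hτ _ => hτ)
  intro k hk τ hτ hag
  let kF : Fin I.n := ⟨k, by omega⟩
  have e3 : τ.arr 3 k = (I.perm kF).val := by
    rw [hag.2 3 (by simp [Cmd.warr])]; exact henv.perm_eq kF
  have e4 : τ.arr 4 = σ.arr 4 := hag.2 4 (by simp [Cmd.warr])
  have e5 : τ.arr 5 = σ.arr 5 := hag.2 5 (by simp [Cmd.warr])
  have e16 : τ.reg 16 = m := by rw [hag.1 16 (by simp [Cmd.wreg]), henv.m_eq]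
  clear hag
  have hkeep : ∀ (ρ : State) (i : Fin m) (x : ℚ), (∀ h : Fin I.n, h.val < k →
      Row I m (fun h i => if f h = i then I.p (I.perm h) else 0) h ρ) →
      ∀ h : Fin I.n, h.val < k → Row I m (fun h i => if f h = i then I.p (I.perm h) else 0) h
        (ρ.setArr 1 ((I.perm kF).val * m + i.val) x) := by
    intro ρ i x hρ h hh i'
    rw [State.setArr_arr, if_neg]
    · exact hρ h hh i'
    · rintro ⟨-, e⟩
      have := (cell_injective e).1
      rw [I.perm.injective this] at hh
      exact lt_irrefl _ hh
  refine Cmd.wp_seq (R := fun ρ => (∀ h : Fin I.n, h.val < k →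
      Row I m (fun h i => if f h = i then I.p (I.perm h) else 0) h ρ) ∧
      ∀ i : Fin m, ρ.arr 1 ((I.perm kF).val * m + i.val) = 0) ?_ ?_
  · refine Cmd.wp_cfor (by decide) (by simp [Cmd.wreg]) (by simp [Cmd.wreg]) m (by simp [e16])
      (by have := F.le_loop; omega) (fun i ρ => (∀ h : Fin I.n, h.val < k →
        Row I m (fun h i => if f h = i then I.p (I.perm h) else 0) h ρ) ∧
        ∀ i' : Fin m, i'.val < i → ρ.arr 1 ((I.perm kF).val * m + i'.val) = 0)
      ⟨hτ, fun i hi => absurd hi (Nat.not_lt_zero _)⟩ ?_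
      (fun ρ hρ _ => ⟨hρ.1, fun i => hρ.2 i i.2⟩)
    intro i hi ρ hρ hag
    have e3' : ρ.arr 3 k = (I.perm kF).val := by rw [hag.2 3 (by simp [Cmd.warr])]; exact e3
    have e11 : ρ.reg 11 = k := by rw [hag.1 11 (by simp [Cmd.wreg])]; simp
    refine ⟨⟨⟨⟨trivial, k, by simp [Exp.eval, e11]⟩, trivial⟩, trivial⟩, trivial,
      (I.perm kF).val * m + i, ?_, F.zero, ?_⟩
    · simp [cellExp, Exp.eval, e11, e3']
    · refine ⟨hkeep _ ⟨i, hi⟩ _ hρ.1, fun i' hi' => ?_⟩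
      rw [State.setArr_arr]
      split_ifs with h
      · rfl
      · refine hρ.2 i' ?_
        simp only [true_and, Nat.add_left_cancel_iff] at h
        omega
  · intro ρ hρ hag
    have e3' : ρ.arr 3 k = (I.perm kF).val := by rw [hag.2 3 (by simp [Cmd.warr])]; exact e3
    have e4' : ρ.arr 4 k = I.p (I.perm kF) := by
      rw [hag.2 4 (by simp [Cmd.warr])]
      exact (congrFun e4 k).trans (henv.sorted_eq kF)
    have e5' : ρ.arr 5 k = ((f kF).val : ℚ) := by
      rw [hag.2 5 (by simp [Cmd.warr])]
      exact (congrFun e5 k).trans (hf.job_eq kF hk)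
    have e11 : ρ.reg 11 = k := by rw [hag.1 11 (by simp [Cmd.wreg])]; simp
    refine ⟨⟨⟨⟨trivial, k, by simp [Exp.eval, e11]⟩, trivial⟩, trivial, k, by simp [Exp.eval, e11]⟩,
      ⟨trivial, k, by simp [Exp.eval, e11]⟩, (I.perm kF).val * m + (f kF).val, ?_, ?_, ?_⟩
    · simp [cellExp, Exp.eval, e11, e3', e5']
    · simp only [Exp.eval, e11, Nat.floor_natCast, e4']
      exact F.adm (adm_p I _) (by have := F.le_weight; omega)
    · intro h hh
      rcases Nat.lt_succ_iff_lt_or_eq.mp hh with hlt | he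
      · exact hkeep _ _ _ hρ.1 h hlt
      · obtain rfl : h = kF := Fin.ext he
        intro i
        simp only [Exp.eval, e11, Nat.floor_natCast, e4', State.setArr_arr, true_and,
          Nat.add_left_cancel_iff]
        by_cases e : f kF = i
        · simp [e]
        · have : ¬ i.val = (f kF).val := fun e' => e (Fin.ext e'.symm)
          simpa [e, this] using hρ.2 i

-- The forms read only variables and the arrays `4` and `6`, so writing to array `1` does not change
-- their values. Distinct pairs of job and machine have distinct cells, so earlier entries persist.
open Classical in
theorem wp_writeTailCmd (F : Fits m I d A W B N) (hK : K ≤ I.n) {σ : State} (henv : Env m I K σ)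
    (hT : ∀ i : Fin m, Adm I 1 K (σ.arr 6 i)) {c : ℕ} (hA : c * (I.n + m * I.n + 1) ≤ W)
    {κ : Candidate m (I.n - K)} (hκ : κ.Good d c) :
    Cmd.wp B N (writeTailCmd κ) (fun τ => (∀ (l : Fin (I.n - K)) (i : Fin m),
        τ.arr 1 ((I.perm (tailPos l)).val * m + i.val) =
          if i ∈ κ.M l then (formExp (κ.x l i)).eval σ else 0) ∧
      ∀ (h : Fin I.n) (i : Fin m), h.val < K →
        τ.arr 1 ((I.perm h).val * m + i.val) = σ.arr 1 ((I.perm h).val * m + i.val)) σ := by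
  let Y : Fin (I.n - K) × Fin m → ℚ := fun p =>
    if p.2 ∈ κ.M p.1 then (formExp (κ.x p.1 p.2)).eval σ else 0
  refine Cmd.wp_mono (c := writeTailCmd κ) (Cmd.wp_seqs _
    (fun τ => (Env m I K τ ∧ τ.arr 6 = σ.arr 6) ∧ ∀ (h : Fin I.n) (i : Fin m), h.val < K →
        τ.arr 1 ((I.perm h).val * m + i.val) = σ.arr 1 ((I.perm h).val * m + i.val))
    (fun p τ => τ.arr 1 ((I.perm (tailPos p.1)).val * m + p.2.val) = Y p) _ ?_
    ⟨⟨henv, rfl⟩, fun _ _ _ => rfl⟩) ?_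
  · rintro p τ ⟨⟨hτ, h6⟩, hhead⟩
    have hev : (if p.2 ∈ κ.M p.1 then formExp (κ.x p.1 p.2) else .lit 0).eval τ = Y p := by
      simp only [Y]
      split_ifs
      · rw [hτ.formExp_eval, henv.formExp_eval, h6]
      · rfl
    refine ⟨⟨⟨hτ.get_ok 3 _, trivial⟩, trivial⟩, ?_, (I.perm (tailPos p.1)).val * m + p.2.val, ?_,
      ?_, ⟨⟨⟨hτ.n_eq, hτ.s_eq, hτ.K_eq, hτ.grid_eq, hτ.m_eq, hτ.succ_eq, fun h => ?_, fun h => ?_⟩,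
        ?_⟩, fun h i hh => ?_⟩, ?_, fun q hq => ?_⟩
    · split_ifs
      · exact hτ.formExp_ok _
      · trivial
    · simp only [cellExp]
      change (Exp.get 3 (.add (.var 2) (.lit (p.1.val : ℕ)))).eval τ * m + p.2.val = _
      rw [hτ.get_eq, hτ.perm_eq]
      push_cast; rfl
    · rw [hev]
      simp only [Y]
      split_ifs
      · exact F.bitLength_le _ ((henv.adm_formExp hK hT (hκ.1 _ _)).mono hA)
      · exact F.zero
    · simpa using hτ.perm_eq h
    · simpa using hτ.sorted_eq h
    · funext k; simp [h6]
    · rw [State.setArr_arr, if_neg, hhead h i hh]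
      rintro ⟨-, e⟩
      have := congrArg Fin.val (I.perm.injective (cell_injective e).1)
      simp only [tailPos] at this
      omega
    · simp [hev]
    · rw [State.setArr_arr, hev]
      split_ifs with h
      · obtain ⟨e1, e2⟩ := cell_injective h.2
        have e3 := congrArg Fin.val (I.perm.injective e1)
        simp only [tailPos, Nat.add_left_cancel_iff] at e3
        congr 1
        exact Prod.ext (Fin.ext e3.symm) e2.symm
      · exact hq
  · rintro τ ⟨⟨-, h1⟩, h2, -⟩
    exact ⟨fun l i => h2 (l, i) (by simp [List.mem_product, List.mem_finRange]), h1⟩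

end Commands

end SplitSched

/-! ### The program: candidates and rounds -/

namespace SplitSched

/-- The candidate becomes the best round so far. -/
noncomputable def storeCmd {m N : ℕ} (κ : Candidate m N) : Cmd :=
  .seq (.set 4 (.var 18)) (.seq (.set 5 (.lit 1)) (.seq (writeHeadCmd m) (writeTailCmd κ)))

/-- The candidate is tried, if it is feasible. -/
noncomputable def candidateCmd {m N : ℕ} (κ : Candidate m N) : Cmd :=
  .guard (κ.checks.map formExp) (.seq (.set 18 (.add (.var 10) (formExp (∑ l, κ.C l))))
    (.ite (.var 5) (.lit 1) (storeCmd κ) (.ite (.var 18) (.var 4) (storeCmd κ) .skip)))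

/-- All rounds with the guessed loads given by array `7`. -/
noncomputable def roundCmd {m : ℕ} (Z : ∀ N, List (Candidate m N)) (R : ℕ) : Cmd :=
  .seq listCmd (.ite (.var 9) (.lit 1) .skip
    (.cases (fun N => .seqs ((Z N).map candidateCmd)) R))

theorem wreg_storeCmd {m N : ℕ} {κ : Candidate m N} {v : ℕ} (h : (storeCmd κ).wreg v) :
    v = 4 ∨ v = 5 ∨ v = 11 ∨ v = 12 := by
  simp only [storeCmd, writeHeadCmd, writeTailCmd, Cmd.wreg, Cmd.wreg_seqs, List.mem_map] at h
  rcases h with h | h | (h | (h | h) | h) | ⟨c, ⟨p, -, rfl⟩, h⟩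
  · exact .inl h
  · exact .inr (.inl h)
  · exact .inr (.inr (.inl h))
  · exact .inr (.inr (.inr h))
  · exact h.elim
  · exact h.elim
  · exact h.elim

theorem warr_storeCmd {m N : ℕ} {κ : Candidate m N} {b : ℕ} (h : (storeCmd κ).warr b) : b = 1 := by
  simp only [storeCmd, writeHeadCmd, writeTailCmd, Cmd.warr, Cmd.warr_seqs, List.mem_map,
    false_or] at h
  rcases h with (h | h) | ⟨c, ⟨p, -, rfl⟩, h⟩
  · exact h
  · exact h
  · exact h

theorem wreg_candidateCmd {m N : ℕ} {κ : Candidate m N} {v : ℕ} (h : (candidateCmd κ).wreg v) :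
    v = 4 ∨ v = 5 ∨ v = 11 ∨ v = 12 ∨ v = 18 := by
  rw [candidateCmd, Cmd.wreg_guard] at h
  rcases h with h | h | h | h
  · exact .inr (.inr (.inr (.inr h)))
  · have := wreg_storeCmd h; omega
  · have := wreg_storeCmd h; omega
  · exact h.elim

theorem warr_candidateCmd {m N : ℕ} {κ : Candidate m N} {b : ℕ} (h : (candidateCmd κ).warr b) :
    b = 1 := by
  rw [candidateCmd, Cmd.warr_guard] at h
  rcases h with h | h | h | h
  · exact h.elim
  · exact warr_storeCmd h
  · exact warr_storeCmd h
  · exact h.elim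

theorem wreg_roundCmd {m : ℕ} {Z : ∀ N, List (Candidate m N)} {R v : ℕ}
    (h : (roundCmd Z R).wreg v) : (4 ≤ v ∧ v ≤ 15) ∨ v = 18 := by
  rcases h with h | h | h
  · simp only [listCmd, selectCmd, Cmd.wreg, or_false, false_or] at h
    omega
  · exact h.elim
  · obtain ⟨N, -, h⟩ := Cmd.wreg_cases h
    rw [Cmd.wreg_seqs] at h
    obtain ⟨c, hc, h⟩ := h
    obtain ⟨κ, -, rfl⟩ := List.mem_map.mp hc
    have := wreg_candidateCmd h
    omega

theorem warr_roundCmd {m : ℕ} {Z : ∀ N, List (Candidate m N)} {R b : ℕ}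
    (h : (roundCmd Z R).warr b) : b = 1 ∨ b = 5 ∨ b = 6 := by
  rcases h with h | h | h
  · simp only [listCmd, selectCmd, Cmd.warr, false_or, or_false] at h
    omega
  · exact h.elim
  · obtain ⟨N, -, h⟩ := Cmd.warr_cases h
    rw [Cmd.warr_seqs] at h
    obtain ⟨c, hc, h⟩ := h
    obtain ⟨κ, -, rfl⟩ := List.mem_map.mp hc
    exact .inl (warr_candidateCmd h)

/-- A round, up to the optimality of the solution of the linear program, whose schedule is stored
in array `1` and whose value is stored in variable `4`. -/
structure RoundState {m : ℕ} (I : Instance) (d A K : ℕ) (r : Round m I.n) (τ : State) : Prop where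
  guess_le : ∀ i, r.a i ≤ K
  list : IsListSchedule I.s I.sorted K (fun i => r.a i * gridStep I.s I.sorted K) r.f
  lp : LPFeasible I.s I.sorted K (listLoad I.s I.sorted r.f K) r.M r.x r.C
  amount_eq : ∀ (h : Fin I.n) (i : Fin m),
    (τ.arr 1 ((I.perm h).val * m + i.val) : ℝ) = r.amount I.sorted K h i
  amount_adm : ∀ (h : Fin I.n) (i : Fin m), Adm I d A (τ.arr 1 ((I.perm h).val * m + i.val))
  value_eq : (τ.reg 4 : ℝ) = r.value I.s I.sorted K

/-- A round has been stored whose value is at most the numbers in `V`; initially, there is no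
round, and `V` is empty. -/
def BestState (m : ℕ) (I : Instance) (d A K : ℕ) (V : Set ℝ) (τ : State) : Prop :=
  (τ.reg 5 = 0 ∧ V = ∅) ∨
    (τ.reg 5 = 1 ∧ ∃ r : Round m I.n, RoundState I d A K r τ ∧ ∀ v ∈ V, r.value I.s I.sorted K ≤ v)

section States

variable {m : ℕ} {I : Instance} {d A K : ℕ} {V V' : Set ℝ} {σ τ : State}

/-- Only lower bounds for the values in `V` matter, so the value of a valid round may be replaced by
that of a candidate that is not worse. If no round is stored, the hypothesis forces the new set to
be empty, too. -/
theorem BestState.mono (h : BestState m I d A K V τ) (hV : ∀ v' ∈ V', ∃ v ∈ V, v ≤ v') :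
    BestState m I d A K V' τ := by
  rcases h with ⟨h, rfl⟩ | ⟨h, r, hr, hv⟩
  · refine .inl ⟨h, Set.eq_empty_iff_forall_notMem.mpr fun v' hv' => ?_⟩
    obtain ⟨v, hv, -⟩ := hV v' hv'
    exact hv
  · refine .inr ⟨h, r, hr, fun v' hv' => ?_⟩
    obtain ⟨v, hv', hle⟩ := hV v' hv'
    exact (hv v hv').trans hle

theorem RoundState.congr {r : Round m I.n} (h : RoundState I d A K r σ) (h4 : τ.reg 4 = σ.reg 4)
    (h1 : τ.arr 1 = σ.arr 1) : RoundState I d A K r τ :=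
  ⟨h.guess_le, h.list, h.lp, by rw [h1]; exact h.amount_eq, by rw [h1]; exact h.amount_adm,
    by rw [h4]; exact h.value_eq⟩

theorem BestState.congr (h : BestState m I d A K V σ) (h4 : τ.reg 4 = σ.reg 4)
    (h5 : τ.reg 5 = σ.reg 5) (h1 : τ.arr 1 = σ.arr 1) : BestState m I d A K V τ := by
  rcases h with ⟨h, hV⟩ | ⟨h, r, hr, hv⟩
  · exact .inl ⟨by rw [h5, h], hV⟩
  · exact .inr ⟨by rw [h5, h], r, hr.congr h4 h1, hv⟩

theorem ListState.congr {t : Fin m → ℝ} {f : Fin I.n → Fin m} {h : ℕ}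
    (H : ListState I t f h σ) (h10 : τ.reg 10 = σ.reg 10) (h5 : τ.arr 5 = σ.arr 5)
    (h6 : τ.arr 6 = σ.arr 6) : ListState I t f h τ :=
  ⟨H.list, by rw [h5]; exact H.job_eq, by rw [h6]; exact H.load_eq,
    by rw [h6]; exact H.load_adm, by rw [h10]; exact H.value_eq,
    by rw [h10]; exact H.value_adm⟩

end States

/-- The round of a candidate. -/
noncomputable def candidateRound {m : ℕ} (I : Instance) {K : ℕ} (a : Fin m → ℕ)
    (f : Fin I.n → Fin m) (κ : Candidate m (I.n - K)) : Round m I.n where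
  a := a
  f := f
  M := extendTail ∅ κ.M
  x := extendTail (fun _ => 0) fun l i => lin (κ.x l i)
    (lpParam (I.s : ℝ) (fun l => I.sorted (tailPos l)) (listLoad I.s I.sorted f K))
  C := extendTail 0 fun l => lin (κ.C l)
    (lpParam (I.s : ℝ) (fun l => I.sorted (tailPos l)) (listLoad I.s I.sorted f K))

section Commands

variable {m : ℕ} {I : Instance} {d A W B N K : ℕ} {σ : State} {V : Set ℝ}

/-- The value of the round of a candidate, if it is feasible. -/
def candidateValues {m : ℕ} (I : Instance) {K : ℕ} (a : Fin m → ℕ) (f : Fin I.n → Fin m)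
    (κ : Candidate m (I.n - K)) : Set ℝ :=
  {v | LPFeasible I.s I.sorted K (listLoad I.s I.sorted f K) (candidateRound I a f κ).M
    (candidateRound I a f κ).x (candidateRound I a f κ).C ∧
    v = (candidateRound I a f κ).value I.s I.sorted K}

theorem value_candidateRound (a : Fin m → ℕ) (f : Fin I.n → Fin m) (κ : Candidate m (I.n - K)) :
    (candidateRound I a f κ).value I.s I.sorted K =
      ∑ h with h.val < K, listLoad I.s I.sorted f (h.val + 1) (f h) + lin (∑ l, κ.C l)
        (lpParam (I.s : ℝ) (fun l => I.sorted (tailPos l)) (listLoad I.s I.sorted f K)) := by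
  rw [Round.value, lpValue_tail, lin_sum]
  simp only [candidateRound, extendTail_tailPos, lpValue, Nat.zero_le, Finset.filter_true]

theorem lpFeasible_candidateRound (a : Fin m → ℕ) (f : Fin I.n → Fin m)
    (κ : Candidate m (I.n - K)) : LPFeasible I.s I.sorted K (listLoad I.s I.sorted f K)
      (candidateRound I a f κ).M (candidateRound I a f κ).x (candidateRound I a f κ).C ↔
    LPFeasible (I.s : ℝ) (fun l => I.sorted (tailPos l)) 0 (listLoad I.s I.sorted f K) κ.M
      (fun l i => lin (κ.x l i)
        (lpParam (I.s : ℝ) (fun l => I.sorted (tailPos l)) (listLoad I.s I.sorted f K)))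
      (fun l => lin (κ.C l)
        (lpParam (I.s : ℝ) (fun l => I.sorted (tailPos l)) (listLoad I.s I.sorted f K))) := by
  rw [lpFeasible_tail]
  simp only [candidateRound, extendTail_tailPos]

theorem wp_storeCmd (F : Fits m I d A W B N) (hK : K ≤ I.n) (henv : Env m I K σ) {a : Fin m → ℕ}
    (ha : ∀ i, a i ≤ K) {f : Fin I.n → Fin m}
    (hf : ListState I (fun i => a i * gridStep I.s I.sorted K) f K σ) {c : ℕ}
    (hA : c * (I.n + m * I.n + 1) + 1 ≤ A) {κ : Candidate m (I.n - K)} (hκ : κ.Good d c)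
    (hfeas : LPFeasible I.s I.sorted K (listLoad I.s I.sorted f K) (candidateRound I a f κ).M
      (candidateRound I a f κ).x (candidateRound I a f κ).C)
    (h18 : (σ.reg 18 : ℝ) = (candidateRound I a f κ).value I.s I.sorted K)
    (hB : bitLength (σ.reg 18) ≤ B) :
    Cmd.wp B N (storeCmd κ)
      (fun τ => τ.reg 5 = 1 ∧ RoundState I d A K (candidateRound I a f κ) τ) σ := by
  refine ⟨trivial, hB, trivial, F.one, ?_⟩
  have henv' : Env m I K ((σ.setReg 4 (σ.reg 18)).setReg 5 1) :=
    (henv.setReg (by decide) _).setReg (by decide) _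
  have hf' : ListState I (fun i => a i * gridStep I.s I.sorted K) f K
      ((σ.setReg 4 (σ.reg 18)).setReg 5 1) := hf.congr (by simp) rfl rfl
  refine Cmd.wp_seq (wp_writeHeadCmd F hK henv' hf') fun τ hτ hag => ?_
  have henvτ : Env m I K τ := henv'.of_agree
    ⟨fun v hv => by simp only [Cmd.wreg, writeHeadCmd, or_false]; omega,
      fun b hb => by simp only [Cmd.warr, writeHeadCmd]; omega⟩ hag
  have h6τ : τ.arr 6 = σ.arr 6 := hag.2 6 (by simp [Cmd.warr, writeHeadCmd])
  have h4τ : τ.reg 4 = σ.reg 18 := by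
    rw [hag.1 4 (by simp [Cmd.wreg, writeHeadCmd])]; simp [Exp.eval]
  have h5τ : τ.reg 5 = 1 := by
    rw [hag.1 5 (by simp [Cmd.wreg, writeHeadCmd])]; simp [Exp.eval]
  clear hag
  have hadm6 : ∀ i : Fin m, Adm I 1 K (τ.arr 6 i) := by rw [h6τ]; exact hf.load_adm
  refine Cmd.wp_mono (c := writeTailCmd κ) (Cmd.wp_frame (wp_writeTailCmd F hK henvτ hadm6 (c := c)
    (by have := F.value_le_weight; omega) hκ)) ?_
  rintro ρ ⟨⟨h1, h2⟩, hag⟩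
  have hreg : ∀ v, ρ.reg v = τ.reg v := fun v => hag.1 v (by
    rw [writeTailCmd, Cmd.wreg_seqs]
    rintro ⟨c, hc, h⟩
    obtain ⟨p, -, rfl⟩ := List.mem_map.mp hc
    exact h)
  have hT : ∀ i : Fin m, (τ.arr 6 i : ℝ) = listLoad I.s I.sorted f K i := by
    rw [h6τ]; exact hf.load_eq
  refine ⟨by rw [hreg, h5τ], ha, hf.list, hfeas, fun h i => ?_, fun h i => ?_, by rw [hreg, h4τ, h18]⟩
  · by_cases hh : h.val < K
    · rw [h2 h i hh, hτ h hh i, Round.amount, if_pos hh]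
      change ((if f h = i then _ else _ : ℚ) : ℝ) = if f h = i then _ else _
      split_ifs <;> simp
    · obtain ⟨l, rfl⟩ := exists_tailPos (not_lt.mp hh)
      rw [h1, Round.amount, if_neg hh]
      simp only [candidateRound, extendTail_tailPos]
      split_ifs
      · exact henvτ.cast_formExp_eval hT _
      · simp
  · by_cases hh : h.val < K
    · rw [h2 h i hh, hτ h hh i]
      beta_reduce
      split_ifs
      · exact (adm_p I _).of_one.mono (by omega)
      · exact Adm.zero
    · obtain ⟨l, rfl⟩ := exists_tailPos (not_lt.mp hh)
      rw [h1]
      split_ifs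
      · exact (henvτ.adm_formExp hK hadm6 (hκ.1 _ _)).mono (by omega)
      · exact Adm.zero

theorem wp_candidateCmd (F : Fits m I d A W B N) (hK : K ≤ I.n) (henv : Env m I K σ)
    {a : Fin m → ℕ} (ha : ∀ i, a i ≤ K) {f : Fin I.n → Fin m}
    (hf : ListState I (fun i => a i * gridStep I.s I.sorted K) f K σ) {c : ℕ}
    (hA : c * (I.n + m * I.n + 1) + 1 ≤ A) {κ : Candidate m (I.n - K)} (hκ : κ.Good d c)
    (hs : κ.Sound) (hb : BestState m I d A K V σ) :
    Cmd.wp B N (candidateCmd κ) (BestState m I d A K (V ∪ candidateValues I a f κ)) σ := by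
  have hiff : (∀ e ∈ κ.checks.map formExp, 0 ≤ e.eval σ) ↔
      LPFeasible I.s I.sorted K (listLoad I.s I.sorted f K) (candidateRound I a f κ).M
        (candidateRound I a f κ).x (candidateRound I a f κ).C := by
    rw [lpFeasible_candidateRound, ← hs]
    simp only [List.forall_mem_map, ← henv.cast_formExp_eval hf.load_eq, Rat.cast_nonneg]
  refine Cmd.wp_guard ?_ (fun h => ?_) (fun h => ?_)
  · intro e he
    obtain ⟨g, -, rfl⟩ := List.mem_map.mp he
    exact henv.formExp_ok g
  · rw [hiff] at h
    have hval : ((σ.reg 10 + (formExp (∑ l, κ.C l)).eval σ : ℚ) : ℝ) =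
        (candidateRound I a f κ).value I.s I.sorted K := by
      rw [value_candidateRound]
      push_cast
      rw [henv.cast_formExp_eval hf.load_eq, hf.value_eq]
    have hBv : bitLength (σ.reg 10 + (formExp (∑ l, κ.C l)).eval σ) ≤ B := by
      refine F.bitLength_le _ ((hf.value_adm.of_one.add
        (henv.adm_formExp hK hf.load_adm hκ.2)).mono ?_)
      have := F.value_le_weight
      have : K * I.n ≤ I.n * I.n := Nat.mul_le_mul_right _ hK
      omega
    refine ⟨⟨trivial, henv.formExp_ok _⟩, hBv, ?_⟩
    set ρ := σ.setReg 18 ((Exp.add (.var 10) (formExp (∑ l, κ.C l))).eval σ) with hρ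
    have h18 : ρ.reg 18 = σ.reg 10 + (formExp (∑ l, κ.C l)).eval σ := by
      rw [hρ, State.setReg_reg, if_pos rfl]; rfl
    have hstore := wp_storeCmd F hK (σ := ρ) (henv.setReg (by decide) _) ha
      (hf.congr (by simp [hρ]) rfl rfl) hA hκ h (by rw [h18, hval]) (by rw [h18]; exact hBv)
    have hbρ : BestState m I d A K V ρ := hb.congr (by simp [hρ]) (by simp [hρ]) rfl
    clear_value ρ
    refine ⟨trivial, trivial, fun h5 => ?_, fun h5 => ⟨trivial, trivial, fun h4 => ?_, fun h4 => ?_⟩⟩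
    · refine Cmd.wp_mono hstore fun τ hτ => .inr ⟨hτ.1, _, hτ.2, ?_⟩
      rcases hbρ with ⟨-, rfl⟩ | ⟨h5', -⟩
      · rintro v (hv | hv)
        · exact hv.elim
        · exact hv.2.ge
      · simp [Exp.eval, h5'] at h5
    · refine Cmd.wp_mono hstore fun τ hτ => .inr ⟨hτ.1, _, hτ.2, ?_⟩
      rcases hbρ with ⟨h5', -⟩ | ⟨-, r, hr, hv⟩
      · simp [Exp.eval, h5'] at h5
      · simp only [Exp.eval, h18] at h4
        have h4' : ((σ.reg 10 + (formExp (∑ l, κ.C l)).eval σ : ℚ) : ℝ) < ρ.reg 4 := by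
          exact_mod_cast h4
        rw [hval, hr.value_eq] at h4'
        rintro v (hv' | hv')
        · exact h4'.le.trans (hv v hv')
        · exact hv'.2.ge
    · rcases hbρ with ⟨h5', -⟩ | ⟨h5', r, hr, hv⟩
      · simp [Exp.eval, h5'] at h5
      · simp only [Exp.eval, h18] at h4
        have h4' : (ρ.reg 4 : ℝ) ≤ ((σ.reg 10 + (formExp (∑ l, κ.C l)).eval σ : ℚ) : ℝ) := by
          exact_mod_cast not_lt.mp h4
        rw [hval, hr.value_eq] at h4'
        refine .inr ⟨h5', r, hr, ?_⟩
        rintro v (hv' | hv')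
        · exact hv v hv'
        · rw [hv'.2]; exact h4'
  · refine hb.mono ?_
    rintro v (hv | hv)
    · exact ⟨v, hv, le_rfl⟩
    · exact absurd (hiff.mpr hv.1) h

theorem wp_candidates (F : Fits m I d A W B N) (hK : K ≤ I.n) {a : Fin m → ℕ} (ha : ∀ i, a i ≤ K)
    {f : Fin I.n → Fin m} {c : ℕ} (hA : c * (I.n + m * I.n + 1) + 1 ≤ A)
    (l : List (Candidate m (I.n - K))) (hl : ∀ κ ∈ l, κ.Good d c ∧ κ.Sound) (henv : Env m I K σ)
    (hf : ListState I (fun i => a i * gridStep I.s I.sorted K) f K σ)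
    (hb : BestState m I d A K V σ) :
    Cmd.wp B N (.seqs (l.map candidateCmd))
      (BestState m I d A K (V ∪ {v | ∃ κ ∈ l, v ∈ candidateValues I a f κ})) σ := by
  induction l generalizing σ V with
  | nil =>
    refine hb.mono fun v hv => ⟨v, ?_, le_rfl⟩
    rcases hv with hv | ⟨κ, hκ, -⟩
    · exact hv
    · exact absurd hκ List.not_mem_nil
  | cons κ l ih =>
    obtain ⟨hg, hs⟩ := hl κ (by simp)
    refine Cmd.wp_seq (wp_candidateCmd F hK henv ha hf hA hg hs hb) fun τ hτ hag => ?_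
    have hr : ∀ v, 4 ≤ v → v ≠ 4 → v ≠ 5 → v ≠ 11 → v ≠ 12 → v ≠ 18 → τ.reg v = σ.reg v :=
      fun v _ _ _ _ _ _ => hag.1 v fun hv => by have := wreg_candidateCmd hv; omega
    have hra : ∀ b, b ≠ 1 → τ.arr b = σ.arr b := fun b hb => hag.2 b fun h => hb (warr_candidateCmd h)
    refine Cmd.wp_mono (ih (fun κ' hκ' => hl κ' (by simp [hκ'])) (henv.of_agree
      ⟨fun v hv h => by have := wreg_candidateCmd h; omega,
        fun b hb h => by have := warr_candidateCmd h; omega⟩ hag)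
      (hf.congr (hr 10 (by decide) (by decide) (by decide) (by decide) (by decide) (by decide))
        (hra 5 (by decide)) (hra 6 (by decide))) hτ) fun ρ hρ => hρ.mono fun v hv => ⟨v, ?_, le_rfl⟩
    rcases hv with hv | ⟨κ', hκ', hv⟩
    · exact .inl (.inl hv)
    · rcases List.mem_cons.mp hκ' with rfl | hκ'
      · exact .inl (.inr hv)
      · exact .inr ⟨κ', hκ', hv⟩

/-- A choice of candidates for all numbers of jobs. -/
def CandidateLists (m : ℕ) (Z : ∀ N, List (Candidate m N)) : Prop :=
  ∀ N, (∀ κ ∈ Z N, κ.Sound) ∧ ∀ M s q T, (∃ x C, LPFeasible s q 0 T M x C) → ∃ κ ∈ Z N, κ.M = M ∧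
    LPOptimal s q 0 T M (fun h i => lin (κ.x h i) (lpParam s q T))
      (fun h => lin (κ.C h) (lpParam s q T))

/-- The values of the valid rounds with guesses in `G`. -/
def roundValues (m : ℕ) (I : Instance) (K : ℕ) (G : Set (Fin m → ℕ)) : Set ℝ :=
  {v | ∃ r : Round m I.n, r.Valid I.s I.sorted K ∧ r.a ∈ G ∧ v = r.value I.s I.sorted K}

theorem wp_roundCmd (F : Fits m I d A W B N) (hK : K ≤ I.n) (henv : Env m I K σ) (i₀ : Fin m)
    {a : Fin m → ℕ} (ha : ∀ i, a i ≤ K) (ha7 : ∀ i : Fin m, σ.arr 7 i = a i) {c : ℕ}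
    (hA : c * (I.n + m * I.n + 1) + 1 ≤ A) {Z : ∀ N, List (Candidate m N)} {R : ℕ}
    (hZ : CandidateLists m Z) (hR : I.n - K ≤ R) (hgood : ∀ κ ∈ Z (I.n - K), κ.Good d c)
    (hb : BestState m I d A K V σ) :
    Cmd.wp B N (roundCmd Z R) (BestState m I d A K (V ∪ roundValues m I K {a})) σ := by
  refine Cmd.wp_seq (wp_listCmd F hK henv i₀ ha7) fun τ hτ hag => ?_
  have henvτ : Env m I K τ := henv.of_agree
    ⟨fun v hv => by simp only [Cmd.wreg, listCmd, selectCmd, or_false, false_or]; omega,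
      fun b hb => by simp only [Cmd.warr, listCmd, selectCmd, or_false, false_or]; omega⟩ hag
  have hbτ : BestState m I d A K V τ := hb.congr (hag.1 4 (by simp [Cmd.wreg, listCmd, selectCmd]))
    (hag.1 5 (by simp [Cmd.wreg, listCmd, selectCmd]))
    (hag.2 1 (by simp [Cmd.warr, listCmd, selectCmd]))
  clear hag
  refine ⟨trivial, trivial, fun h9 => ?_, fun h9 => ?_⟩
  · rcases hτ with ⟨h9', -⟩ | ⟨-, hno⟩
    · simp [Exp.eval, h9'] at h9
    · refine hbτ.mono ?_
      rintro v (hv | ⟨r, hr, rfl, -⟩)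
      · exact ⟨v, hv, le_rfl⟩
      · exact absurd hr.list (hno r.f)
  · rcases hτ with ⟨-, f, hf⟩ | ⟨h9', -⟩
    swap
    · simp [Exp.eval, h9'] at h9
    refine Cmd.wp_cases henvτ.n_eq henvτ.K_eq hR ?_
    refine Cmd.wp_mono (wp_candidates F hK ha hA _ (fun κ hκ => ⟨hgood κ hκ, (hZ _).1 κ hκ⟩) henvτ
      hf hbτ) fun ρ hρ => hρ.mono ?_
    rintro v (hv | ⟨r, hr, rfl, rfl⟩)
    · exact ⟨v, .inl hv, le_rfl⟩
    -- All valid rounds with the guess `a` have the same list schedule, hence the same linear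
    -- programs. For the machine sets of `r` some candidate is optimal, so its value is at most that
    -- of `r`.
    have hfr : ∀ k : Fin I.n, k.val < K → r.f k = f k := hr.list.unique hf.list
    have hload : listLoad (I.s : ℝ) I.sorted r.f K = listLoad I.s I.sorted f K := by
      funext i
      exact listLoad_congr hfr i
    have hopt := hr.lp
    rw [hload, lpOptimal_tail] at hopt
    obtain ⟨κ, hκ, hM, hκopt⟩ := (hZ (I.n - K)).2 _ _ _ _ ⟨_, _, hopt.1⟩
    refine ⟨(candidateRound I r.a f κ).value I.s I.sorted K, .inr ⟨κ, hκ, ?_, rfl⟩, ?_⟩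
    · rw [lpFeasible_candidateRound, hM]
      exact hκopt.1
    · have hle := hκopt.2 _ _ hopt.1
      rw [Round.value, Round.value, lpValue_tail, lpValue_tail r.C]
      simp only [candidateRound, extendTail_tailPos]
      have hsum : ∑ h : Fin I.n with h.val < K, listLoad (I.s : ℝ) I.sorted f (h.val + 1) (f h) =
          ∑ h : Fin I.n with h.val < K, listLoad (I.s : ℝ) I.sorted r.f (h.val + 1) (r.f h) := by
        refine Finset.sum_congr rfl fun h hh => ?_
        have hh' : h.val < K := (Finset.mem_filter.mp hh).2
        rw [hfr h hh']
        exact (listLoad_congr (fun k hk => hfr k (by omega)) _).symm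
      rw [hsum]
      exact add_le_add_right hle _

end Commands

end SplitSched

/-! ### The program: enumeration of the guesses, starting times, composition -/

namespace SplitSched

/-- The command `c` is executed for all values of the first `j` cells of array `7` up to the value
of variable `2`. -/
def guessCmd (c : Cmd) : ℕ → Cmd
  | 0 => c
  -- The nesting depth is `m`, a constant, and each loop takes `K + 1` values, so the number of
  -- rounds is polynomial.
  | j + 1 => .cfor (20 + j) 17 (.seq (.put 7 (.lit (j : ℕ)) (.var (20 + j))) (guessCmd c j))

theorem wreg_guessCmd {c : Cmd} {j v : ℕ} (h : (guessCmd c j).wreg v) :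
    c.wreg v ∨ (20 ≤ v ∧ v < 20 + j) := by
  induction j with
  | zero => exact .inl h
  | succ j ih =>
    rcases h with h | h | h
    · exact .inr (by omega)
    · exact h.elim
    · rcases ih h with h | h
      · exact .inl h
      · exact .inr (by omega)

theorem warr_guessCmd {c : Cmd} {j b : ℕ} (h : (guessCmd c j).warr b) : c.warr b ∨ b = 7 := by
  induction j with
  | zero => exact .inl h
  | succ j ih =>
    rcases h with h | h
    · exact .inr h
    · exact ih h

/-- The starting times of the parts. -/
def clockCmd (m : ℕ) : Cmd :=
  .cfor 12 16 (.seq (.set 8 (.lit 0)) (.cfor 11 0 (.seq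
    -- Variable `8` is the time up to which the machine is occupied. It is also written for empty
    -- parts, whose cells the output ignores, but it advances only for nonempty ones.
    (.put 2 (cellExp m (.var 11) (.var 12)) (.var 8))
    (.ite (.lit 0) (.get 1 (cellExp m (.var 11) (.var 12)))
      (.set 8 (.add (.var 8) (.add (.var 1) (.get 1 (cellExp m (.var 11) (.var 12)))))) .skip))))

/-- The whole program. -/
noncomputable def schemeCmd {m : ℕ} (Z : ∀ N, List (Candidate m N)) (R : ℕ) : Cmd :=
  .seq sortCmd (.seq (paramCmd m R) (.seq (guessCmd (roundCmd Z R) m) (clockCmd m)))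

section Commands

variable {m : ℕ} {I : Instance} {d A W B N K : ℕ} {σ : State} {V : Set ℝ}

theorem wp_guessCmd (F : Fits m I d A W B N) (hK : K ≤ I.n) (i₀ : Fin m) {c : ℕ}
    (hA : c * (I.n + m * I.n + 1) + 1 ≤ A) {Z : ∀ N, List (Candidate m N)} {R : ℕ}
    (hZ : CandidateLists m Z) (hR : I.n - K ≤ R) (hgood : ∀ κ ∈ Z (I.n - K), κ.Good d c) (j : ℕ)
    (hj : j ≤ m) {a : Fin m → ℕ} (henv : Env m I K σ)
    (ha : ∀ i : Fin m, j ≤ i.val → a i ≤ K ∧ σ.arr 7 i = a i) (hb : BestState m I d A K V σ) :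
    Cmd.wp B N (guessCmd (roundCmd Z R) j) (fun τ =>
      BestState m I d A K (V ∪ roundValues m I K {b | ∀ i : Fin m, j ≤ i.val → b i = a i}) τ ∧
      ∀ i : Fin m, j ≤ i.val → τ.arr 7 i = σ.arr 7 i) σ := by
  induction j generalizing σ V a with
  | zero =>
    refine Cmd.wp_mono (Cmd.wp_frame (wp_roundCmd F hK henv i₀ (fun i => (ha i (Nat.zero_le _)).1)
      (fun i => (ha i (Nat.zero_le _)).2) hA hZ hR hgood hb)) fun τ hτ => ⟨?_, fun i _ => ?_⟩
    · have : {b | ∀ i : Fin m, 0 ≤ i.val → b i = a i} = {a} := by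
        ext b
        simp [funext_iff]
      rw [this]
      exact hτ.1
    · rw [hτ.2.2 7 fun h => by have := warr_roundCmd h; omega]
  | succ j ih =>
    have hwreg : ∀ v, (guessCmd (roundCmd Z R) j).wreg v →
        (4 ≤ v ∧ v ≤ 15) ∨ v = 18 ∨ (20 ≤ v ∧ v < 20 + j) := by
      intro v hv
      rcases wreg_guessCmd hv with h | h
      · have := wreg_roundCmd h; omega
      · omega
    have hwarr : ∀ b, (guessCmd (roundCmd Z R) j).warr b → b = 1 ∨ b = 5 ∨ b = 6 ∨ b = 7 := by
      intro b hb
      rcases warr_guessCmd hb with h | h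
      · have := warr_roundCmd h; omega
      · omega
    let jF : Fin m := ⟨j, hj⟩
    -- Before pass `k`, the stored round is compared with all valid rounds whose guess for machine
    -- `j` is below `k` and agrees with `a` on the later machines.
    refine Cmd.wp_cfor (by omega) (fun h => ?_) (fun h => ?_) (K + 1) henv.succ_eq
      (by have := F.le_loop; omega) (fun k τ => BestState m I d A K (V ∪ roundValues m I K
        {b | (∀ i : Fin m, j + 1 ≤ i.val → b i = a i) ∧ b jF < k}) τ ∧
        ∀ i : Fin m, j + 1 ≤ i.val → τ.arr 7 i = σ.arr 7 i) ⟨hb.mono ?_, fun _ _ => rfl⟩ ?_ ?_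
    · rcases h with h | h
      · exact h
      · have := hwreg _ h; omega
    · rcases h with h | h
      · exact h
      · have := hwreg _ h; omega
    · rintro v (hv | ⟨r, -, hr, -⟩)
      · exact ⟨v, hv, le_rfl⟩
      · exact absurd hr.2 (Nat.not_lt_zero _)
    · rintro k hk τ ⟨hτ, h7⟩ hag
      have henvτ : Env m I K τ := henv.of_agree ⟨fun v hv h => by
        rcases h with h | h | h
        · omega
        · exact h
        · have := hwreg _ h; omega, fun b hb h => by
        rcases h with h | h
        · have : b = 7 := h
          omega
        · have := hwarr _ h; omega⟩ hag
      clear hag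
      refine ⟨trivial, trivial, j, rfl, ?_, ?_⟩
      · simpa [Exp.eval] using F.nat (by omega : k ≤ I.n + m + 1)
      have hev : (Exp.var (20 + j)).eval (τ.setReg (20 + j) k) = k := by simp [Exp.eval]
      rw [hev]
      set ρ := (τ.setReg (20 + j) k).setArr 7 j k with hρ
      have henvρ : Env m I K ρ := by
        have h := henvτ.setReg (v := 20 + j) (by omega) k
        exact ⟨h.n_eq, h.s_eq, h.K_eq, h.grid_eq, h.m_eq, h.succ_eq,
          fun i => by simpa [hρ] using h.perm_eq i, fun i => by simpa [hρ] using h.sorted_eq i⟩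
      have hρ7 : ∀ i : Fin m, j + 1 ≤ i.val → ρ.arr 7 i = σ.arr 7 i := by
        intro i hi
        have : i.val ≠ j := by omega
        simpa [hρ, this] using h7 i hi
      refine Cmd.wp_mono (ih (a := Function.update a jF k) (by omega) henvρ ?_
        (hτ.congr (by simp [hρ]; omega) (by simp [hρ]; omega) (by funext; simp [hρ]))) ?_
      · intro i hi
        by_cases e : i = jF
        · subst e
          simp [hρ, jF]
          omega
        · have hne : i.val ≠ j := fun e' => e (Fin.ext e')
          rw [hρ7 i (by omega), Function.update_of_ne e]
          exact ha i (by omega)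
      · rintro κ ⟨hκ, hκ7⟩
        refine ⟨hκ.mono ?_, fun i hi => by rw [hκ7 i (by omega), hρ7 i hi]⟩
        rintro v (hv | ⟨r, hr, ⟨h1, h2⟩, rfl⟩)
        · exact ⟨v, .inl (.inl hv), le_rfl⟩
        · rcases Nat.lt_succ_iff_lt_or_eq.mp h2 with h3 | h3
          · exact ⟨_, .inl (.inr ⟨r, hr, ⟨h1, h3⟩, rfl⟩), le_rfl⟩
          · refine ⟨_, .inr ⟨r, hr, fun i hi => ?_, rfl⟩, le_rfl⟩
            by_cases e : i = jF
            · subst e; simpa using h3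
            · have hne : i.val ≠ j := fun e' => e (Fin.ext e')
              rw [Function.update_of_ne e]
              exact h1 i (by omega)
    · rintro τ ⟨hτ, h7⟩ -
      refine ⟨(hτ.mono ?_).congr (by simp; omega) (by simp; omega) rfl, h7⟩
      rintro v (hv | ⟨r, hr, h1, rfl⟩)
      · exact ⟨v, .inl hv, le_rfl⟩
      -- Valid rounds only guess numbers up to `K`, so the `K + 1` passes cover them all.
      · exact ⟨_, .inr ⟨r, hr, ⟨h1, Nat.lt_succ_of_le (hr.guess_le jF)⟩, rfl⟩, le_rfl⟩

theorem wp_clockCmd (F : Fits m I d A W B N) (henv : Env m I K σ) {y : Fin I.n → Fin m → ℝ}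
    (hy : ∀ (h : Fin I.n) (i : Fin m), (σ.arr 1 ((I.perm h).val * m + i.val) : ℝ) = y h i)
    (hadm : ∀ (h : Fin I.n) (i : Fin m), Adm I d A (σ.arr 1 ((I.perm h).val * m + i.val))) :
    Cmd.wp B N (clockCmd m) (fun τ => ∀ (h : Fin I.n) (i : Fin m),
      (τ.arr 2 ((I.perm h).val * m + i.val) : ℝ) =
        ∑ k with k.val < h.val, if 0 < y k i then (I.s : ℝ) + y k i else 0) σ := by
  refine Cmd.wp_cfor (by decide) (by simp [Cmd.wreg]) (by simp [Cmd.wreg]) m henv.m_eq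
    (by have := F.le_loop; omega) (fun l τ => ∀ (h : Fin I.n) (i : Fin m), i.val < l →
      (τ.arr 2 ((I.perm h).val * m + i.val) : ℝ) =
        ∑ k with k.val < h.val, if 0 < y k i then (I.s : ℝ) + y k i else 0)
    (fun h i hi => absurd hi (Nat.not_lt_zero _)) ?_ (fun τ hτ _ h i => hτ h i i.2)
  intro l hl τ hτ hag
  let lF : Fin m := ⟨l, hl⟩
  have henvτ : Env m I K τ := henv.of_agree
    ⟨fun v hv => by simp only [Cmd.wreg, or_false, false_or]; omega,
      fun b hb => by simp only [Cmd.warr, or_false, false_or]; omega⟩ hag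
  have h1τ : τ.arr 1 = σ.arr 1 := hag.2 1 (by simp [Cmd.warr])
  clear hag
  refine ⟨trivial, F.zero, ?_⟩
  refine Cmd.wp_cfor (by decide) (by simp [Cmd.wreg]) (by simp [Cmd.wreg]) I.n
    (by simp [henvτ.n_eq]) (by have := F.le_loop; omega) (fun h ρ =>
      (∀ (h' : Fin I.n) (i : Fin m), i.val < l ∨ (i = lF ∧ h'.val < h) →
        (ρ.arr 2 ((I.perm h').val * m + i.val) : ℝ) =
          ∑ k with k.val < h'.val, if 0 < y k i then (I.s : ℝ) + y k i else 0) ∧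
      (ρ.reg 8 : ℝ) = (∑ k : Fin I.n with k.val < h, if 0 < y k lF then (I.s : ℝ) + y k lF else 0) ∧
      Adm I d (h * (A + 1)) (ρ.reg 8)) ⟨?_, ?_, ?_⟩ ?_ ?_
  · rintro h' i (hi | hi)
    · exact hτ h' i hi
    · exact absurd hi.2 (Nat.not_lt_zero _)
  · simp [Exp.eval]
  · simpa [Exp.eval] using Adm.zero
  · rintro h hh ρ ⟨h2, h8, h8adm⟩ hag
    let hF : Fin I.n := ⟨h, hh⟩
    have henvρ : Env m I K ρ := ((henvτ.setReg (by decide) _).setReg (by decide) _).of_agree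
      ⟨fun v hv => by simp only [Cmd.wreg, or_false, false_or]; omega,
        fun b hb => by simp only [Cmd.warr, or_false]; omega⟩ hag
    have h1ρ : ρ.arr 1 = σ.arr 1 := by rw [hag.2 1 (by simp [Cmd.warr])]; exact h1τ
    have h12 : ρ.reg 12 = l := by rw [hag.1 12 (by simp [Cmd.wreg])]; simp
    clear hag
    have e3 : ρ.arr 3 h = (I.perm hF).val := henvρ.perm_eq hF
    have hcell : ∀ ρ' : State, ρ'.reg 11 = h → ρ'.reg 12 = l → ρ'.arr 3 = ρ.arr 3 →
        (cellExp m (.var 11) (.var 12)).eval ρ' = ((I.perm hF).val * m + l : ℕ) := by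
      intro ρ' h1 h2 h3
      simp [cellExp, Exp.eval, h1, h2, h3, e3]
    have hcellok : ∀ ρ' : State, ρ'.reg 11 = h → (cellExp m (.var 11) (.var 12)).ok ρ' :=
      fun ρ' h1 => ⟨⟨⟨trivial, h, h1⟩, trivial⟩, trivial⟩
    have hhW : (h + 1) * (A + 1) ≤ W :=
      (Nat.mul_le_mul_right _ (by omega)).trans F.clock_le_weight
    have hB8 : bitLength (ρ.reg 8) ≤ B :=
      F.bitLength_le _ (h8adm.mono ((Nat.mul_le_mul_right _ (by omega)).trans hhW))
    have hr11 : (ρ.setReg 11 h).reg 11 = h := by simp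
    have hr12 : (ρ.setReg 11 h).reg 12 = l := by simp [h12]
    have hr8 : (ρ.setReg 11 h).reg 8 = ρ.reg 8 := by simp
    refine ⟨hcellok _ hr11, trivial, (I.perm hF).val * m + l, hcell _ hr11 hr12 rfl,
      by simpa [Exp.eval] using hB8, ?_⟩
    set κ := (ρ.setReg 11 h).setArr 2 ((I.perm hF).val * m + l)
      ((Exp.var 8).eval (ρ.setReg 11 h)) with hκ
    have hκ8 : κ.reg 8 = ρ.reg 8 := by simp [hκ]
    have hκ1 : κ.reg 1 = I.s := by simp [hκ, henvρ.s_eq]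
    have hκc : (cellExp m (.var 11) (.var 12)).eval κ = ((I.perm hF).val * m + l : ℕ) :=
      hcell κ (by simp [hκ]) (by simp [hκ, h12]) (by funext; simp [hκ])
    have hκok : (cellExp m (.var 11) (.var 12)).ok κ := hcellok κ (by simp [hκ])
    have hκget : (Exp.get 1 (cellExp m (.var 11) (.var 12))).eval κ =
        σ.arr 1 ((I.perm hF).val * m + l) := by
      change κ.arr 1 ⌊(cellExp m (.var 11) (.var 12)).eval κ⌋₊ = _
      rw [hκc, Nat.floor_natCast, ← h1ρ]
      simp [hκ]
    have hκ2 : ∀ (h' : Fin I.n) (i : Fin m), i.val < l ∨ (i = lF ∧ h'.val < h + 1) →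
        (κ.arr 2 ((I.perm h').val * m + i.val) : ℝ) =
          ∑ k with k.val < h'.val, if 0 < y k i then (I.s : ℝ) + y k i else 0 := by
      intro h' i hi
      rw [hκ, State.setArr_arr]
      split_ifs with hc
      · obtain ⟨e1, rfl⟩ := cell_injective (i' := lF) hc.2
        obtain rfl := I.perm.injective e1
        simp only [Exp.eval, hr8]
        exact h8
      · refine h2 h' i ?_
        rcases hi with hi | ⟨rfl, hi⟩
        · exact .inl hi
        · rcases Nat.lt_succ_iff_lt_or_eq.mp hi with h3 | h3
          · exact .inr ⟨rfl, h3⟩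
          · obtain rfl : h' = hF := Fin.ext h3
            exact absurd ⟨rfl, rfl⟩ hc
    clear_value κ
    have hyF := hy hF lF
    have hsum := sum_filter_lt_succ (fun k => if 0 < y k lF then (I.s : ℝ) + y k lF else 0) hF
    rw [show hF.val = h from rfl] at hsum
    have hpos : 0 < σ.arr 1 ((I.perm hF).val * m + l) ↔ 0 < y hF lF := by
      rw [← hyF]; simp [lF]
    refine ⟨trivial, ⟨hκok, _, hκc⟩, fun hlt => ?_, fun hlt => ?_⟩
    · rw [hκget] at hlt
      have hev : (Exp.add (.var 8) (.add (.var 1) (.get 1 (cellExp m (.var 11) (.var 12))))).eval κ =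
          ρ.reg 8 + (I.s + σ.arr 1 ((I.perm hF).val * m + l)) := by
        change κ.reg 8 + (κ.reg 1 + (Exp.get 1 (cellExp m (.var 11) (.var 12))).eval κ) = _
        rw [hκget, hκ8, hκ1]
      have hadm' : Adm I d ((h + 1) * (A + 1)) (ρ.reg 8 + (I.s + σ.arr 1 ((I.perm hF).val * m + l))) :=
        (h8adm.add ((adm_s I).of_one.add (hadm hF lF))).mono (by ring_nf; rfl)
      refine ⟨⟨trivial, trivial, hκok, _, hκc⟩, ?_, hκ2, ?_, ?_⟩
      · rw [hev]
        exact F.bitLength_le _ (hadm'.mono hhW)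
      · rw [hev, hsum, if_pos (hpos.mp hlt), ← h8, ← hyF]
        simp [lF]
      · rw [hev]
        simpa using hadm'
    · rw [hκget] at hlt
      refine ⟨hκ2, ?_, ?_⟩
      · rw [hκ8, hsum, if_neg fun h => hlt (hpos.mpr h), add_zero, h8]
      · rw [hκ8]
        exact h8adm.mono (Nat.mul_le_mul_right _ (by omega))
  · rintro ρ ⟨h2, -, -⟩ - h i hi
    refine h2 h i ?_
    rcases Nat.lt_succ_iff_lt_or_eq.mp hi with h3 | h3
    · exact .inl h3
    · exact .inr ⟨Fin.ext h3, h.2⟩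

end Commands

end SplitSched

/-! ### Correctness and running time of the whole program -/

namespace SplitSched

theorem Round.startTime_eq {m n : ℕ} (s : ℝ) (q : Fin n → ℝ) (K : ℕ) (r : Round m n) (h : Fin n)
    (i : Fin m) : r.startTime s q K h i =
      ∑ k with k.val < h.val, if 0 < r.amount q K k i then s + r.amount q K k i else 0 := by
  rw [Round.startTime, Finset.sum_filter, Finset.sum_filter]
  refine Finset.sum_congr rfl fun k _ => ?_
  simp only [Fin.lt_def, ite_and]

theorem monotone_sorted (I : Instance) : Monotone I.sorted := fun _ _ h => by
  exact_mod_cast Tuple.monotone_sort I.p h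

/-- A stored round of least value can be completed to a best round. -/
theorem BestState.exists_isBest {m : ℕ} (hm : 1 ≤ m) {ε : ℝ} (hε : 0 < ε) {I : Instance} {d A : ℕ}
    {τ : State} (h : BestState m I d A (numFirst m ε I.n)
      (roundValues m I (numFirst m ε I.n) Set.univ) τ) :
    ∃ r : Round m I.n, r.IsBest I.s I.sorted (numFirst m ε I.n) ∧
      RoundState I d A (numFirst m ε I.n) r τ := by
  obtain ⟨r₀, hr₀⟩ := exists_valid_round hm hε I (monotone_sorted I)
  rcases h with ⟨-, h⟩ | ⟨-, r, hr, hle⟩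
  · exact absurd ⟨r₀, hr₀, Set.mem_univ _, rfl⟩ (Set.eq_empty_iff_forall_notMem.mp h (r₀.value _ _ _))
  · refine ⟨r, ⟨⟨hr.guess_le, hr.list, hr.lp, fun x' C' h' => ?_⟩,
      fun r' hr' => hle _ ⟨r', hr', Set.mem_univ _, rfl⟩⟩, hr⟩
    -- The stored round is at most as expensive as the valid round with the same guesses and an
    -- optimal solution of the same linear program. The list scheduled jobs cost the same in both,
    -- so the stored solution is optimal itself.
    obtain ⟨x, C, hopt⟩ := hr.lp.exists_optimal
    have := hle _ ⟨⟨r.a, r.f, r.M, x, C⟩, ⟨hr.guess_le, hr.list, hopt⟩, Set.mem_univ _, rfl⟩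
    simp only [Round.value] at this
    have h2 := hopt.2 x' C' h'
    linarith

theorem wp_schemeCmd {m : ℕ} (hm : 1 ≤ m) {ε : ℝ} (hε : 0 < ε) {I : Instance} {d A W B N : ℕ}
    (F : Fits m I d A W B N) {c : ℕ} (hA : c * (I.n + m * I.n + 1) + 1 ≤ A)
    {Z : ∀ N, List (Candidate m N)} (hZ : CandidateLists m Z)
    (hgood : ∀ N ≤ ⌈(m : ℝ) / ε⌉₊, ∀ κ ∈ Z N, κ.Good d c) {σ : State} (h0 : σ.reg 0 = I.n)
    (h1 : σ.reg 1 = I.s) (hp : ∀ j : Fin I.n, σ.arr 0 j = I.p j) :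
    Cmd.wp B N (schemeCmd Z ⌈(m : ℝ) / ε⌉₊)
      (fun τ => IsSchemeOutput ε I (outputSchedule m I.n τ)) σ := by
  set R := ⌈(m : ℝ) / ε⌉₊ with hR
  have hK : numFirst m ε I.n = I.n - R := rfl
  refine Cmd.wp_seq (wp_sortCmd F h0 hp) fun τ hτ hag => ?_
  refine Cmd.wp_seq (wp_paramCmd F R (by rw [hag.1 0 (by simp [Cmd.wreg, sortCmd]), h0])
    (by rw [hag.1 1 (by simp [Cmd.wreg, sortCmd]), h1]) (fun h => (hτ h).1) fun h => (hτ h).2) ?_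
  rintro ρ ⟨henv, h5⟩ -
  refine Cmd.wp_seq (wp_guessCmd F (Nat.sub_le _ _) ⟨0, hm⟩ hA hZ (by omega)
    (hgood _ (by omega)) m le_rfl (a := 0) (V := ∅) henv (fun i hi => absurd i.2 hi.not_gt)
    (.inl ⟨h5, rfl⟩)) fun κ hκ hag => ?_
  have henvκ : Env m I (I.n - R) κ := henv.of_agree ⟨fun v hv h => by
      rcases wreg_guessCmd h with h | h
      · have := wreg_roundCmd h; omega
      · omega, fun b hb h => by
      rcases warr_guessCmd h with h | h
      · have := warr_roundCmd h; omega
      · omega⟩ hag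
  -- With all `m` loops in place no guess is prescribed, so all valid rounds are covered.
  have huniv : {b : Fin m → ℕ | ∀ i : Fin m, m ≤ i.val → b i = (0 : Fin m → ℕ) i} = Set.univ :=
    Set.eq_univ_of_forall fun b i hi => absurd i.2 hi.not_gt
  have hbest := hκ.1
  rw [huniv, Set.empty_union, ← hK] at hbest
  obtain ⟨r, hr, hrs⟩ := hbest.exists_isBest hm hε
  refine Cmd.wp_mono (Cmd.wp_frame (wp_clockCmd F henvκ hrs.amount_eq hrs.amount_adm)) ?_
  rintro χ ⟨hχ, hag⟩
  refine ⟨I.perm, I.sorted, numFirst m ε I.n, r, rfl, monotone_sorted I, rfl, hr, ?_⟩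
  have h1χ : χ.arr 1 = κ.arr 1 := hag.2 1 (by simp [Cmd.warr, clockCmd])
  rw [outputSchedule]
  congr 1
  · funext j i
    rw [h1χ, ← hrs.amount_eq, Equiv.apply_symm_apply]
  · funext j i
    rw [Round.startTime_eq, ← hχ, Equiv.apply_symm_apply]

/-- The scheme is carried out by a program in polynomial time. -/
theorem exists_scheme_program (m : ℕ) (hm : 1 ≤ m) (ε : ℝ) (hε : 0 < ε) :
    ∃ (A : Prog) (P : Polynomial ℕ), ∀ I : Instance, ∃ (S : State) (t : ℕ),
      Exec A I.input S t ∧ t ≤ P.eval I.size ∧ IsSchemeOutput ε I (outputSchedule m I.n S) := by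
  choose Z hZ using Candidate.exists_list m
  obtain ⟨d, c, hd, hgood⟩ := Candidate.exists_good Z ⌈(m : ℝ) / ε⌉₊
  obtain ⟨T, hT⟩ := Cmd.exists_polynomial_time (schemeCmd Z ⌈(m : ℝ) / ε⌉₊)
  let X : Polynomial ℕ := Polynomial.X
  -- `PA`, `PW` and `PB` bound the weight of the solutions of linear programs, the weight of all
  -- numbers and their bit length, in terms of the size of the instance. The constants `c` and `d`
  -- depend only on `m` and `ε`.
  let PA : Polynomial ℕ := Polynomial.C c * (X + Polynomial.C m * X + 1) + 1
  let PW : Polynomial ℕ := X * X + (X + 1) * (PA + 1) + X + Polynomial.C m + 1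
  let PB : Polynomial ℕ := PW + Polynomial.C (2 * d) + Polynomial.C 3 * X + Polynomial.C 3
  -- The input has the setup time in register `1`, but variable `1` is kept in register `2`.
  -- Register `3` is zero initially, so the addition copies it. Variable `0`, the number of jobs, is
  -- already in place.
  refine ⟨.seq (.arith .add 2 1 3) (schemeCmd Z ⌈(m : ℝ) / ε⌉₊).compile,
    X + Polynomial.C 3 + T.comp (X + Polynomial.C (m + 1)) * PB, fun I => ?_⟩
  obtain ⟨x, hx⟩ : ∃ x, x = I.size := ⟨_, rfl⟩
  obtain ⟨A, hA⟩ : ∃ A, A = c * (x + m * x + 1) + 1 := ⟨_, rfl⟩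
  obtain ⟨W, hW⟩ : ∃ W, W = x * x + (x + 1) * (A + 1) + x + m + 1 := ⟨_, rfl⟩
  obtain ⟨B, hB⟩ : ∃ B, B = W + 2 * d + 3 * x + 3 := ⟨_, rfl⟩
  have hn : I.n ≤ x := hx ▸ I.n_le_size
  have hfits : Fits m I d A W B (x + m + 1) := by
    refine ⟨fun y hy => hB ▸ hx ▸ hy.bitLength_le hd, by omega, ?_, ?_, by omega⟩
    · have := Nat.mul_le_mul hn hn
      nlinarith
    · have := Nat.mul_le_mul_right (A + 1) hn
      nlinarith
  have hA' : c * (I.n + m * I.n + 1) + 1 ≤ A := by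
    have h1 := Nat.mul_le_mul_left m hn
    have h2 : c * (I.n + m * I.n + 1) ≤ c * (x + m * x + 1) := Nat.mul_le_mul_left _ (by omega)
    omega
  have hloop : ∀ i ≤ x + m + 1, bitLength (i : ℚ) ≤ B := fun i hi =>
    hfits.bitLength_le _ (Adm.nat (by nlinarith))
  let S₀ : State := I.input.setReg 2 (Op.add.eval (I.input.reg 1) (I.input.reg 3))
  have hS₀ : ∀ v, S₀.reg v = if v = 0 then (I.n : ℚ) else if v = 1 ∨ v = 2 then I.s else 0 := by
    intro v
    by_cases h : v = 2
    · simp [S₀, h, Op.eval, Instance.input]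
    · simp [S₀, h, Instance.input]
  let σ : State := ⟨fun v => S₀.reg (2 * v), S₀.arr⟩
  have hbdd : σ.Bdd B := by
    refine ⟨fun v => ?_, fun b k => ?_⟩
    · change bitLength (S₀.reg (2 * v)) ≤ B
      rw [hS₀]
      split_ifs
      · exact hfits.nat (by omega)
      · exact hfits.adm (adm_s I) (by omega)
      · exact hfits.zero
    · change bitLength (I.input.arr b k) ≤ B
      unfold Instance.input
      dsimp only
      split_ifs
      · exact hfits.adm (adm_p I _) (by omega)
      · exact hfits.zero
  obtain ⟨τ, S, t, hexec, ht, hrel, -, hout⟩ := Cmd.exec_compile hloop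
    (wp_schemeCmd hm hε hfits hA' hZ hgood (σ := σ) (by change S₀.reg 0 = _; simp [hS₀])
      (by change S₀.reg 2 = _; simp [hS₀]) (fun j => by
        change I.input.arr 0 j = _
        simp [Instance.input])) hbdd (S := S₀) ⟨fun v => rfl, rfl⟩
  have hS : outputSchedule m I.n S = outputSchedule m I.n τ := by
    rw [outputSchedule, outputSchedule, hrel.2]
  refine ⟨S, _, .seq (.arith I.input .add 2 1 3) hexec, ?_, ?_⟩
  · have h1 : 1 + bitLength (I.input.reg 1) + bitLength (I.input.reg 3) ≤ x + 3 := by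
      have e1 : I.input.reg 1 = I.s := by simp [Instance.input]
      have e3 : I.input.reg 3 = 0 := by simp [Instance.input]
      rw [e1, e3, bitLength_zero, hx, Instance.size]
      omega
    have h2 : (X + Polynomial.C 3 + T.comp (X + Polynomial.C (m + 1)) * PB).eval I.size =
        x + 3 + T.eval (x + m + 1) * B := by
      simp only [X, PB, PW, PA, Polynomial.eval_add, Polynomial.eval_mul, Polynomial.eval_comp,
        Polynomial.eval_X, Polynomial.eval_C, Polynomial.eval_one, ← hx, hB, hW, hA]
      ring_nf
    rw [h2, ← hT]
    exact Nat.add_le_add h1 ht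
  · rw [hS]
    exact hout

end SplitSched

theorem mainTheorem4 (m : ℕ) (hm : 1 ≤ m) (ε : ℝ) (hε : 0 < ε) :
    ∃ (A : SplitSched.Prog) (P : Polynomial ℕ), ∀ I : SplitSched.Instance,
      ∃ (S : SplitSched.State) (t : ℕ),
        SplitSched.Exec A I.input S t ∧ t ≤ P.eval I.size ∧
        SplitSched.IsFeasible I (SplitSched.outputSchedule m I.n S) ∧
        SplitSched.IsSchemeOutput ε I (SplitSched.outputSchedule m I.n S) ∧
        SplitSched.totalCompletionTime I (SplitSched.outputSchedule m I.n S) ≤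
          (1 + 5 * ε) * SplitSched.OPT m I := by
  obtain ⟨A, P, h⟩ := SplitSched.exists_scheme_program m hm ε hε
  refine ⟨A, P, fun I => ?_⟩
  obtain ⟨S, t, hexec, ht, hout⟩ := h I
  exact ⟨S, t, hexec, ht, (hout.guarantee hm hε).1, hout, (hout.guarantee hm hε).2⟩
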